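/- All graphs are finite and simple. For $X\subseteq V(G)$ write $\chi(X)=\chi(G[X])$. For $\delta\ge 1$ let $T(\delta)$ be the tree obtained from the disjoint union of $\delta$ $(1,\delta)$-brooms and $\delta$ $(2,\delta)$-brooms by identifying their handles, where a $(k,\delta)$-broom is a path with $k$ edges together with $\delta$ new leaves adjacent to one of its ends, and its handle is the other end of the path. A graph is $T(\delta)$-free if it has no induced subgraph isomorphic to $T(\delta)$. Let $\chi^2(G)$ be the maximum over all vertices $v$ of $\chi(N^2[v])$, where $N^2[v]$ is the set of vertices at distance at most $2$ from $v$ (and $\chi^2(G)=0$ if $G$ has no vertices). A set $X\subseteq V(G)$ is matching-covered in $G$ if each $x\in X$ has a neighbour $y\in V(G)\setminus X$ that is adjacent to no other vertex of $X$. For integers $a,b\ge 1$, an $(a,b)$-core in $G$ is a set $Y\subseteq V(G)$ of cardinality $ab$ that admits a partition into $b$ stable sets $A_1,\ldots,A_b$ of cardinality $a$ such that every vertex of $A_i$ is adjacent to every vertex of $A_j$ for $1\le i<j\le b$. **Theorem.** For all integers $\tau\ge 0$, $\alpha,\delta\ge 1$ and $\beta\ge 2$, and every non-decreasing function $\theta:\mathbb{N}\to\mathbb{N}$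 (where $0\in\mathbb{N}$), there exists $c$ such that every graph $G$ satisfying (i) $G$ is $T(\delta)$-free; (ii) $\chi^2(G)\le\tau$; (iii) every matching-covered set in $G$ has chromatic number at most $\tau$; (iv) for all integers $a\ge 1$, if $\chi(G)>\theta(a)$ then $G$ admits an $(a,\beta)$-core; (v) $G$ does not admit an $(\alpha,\beta+1)$-core has $\chi(G)\le c$. -/

import Mathlib

namespace Multibroom

/-- Vertices of the tree `T δ`: the common handle of all the brooms; for each of the `δ` brooms of
length one, its hub (the end of the path other than the handle) and its `δ` leaves; for each of
the `δ` brooms of length two, the middle vertex of its path, its hub and its `δ` leaves. -/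
inductive TVertex (δ : ℕ) : Type
  | handle : TVertex δ
  | hubOne (i : Fin δ) : TVertex δ
  | leafOne (i j : Fin δ) : TVertex δ
  | midTwo (i : Fin δ) : TVertex δ
  | hubTwo (i : Fin δ) : TVertex δ
  | leafTwo (i j : Fin δ) : TVertex δ

/-- `IsParent u v` means that `u` is the parent of `v` in `T δ`, rooted at the handle. -/
inductive IsParent {δ : ℕ} : TVertex δ → TVertex δ → Prop
  | handle_hubOne (i : Fin δ) : IsParent .handle (.hubOne i)
  | hubOne_leafOne (i j : Fin δ) : IsParent (.hubOne i) (.leafOne i j)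
  | handle_midTwo (i : Fin δ) : IsParent .handle (.midTwo i)
  | midTwo_hubTwo (i : Fin δ) : IsParent (.midTwo i) (.hubTwo i)
  | hubTwo_leafTwo (i j : Fin δ) : IsParent (.hubTwo i) (.leafTwo i j)

/-- The tree `T(δ)`, obtained from the disjoint union of `δ` brooms of length one and `δ` brooms of
length two, each with `δ` leaves different from its handle, by identifying their handles. -/
def T (δ : ℕ) : SimpleGraph (TVertex δ) :=
  SimpleGraph.fromRel IsParent

/-- `G` is `H`-free: no induced subgraph of `G` is isomorphic to `H`. -/
def IsFree {V W : Type*} (G : SimpleGraph V) (H : SimpleGraph W) : Prop :=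
  ¬ H.IsIndContained G

/-- The chromatic number `χ(X)` of the subgraph of `G` induced on the set `X` of vertices. -/
noncomputable def chi {V : Type*} (G : SimpleGraph V) (X : Set V) : ℕ∞ :=
  (G.induce X).chromaticNumber

/-- The set `N^k[v]` of all vertices at distance at most `k` from `v`. -/
def closedBall {V : Type*} (G : SimpleGraph V) (k : ℕ) (v : V) : Set V :=
  {w | G.edist v w ≤ (k : ℕ∞)}

/-- `χ^k(G)`: the maximum of `χ(N^k[v])` over all vertices `v` (and `0` for the null graph). -/
noncomputable def chiBall {V : Type*} (G : SimpleGraph V) (k : ℕ) : ℕ∞ :=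
  ⨆ v : V, chi G (closedBall G k v)

/-- `X` is matching-covered in `G`: each `x ∈ X` has a neighbour `y ∉ X` that is adjacent to no
other vertex of `X`. -/
def IsMatchingCovered {V : Type*} (G : SimpleGraph V) (X : Set V) : Prop :=
  ∀ x ∈ X, ∃ y, y ∉ X ∧ G.Adj y x ∧ ∀ z ∈ X, G.Adj y z → z = x

/-- `Y` is an `(a, b)`-core in `G`: it has `a * b` vertices and is partitioned into stable sets
`A 0, …, A (b - 1)` of size `a`, any two of which are completely adjacent. -/
def IsCore {V : Type*} (G : SimpleGraph V) (a b : ℕ) (Y : Finset V) : Prop :=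
  Y.card = a * b ∧
    ∃ A : Fin b → Finset V,
      (Y : Set V) = (⋃ i, (A i : Set V)) ∧
      (∀ i j, i ≠ j → Disjoint (A i) (A j)) ∧
      (∀ i, (A i).card = a) ∧
      (∀ i, G.IsIndepSet (A i : Set V)) ∧
      (∀ i j, i < j → ∀ u ∈ A i, ∀ v ∈ A j, G.Adj u v)

/-- `G` admits an `(a, b)`-core. -/
def AdmitsCore {V : Type*} (G : SimpleGraph V) (a b : ℕ) : Prop :=
  ∃ Y : Finset V, IsCore G a b Y

end Multibroom

/-!
The core number `β` is the subject of an induction: sets without a complete `(β + 1)`-partite induced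
subgraph with parts of size `α` have bounded chromatic number, for every `α`. All colourings are of
sets of vertices of one fixed graph (`ColorableOn`), and "bounded" properties are stated by means of
finite sets (`Few`). The inductive statement is `exists_forall_colorableOn`. In the
step, sets without a complete `β`-partite induced subgraph with much larger parts of bounded size may
be regarded as already coloured, and sets that contain one are attacked through it.

For two parts, a graph in which large bicliques are missing is coloured unless the tree can be grown
by one level at a time (`NoBiclique.colorableOn`). A family of small trees at the neighbours of a
vertex `u` is made pairwise apart by Ramsey's theorem; only positions in which all the trees share
a vertex are lost, and these are few because there are no large bicliques.

In the induction step, cores are chosen greedily in a set `U`, and the neighbours of the vertices that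
are strong (many neighbours in some part) but not dense (many non-neighbours in some part) to a
chosen core are removed before the next core is chosen (`Greedy`). A vertex that touches many cores
weakly is the root of the tree, and few vertices are dense to a core, as they would provide another
part. So, up to a remainder of bounded chromatic number, `U` is the union of two sets, of which each
carries a `Layer` of `U`: each vertex is adjacent to a hub of some core, and through it sees a broom in
this core, but touches the hubs and vertices of only few cores. It remains to colour the top
of a high tower of layers (`colorableOn_of_tower`); the descent to `U` is
`colorableOn_of_partial_tower`.

In each layer, a hub is chosen for every vertex of the top. Repeated choices of minimal dominating
sets of hubs give every hub many private neighbours; the vertices lost on the way are covered by few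
matching-covered sets (`Layer.exists_refined`). The index of the core chosen in layer `r` partitions
the top into pieces. A vertex cannot have many neighbours whose indices differ in many layers, as their
hubs serve as leaves and their brooms as brooms of the tree (`Nest.few_adj`). Similarly a piece of one
layer cannot contain many vertices with different indices in lower layers, as the tree can then be
rooted in the core of the piece (`Nest.isIndContained_of_root`). Hence, after the loss of a bounded
factor, the indices in a chain of layers determine one another (`Nest.colorableOn_of_chain`), and the
pieces of the lowest of these layers are such that every vertex touches few of them. In this
situation a piece sends only edges of two kinds to later pieces: those to pieces in which
the earlier end has few neighbours, which form a relation of bounded outdegree, and those to boundedly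
many pieces (`Nest.EdgeFamily.card_lt`), after vertices are classified by the numbers of pieces in which
they have many neighbours. This gives the colouring (`Nest.colorableOn_of_determined`).
-/

namespace Multibroom

universe u

/-! ### Bounded sets and colourings -/

/-- `ColorableOn R X k`: the set `X` can be coloured with `k` colours so that `R`-related members of
`X` get different colours. -/
def ColorableOn {V : Type*} (R : V → V → Prop) (X : Set V) (k : ℕ) : Prop :=
  ∃ f : V → ℕ, (∀ v ∈ X, f v < k) ∧ ∀ u ∈ X, ∀ v ∈ X, R u v → f u ≠ f v

/-- `Few D P`: at most `D` objects satisfy `P`, expressed through a finite set that contains them. -/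
def Few {α : Type*} (D : ℕ) (P : α → Prop) : Prop :=
  ∃ F : Finset α, F.card ≤ D ∧ ∀ a, P a → a ∈ F

section Few
variable {α β : Type*}

theorem Few.mono {D D' : ℕ} {P Q : α → Prop} (h : Few D P) (hD : D ≤ D') (hQ : ∀ a, Q a → P a) :
    Few D' Q := by
  obtain ⟨F, hF, h⟩ := h
  exact ⟨F, hF.trans hD, fun a ha => h a (hQ a ha)⟩

theorem few_mem (F : Finset α) : Few F.card (fun a => a ∈ F) := ⟨F, le_rfl, fun _ h => h⟩

theorem few_false {P : α → Prop} (h : ∀ a, ¬ P a) : Few 0 P :=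
  ⟨∅, by simp, fun a ha => (h a ha).elim⟩

theorem Few.or {D D' : ℕ} {P Q : α → Prop} (h : Few D P) (h' : Few D' Q) :
    Few (D + D') (fun a => P a ∨ Q a) := by
  classical
  obtain ⟨F, hF, h⟩ := h
  obtain ⟨F', hF', h'⟩ := h'
  refine ⟨F ∪ F', (Finset.card_union_le _ _).trans (by omega), fun a ha => ?_⟩
  rcases ha with ha | ha
  · exact Finset.mem_union_left _ (h a ha)
  · exact Finset.mem_union_right _ (h' a ha)

theorem Few.image {D : ℕ} {P : α → Prop} (h : Few D P) (g : α → β) :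
    Few D (fun b => ∃ a, P a ∧ g a = b) := by
  classical
  obtain ⟨F, hF, h⟩ := h
  refine ⟨F.image g, Finset.card_image_le.trans hF, ?_⟩
  rintro _ ⟨a, ha, rfl⟩
  exact Finset.mem_image_of_mem g (h a ha)

theorem Few.bind {D : ℕ} (S : Finset α) {P : α → β → Prop} (h : ∀ a ∈ S, Few D (P a)) :
    Few (S.card * D) (fun b => ∃ a ∈ S, P a b) := by
  classical
  choose! F hF h using h
  refine ⟨S.biUnion F, Finset.card_biUnion_le.trans ?_, ?_⟩
  · calc ∑ a ∈ S, (F a).card ≤ ∑ a ∈ S, D := Finset.sum_le_sum hF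
      _ = S.card * D := by simp
  · rintro b ⟨a, ha, hb⟩
    exact Finset.mem_biUnion.2 ⟨a, ha, h a ha b hb⟩

theorem Few.bind_few {D E : ℕ} {Q : α → Prop} (hQ : Few E Q) {P : α → β → Prop}
    (h : ∀ a, Q a → Few D (P a)) : Few (E * D) (fun b => ∃ a, Q a ∧ P a b) := by
  classical
  obtain ⟨F, hF, hQ⟩ := hQ
  refine (Few.bind (F.filter Q) (P := P) (D := D) fun a ha => h a (Finset.mem_filter.1 ha).2).mono
    ?_ ?_
  · exact Nat.mul_le_mul_right _ ((Finset.card_filter_le _ _).trans hF)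
  · rintro b ⟨a, ha, hb⟩
    exact ⟨a, Finset.mem_filter.2 ⟨hQ a ha, ha⟩, hb⟩

theorem Few.preimage {D : ℕ} {Q : β → Prop} (h : Few D Q) {P : α → Prop} (g : α → β)
    (hg : ∀ a, P a → ∀ b, P b → g a = g b → a = b) : Few D (fun a => P a ∧ Q (g a)) := by
  classical
  obtain ⟨F, hF, h⟩ := h
  have hfin : {a | P a ∧ Q (g a)}.Finite := by
    refine Set.Finite.of_finite_image (f := g) (F.finite_toSet.subset ?_) ?_
    · rintro _ ⟨a, ha, rfl⟩
      exact h _ ha.2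
    · intro a ha b hb hab
      exact hg a ha.1 b hb.1 hab
  refine ⟨hfin.toFinset, ?_, fun a ha => by simpa using ha⟩
  rw [← Finset.card_image_of_injOn (f := g) (s := hfin.toFinset)]
  · refine (Finset.card_le_card ?_).trans hF
    intro b hb
    obtain ⟨a, ha, rfl⟩ := Finset.mem_image.1 hb
    exact h _ ((by simpa using ha : P a ∧ Q (g a)).2)
  · intro a ha b hb hab
    exact hg a (by simpa using ha : P a ∧ Q (g a)).1 b (by simpa using hb : P b ∧ Q (g b)).1 hab

theorem exists_many_of_not_few {D : ℕ} {P : α → Prop} (h : ¬ Few D P) :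
    ∃ S : Finset α, S.card = D + 1 ∧ ∀ a ∈ S, P a := by
  classical
  have : ∀ n ≤ D + 1, ∃ S : Finset α, S.card = n ∧ ∀ a ∈ S, P a := by
    intro n
    induction n with
    | zero => exact fun _ => ⟨∅, by simp⟩
    | succ n ih =>
      intro hn
      obtain ⟨S, hS, hP⟩ := ih (by omega)
      have : ∃ a, P a ∧ a ∉ S := by
        by_contra hcon
        push Not at hcon
        exact h ⟨S, by omega, hcon⟩
      obtain ⟨a, ha, haS⟩ := this
      exact ⟨insert a S, by rw [Finset.card_insert_of_notMem haS, hS], by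
        intro b hb
        rcases Finset.mem_insert.1 hb with rfl | hb
        · exact ha
        · exact hP b hb⟩
  exact this _ le_rfl

theorem not_few_of_card_lt {D : ℕ} {P : α → Prop} {S : Finset α} (hS : D < S.card)
    (hP : ∀ a ∈ S, P a) : ¬ Few D P := by
  rintro ⟨F, hF, h⟩
  have := Finset.card_le_card (fun a ha => h a (hP a ha) : S ⊆ F)
  omega

/-- A large finite set has `k` members that avoid a property with few members. -/
theorem Few.exists_subset {D k : ℕ} {P : α → Prop} (h : Few D P) {S : Finset α}
    (hS : D + k ≤ S.card) : ∃ T ⊆ S, T.card = k ∧ ∀ a ∈ T, ¬ P a := by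
  classical
  obtain ⟨F, hF, h⟩ := h
  have : k ≤ (S \ F).card := by
    have := Finset.le_card_sdiff F S
    omega
  obtain ⟨T, hT, hk⟩ := Finset.exists_subset_card_eq this
  exact ⟨T, hT.trans Finset.sdiff_subset, hk, fun a ha hPa =>
    (Finset.mem_sdiff.1 (hT ha)).2 (h a hPa)⟩

end Few

section Sparse
variable {ι : Type*}

/-- A relation of outdegree at most `D` on a finite set has a proper colouring with `2 * D + 1`
colours. -/
theorem exists_coloring_of_outdegree (R : ι → ι → Prop) (D : ℕ) (s : Finset ι)
    (h : ∀ i ∈ s, Few D (fun j => j ∈ s ∧ j ≠ i ∧ R i j)) :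
    ∃ f : ι → ℕ, (∀ i ∈ s, f i < 2 * D + 1) ∧ ∀ i ∈ s, ∀ j ∈ s, i ≠ j → R i j → f i ≠ f j := by
  classical
  induction s using Finset.strongInduction with
  | H s ih =>
    rcases s.eq_empty_or_nonempty with rfl | hne
    · exact ⟨fun _ => 0, by simp⟩
    -- some vertex has indegree at most `D`, since the average indegree is at most `D`
    have hin : ∃ j ∈ s, (s.filter fun i => j ≠ i ∧ R i j).card ≤ D := by
      by_contra hcon
      push Not at hcon
      have h1 := Finset.sum_card_bipartiteAbove_eq_sum_card_bipartiteBelow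
        (s := s) (t := s) (fun i j => j ≠ i ∧ R i j)
      have h2 : ∑ i ∈ s, (s.bipartiteAbove (fun i j => j ≠ i ∧ R i j) i).card ≤ ∑ i ∈ s, D := by
        refine Finset.sum_le_sum fun i hi => ?_
        obtain ⟨F, hF, hFi⟩ := h i hi
        refine (Finset.card_le_card fun j hj => ?_).trans hF
        have := Finset.mem_filter.1 hj
        exact hFi j ⟨this.1, this.2.1, this.2.2⟩
      have h3 : ∑ i ∈ s, (D + 1) ≤
          ∑ j ∈ s, (s.bipartiteBelow (fun i j => j ≠ i ∧ R i j) j).card :=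
        Finset.sum_le_sum fun j hj => hcon j hj
      have h4 := Finset.card_pos.2 hne
      simp only [Finset.sum_const, smul_eq_mul] at h2 h3
      nlinarith
    obtain ⟨j, hj, hjD⟩ := hin
    obtain ⟨f, hf, hf'⟩ := ih (s.erase j) (Finset.erase_ssubset hj) fun i hi =>
      (h i (Finset.mem_of_mem_erase hi)).mono le_rfl fun k hk =>
        ⟨Finset.mem_of_mem_erase hk.1, hk.2⟩
    obtain ⟨F, hF, hFj⟩ := h j hj
    have : ∃ c < 2 * D + 1, c ∉ (F ∪ s.filter fun i => j ≠ i ∧ R i j).image f := by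
      by_contra hcon
      push Not at hcon
      have h1 : Finset.range (2 * D + 1) ⊆ (F ∪ s.filter fun i => j ≠ i ∧ R i j).image f :=
        fun c hc => hcon c (Finset.mem_range.1 hc)
      have h2 := Finset.card_le_card h1
      have h3 := Finset.card_image_le (s := F ∪ s.filter fun i => j ≠ i ∧ R i j) (f := f)
      have h4 := Finset.card_union_le F (s.filter fun i => j ≠ i ∧ R i j)
      rw [Finset.card_range] at h2
      omega
    obtain ⟨c, hc, hcF⟩ := this
    have hcF' : ∀ i, i ∈ F ∨ (i ∈ s ∧ j ≠ i ∧ R i j) → f i ≠ c := by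
      intro i hi hfi
      refine hcF (Finset.mem_image.2 ⟨i, ?_, hfi⟩)
      rcases hi with hi | hi
      · exact Finset.mem_union_left _ hi
      · exact Finset.mem_union_right _ (Finset.mem_filter.2 hi)
    refine ⟨Function.update f j c, ?_, ?_⟩
    · intro i hi
      by_cases hij : i = j
      · subst hij; simpa using hc
      · rw [Function.update_of_ne hij]
        exact hf i (Finset.mem_erase.2 ⟨hij, hi⟩)
    · intro i hi k hk hik hR
      by_cases hij : i = j
      · subst hij
        rw [Function.update_self, Function.update_of_ne (Ne.symm hik)]
        exact (hcF' k (Or.inl (hFj k ⟨hk, Ne.symm hik, hR⟩))).symm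
      · by_cases hkj : k = j
        · subst hkj
          rw [Function.update_self, Function.update_of_ne hij]
          exact hcF' i (Or.inr ⟨hi, Ne.symm hij, hR⟩)
        · rw [Function.update_of_ne hij, Function.update_of_ne hkj]
          exact hf' i (Finset.mem_erase.2 ⟨hij, hi⟩) k (Finset.mem_erase.2 ⟨hkj, hk⟩) hik hR

/-- A large set contains a large fibre of a function with few values. -/
theorem exists_fiber {α : Type*} {m k : ℕ} {S : Finset ι} (f : ι → α) (A : Finset α)
    (hA : A.card ≤ m) (hf : ∀ i ∈ S, f i ∈ A) (hS : m * k + 1 ≤ S.card) :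
    ∃ a ∈ A, ∃ T ⊆ S, T.card = k ∧ ∀ i ∈ T, f i = a := by
  classical
  have : ∃ a ∈ A, k < (S.filter fun i => f i = a).card := by
    refine Finset.exists_lt_card_fiber_of_mul_lt_card_of_maps_to hf ?_
    have := Nat.mul_le_mul_right k hA
    omega
  obtain ⟨a, haA, ha⟩ := this
  obtain ⟨T, hT, hk⟩ := Finset.exists_subset_card_eq ha.le
  exact ⟨a, haA, T, hT.trans (Finset.filter_subset _ _), hk, fun i hi =>
    (Finset.mem_filter.1 (hT hi)).2⟩

theorem exists_fiber_nat {m k : ℕ} {S : Finset ι} (f : ι → ℕ)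
    (hf : ∀ i ∈ S, f i < m) (hS : m * k + 1 ≤ S.card) :
    ∃ a < m, ∃ T ⊆ S, T.card = k ∧ ∀ i ∈ T, f i = a := by
  obtain ⟨a, ha, h⟩ := exists_fiber f (Finset.range m) (by simp)
    (fun i hi => Finset.mem_range.2 (hf i hi)) hS
  exact ⟨a, Finset.mem_range.1 ha, h⟩

/-- A relation of bounded outdegree on a large set vanishes on a large subset. -/
theorem exists_free_subset {R : ι → ι → Prop} {D k : ℕ} {s : Finset ι}
    (h : ∀ i ∈ s, Few D (fun j => j ∈ s ∧ j ≠ i ∧ R i j)) (hs : (2 * D + 1) * k + 1 ≤ s.card) :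
    ∃ t ⊆ s, t.card = k ∧ ∀ i ∈ t, ∀ j ∈ t, i ≠ j → ¬ R i j := by
  obtain ⟨f, hf, hf'⟩ := exists_coloring_of_outdegree R D s h
  obtain ⟨a, -, t, hts, htk, ht⟩ := exists_fiber_nat f hf hs
  exact ⟨t, hts, htk, fun i hi j hj hij hR =>
    hf' i (hts hi) j (hts hj) hij hR ((ht i hi).trans (ht j hj).symm)⟩

/-- An upper bound for Ramsey numbers. -/
def ram : ℕ → ℕ → ℕ
  | 0, _ => 0
  | r + 1, k => (2 * ram r k + 1) * k + 1

theorem ramsey (r k : ℕ) (R : ι → ι → Prop) (hR : ∀ i j, R i j → R j i) (S : Finset ι)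
    (hS : ram r k ≤ S.card) :
    (∃ T ⊆ S, T.card = r ∧ ∀ i ∈ T, ∀ j ∈ T, i ≠ j → R i j) ∨
      ∃ T ⊆ S, T.card = k ∧ ∀ i ∈ T, ∀ j ∈ T, i ≠ j → ¬ R i j := by
  classical
  induction r generalizing S with
  | zero => exact Or.inl ⟨∅, by simp⟩
  | succ r ih =>
    by_cases h : ∀ i ∈ S, Few (ram r k) (fun j => j ∈ S ∧ j ≠ i ∧ R i j)
    · exact Or.inr (exists_free_subset h hS)
    · push Not at h
      obtain ⟨i, hi, h⟩ := h
      obtain ⟨T, hT, hTS⟩ := exists_many_of_not_few h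
      rcases ih T (by omega) with ⟨T', hT', hr, h'⟩ | ⟨T', hT', hr, h'⟩
      · have hiT : i ∉ T' := fun hiT => (hTS i (hT' hiT)).2.1 rfl
        refine Or.inl ⟨insert i T', ?_, by rw [Finset.card_insert_of_notMem hiT, hr], ?_⟩
        · intro j hj
          rcases Finset.mem_insert.1 hj with rfl | hj
          · exact hi
          · exact (hTS j (hT' hj)).1
        · intro a ha b hb hab
          rcases Finset.mem_insert.1 ha with ha' | ha'
          · rcases Finset.mem_insert.1 hb with hb' | hb'
            · exact (hab (ha'.trans hb'.symm)).elim
            · exact ha' ▸ (hTS b (hT' hb')).2.2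
          · rcases Finset.mem_insert.1 hb with hb' | hb'
            · exact hb' ▸ hR _ _ (hTS a (hT' ha')).2.2
            · exact h' a ha' b hb' hab
      · exact Or.inr ⟨T', fun j hj => (hTS j (hT' hj)).1, hr, h'⟩

/-- On a large set a function is constant or injective on a large subset. -/
theorem exists_const_or_injOn {α : Type*} (k : ℕ) (f : ι → α) (S : Finset ι)
    (hS : ram k k ≤ S.card) :
    (∃ T ⊆ S, T.card = k ∧ ∀ i ∈ T, ∀ j ∈ T, f i = f j) ∨
      ∃ T ⊆ S, T.card = k ∧ ∀ i ∈ T, ∀ j ∈ T, f i = f j → i = j := by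
  rcases ramsey k k (fun i j => f i = f j) (fun i j h => h.symm) S hS with
    ⟨T, h1, h2, h3⟩ | ⟨T, h1, h2, h3⟩
  · refine Or.inl ⟨T, h1, h2, fun i hi j hj => ?_⟩
    by_cases hij : i = j
    · rw [hij]
    · exact h3 i hi j hj hij
  · refine Or.inr ⟨T, h1, h2, fun i hi j hj hf => ?_⟩
    by_contra hij
    exact h3 i hi j hj hij hf

end Sparse

namespace ColorableOn
variable {V : Type*} {R : V → V → Prop} {X Y : Set V} {k l : ℕ}

theorem mono (h : ColorableOn R X k) (hXY : Y ⊆ X) (hkl : k ≤ l) : ColorableOn R Y l := by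
  obtain ⟨f, h1, h2⟩ := h
  exact ⟨f, fun v hv => (h1 v (hXY hv)).trans_le hkl, fun u hu v hv => h2 u (hXY hu) v (hXY hv)⟩

theorem mono_rel {S : V → V → Prop} (h : ColorableOn R X k)
    (hS : ∀ u ∈ X, ∀ v ∈ X, S u v → R u v) : ColorableOn S X k := by
  obtain ⟨f, h1, h2⟩ := h
  exact ⟨f, h1, fun u hu v hv huv => h2 u hu v hv (hS u hu v hv huv)⟩

theorem of_isEmpty (h : ∀ v, v ∉ X) : ColorableOn R X k :=
  ⟨fun _ => 0, fun v hv => (h v hv).elim, fun v hv => (h v hv).elim⟩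

theorem fibers {m : ℕ} (g : V → ℕ) (hg : ∀ v ∈ X, g v < m)
    (h : ∀ i < m, ColorableOn R {v | v ∈ X ∧ g v = i} k) : ColorableOn R X (m * k) := by
  choose! f h1 h2 using h
  refine ⟨fun v => g v * k + f (g v) v, fun v hv => ?_, fun u hu v hv huv heq => ?_⟩
  · have h3 := h1 (g v) (hg v hv) v ⟨hv, rfl⟩
    have h4 : (g v + 1) * k ≤ m * k := Nat.mul_le_mul_right k (hg v hv)
    simp only
    nlinarith
  · have h3 := h1 (g v) (hg v hv) v ⟨hv, rfl⟩
    have h4 := h1 (g u) (hg u hu) u ⟨hu, rfl⟩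
    simp only at heq
    have h5 : g u = g v := by
      rcases lt_trichotomy (g u) (g v) with hlt | h | hlt
      · have : (g u + 1) * k ≤ g v * k := Nat.mul_le_mul_right k hlt
        nlinarith
      · exact h
      · have : (g v + 1) * k ≤ g u * k := Nat.mul_le_mul_right k hlt
        nlinarith
    rw [h5] at heq
    exact h2 (g v) (hg v hv) u ⟨hu, h5⟩ v ⟨hv, rfl⟩ huv (by omega)

theorem union (h : ColorableOn R X k) (h' : ColorableOn R Y l) :
    ColorableOn R (X ∪ Y) (k + l) := by
  classical
  obtain ⟨f, h1, h2⟩ := h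
  obtain ⟨g, h3, h4⟩ := h'
  refine ⟨fun v => if v ∈ X then f v else k + g v, fun v hv => ?_, fun u hu v hv huv => ?_⟩
  · by_cases hvX : v ∈ X
    · have := h1 v hvX
      simp only [hvX, if_true]; omega
    · have := h3 v (hv.resolve_left hvX)
      simp only [hvX, if_false]; omega
  · by_cases huX : u ∈ X <;> by_cases hvX : v ∈ X <;> simp only [huX, hvX, if_true, if_false]
    · exact h2 u huX v hvX huv
    · have := h1 u huX; omega
    · have := h1 v hvX; omega
    · have := h4 u (hu.resolve_left huX) v (hv.resolve_left hvX) huv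
      omega

theorem biUnion {ι : Type*} (S : Finset ι) (F : ι → Set V) (h : ∀ i ∈ S, ColorableOn R (F i) k) :
    ColorableOn R {v | ∃ i ∈ S, v ∈ F i} (S.card * k) := by
  classical
  induction S using Finset.induction_on with
  | empty => exact of_isEmpty (by simp)
  | insert i S hi ih =>
    refine ((h i (Finset.mem_insert_self i S)).union (ih fun j hj =>
      h j (Finset.mem_insert_of_mem hj))).mono ?_ ?_
    · rintro v ⟨j, hj, hv⟩
      rcases Finset.mem_insert.1 hj with rfl | hj
      · exact Or.inl hv
      · exact Or.inr ⟨j, hj, hv⟩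
    · rw [Finset.card_insert_of_notMem hi]
      apply le_of_eq; ring

/-- Colourings for two relations combine to one for their union. -/
theorem or {S : V → V → Prop} (h : ColorableOn R X k) (h' : ColorableOn S X l) :
    ColorableOn (fun u v => R u v ∨ S u v) X (k * l) := by
  obtain ⟨f, h1, h2⟩ := h
  obtain ⟨g, h3, h4⟩ := h'
  refine fibers f h1 fun i _ => ⟨g, fun v hv => h3 v hv.1, fun u hu v hv huv => ?_⟩
  rcases huv with huv | huv
  · exact (h2 u hu.1 v hv.1 huv (hu.2.trans hv.2.symm)).elim
  · exact h4 u hu.1 v hv.1 huv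

/-- Pieces without edges between them are coloured independently. -/
theorem pieces {ι : Type*} (p : V → ι) (h : ∀ i, ColorableOn R {v | v ∈ X ∧ p v = i} k)
    (hp : ∀ u ∈ X, ∀ v ∈ X, R u v → p u = p v) : ColorableOn R X k := by
  choose f h1 h2 using h
  refine ⟨fun v => f (p v) v, fun v hv => h1 _ v ⟨hv, rfl⟩, fun u hu v hv huv => ?_⟩
  have := hp u hu v hv huv
  simp only [this]
  exact h2 (p v) u ⟨hu, this⟩ v ⟨hv, rfl⟩ huv

theorem of_outdegree [Finite V] {S : V → V → Prop} {D : ℕ}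
    (hR : ∀ u ∈ X, ∀ v ∈ X, R u v → u ≠ v ∧ (S u v ∨ S v u))
    (h : ∀ u ∈ X, Few D (fun v => v ∈ X ∧ v ≠ u ∧ S u v)) : ColorableOn R X (2 * D + 1) := by
  classical
  obtain ⟨f, h1, h2⟩ := exists_coloring_of_outdegree S D (Set.toFinite X).toFinset
    (fun i hi => by simpa using h i (by simpa using hi))
  refine ⟨f, fun v hv => h1 v (by simpa using hv), fun u hu v hv huv => ?_⟩
  obtain ⟨hne, h3 | h3⟩ := hR u hu v hv huv
  · exact h2 u (by simpa using hu) v (by simpa using hv) hne h3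
  · exact (h2 v (by simpa using hv) u (by simpa using hu) hne.symm h3).symm

/-- If the edges between different pieces follow a relation of bounded outdegree on the set of
pieces, and each piece can be coloured, then so can the whole set. -/
theorem of_quotient_outdegree [Finite V] {ι : Type*} (p : V → ι) {S : ι → ι → Prop} {D : ℕ}
    (hR : ∀ u ∈ X, ∀ v ∈ X, R u v → p u = p v ∨ S (p u) (p v) ∨ S (p v) (p u))
    (h : ∀ u ∈ X, Few D (fun c => c ∈ p '' X ∧ c ≠ p u ∧ S (p u) c))
    (hk : ∀ i, ColorableOn R {v | v ∈ X ∧ p v = i} k) : ColorableOn R X ((2 * D + 1) * k) := by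
  classical
  obtain ⟨f, h1, h2⟩ := exists_coloring_of_outdegree S D (Set.toFinite (p '' X)).toFinset
    (fun i hi => by
      obtain ⟨u, hu, rfl⟩ : i ∈ p '' X := by simpa using hi
      simpa using h u hu)
  have hmem : ∀ v ∈ X, p v ∈ (Set.toFinite (p '' X)).toFinset := fun v hv => by
    simpa using ⟨v, hv, rfl⟩
  refine fibers (fun v => f (p v)) (fun v hv => h1 _ (hmem v hv)) fun i _ => ?_
  refine pieces p (fun c => (hk c).mono (fun v hv => ⟨hv.1.1, hv.2⟩) le_rfl) ?_
  intro u hu v hv huv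
  by_contra hne
  have heq : f (p u) = f (p v) := hu.2.trans hv.2.symm
  rcases (hR u hu.1 v hv.1 huv).resolve_left hne with h3 | h3
  · exact h2 _ (hmem u hu.1) _ (hmem v hv.1) hne h3 heq
  · exact h2 _ (hmem v hv.1) _ (hmem u hu.1) (Ne.symm hne) h3 heq.symm

end ColorableOn

/-! ### Assembling the tree from brooms -/

section Brooms
variable {V : Type*}

/-- The path `u - h` together with the leaves `L` at `h` is an induced broom of length one with
handle `u`. -/
structure IsBroom (G : SimpleGraph V) (δ : ℕ) (u h : V) (L : Finset V) : Prop where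
  adj : G.Adj u h
  card : L.card = δ
  adj_leaf : ∀ l ∈ L, G.Adj h l
  not_adj_leaf : ∀ l ∈ L, ¬ G.Adj u l
  ne_leaf : ∀ l ∈ L, u ≠ l
  stable : ∀ l ∈ L, ∀ l' ∈ L, ¬ G.Adj l l'

/-- There is an induced broom of length one with handle `u`, all of whose other vertices are
in `O`. -/
def HasBroomOne (G : SimpleGraph V) (δ : ℕ) (u : V) (O : Set V) : Prop :=
  ∃ h L, IsBroom G δ u h L ∧ h ∈ O ∧ ∀ l ∈ L, l ∈ O

/-- There is an induced broom of length two with handle `u`, all of whose other vertices are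
in `O`. -/
def HasBroomTwo (G : SimpleGraph V) (δ : ℕ) (u : V) (O : Set V) : Prop :=
  ∃ m h L, G.Adj u m ∧ IsBroom G δ m h L ∧ u ≠ h ∧ ¬ G.Adj u h ∧ (∀ l ∈ L, u ≠ l ∧ ¬ G.Adj u l) ∧
    m ∈ O ∧ h ∈ O ∧ ∀ l ∈ L, l ∈ O

/-- `Apart G O O'`: the sets `O` and `O'` are disjoint and there are no edges between them. -/
def Apart (G : SimpleGraph V) (O O' : Set V) : Prop :=
  ∀ x ∈ O, ∀ y ∈ O', x ≠ y ∧ ¬ G.Adj x y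

theorem Apart.symm {G : SimpleGraph V} {O O' : Set V} (h : Apart G O O') : Apart G O' O :=
  fun x hx y hy => ⟨(h y hy x hx).1.symm, fun hxy => (h y hy x hx).2 hxy.symm⟩

theorem HasBroomOne.mono {G : SimpleGraph V} {δ : ℕ} {u : V} {O O' : Set V}
    (h : HasBroomOne G δ u O) (hO : O ⊆ O') : HasBroomOne G δ u O' := by
  obtain ⟨m, L, h1, h2, h3⟩ := h
  exact ⟨m, L, h1, hO h2, fun l hl => hO (h3 l hl)⟩

theorem HasBroomTwo.mono {G : SimpleGraph V} {δ : ℕ} {u : V} {O O' : Set V}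
    (h : HasBroomTwo G δ u O) (hO : O ⊆ O') : HasBroomTwo G δ u O' := by
  obtain ⟨m, x, L, h1, h2, h3, h4, h5, h6, h7, h8⟩ := h
  exact ⟨m, x, L, h1, h2, h3, h4, h5, hO h6, hO h7, fun l hl => hO (h8 l hl)⟩

/-- A broom of length one at a neighbour `m` of `u` extends to a broom of length two at `u`, if `u`
has no other neighbours in it. -/
theorem HasBroomOne.extend {G : SimpleGraph V} {δ : ℕ} {u m : V} {O : Set V}
    (h : HasBroomOne G δ m O) (hum : G.Adj u m) (hO : Apart G {u} O) :
    HasBroomTwo G δ u (insert m O) := by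
  obtain ⟨x, L, h1, h2, h3⟩ := h
  exact ⟨m, x, L, hum, h1, (hO u rfl x h2).1, (hO u rfl x h2).2, fun l hl => hO u rfl l (h3 l hl),
    Or.inl rfl, Or.inr h2, fun l hl => Or.inr (h3 l hl)⟩

/-- Sets that are pairwise apart and contain brooms of both kinds with handle `u` give the tree. -/
theorem isIndContained_of_brooms {ι : Type*} {G : SimpleGraph V} {δ : ℕ} {u : V} (S : Finset ι)
    (hS : 2 * δ ≤ S.card) (O : ι → Set V) (h1 : ∀ i ∈ S, HasBroomOne G δ u (O i))
    (h2 : ∀ i ∈ S, HasBroomTwo G δ u (O i))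
    (hO : ∀ i ∈ S, ∀ j ∈ S, i ≠ j → Apart G (O i) (O j)) : (T δ).IsIndContained G := by
  classical
  obtain ⟨e⟩ : Nonempty ((Fin δ ⊕ Fin δ) ↪ S) := by
    rw [Function.Embedding.nonempty_iff_card_le]
    simpa [two_mul] using hS
  choose a L ha haO hL using fun i : Fin δ => h1 (e (Sum.inl i)) (e (Sum.inl i)).2
  choose m b K hum hb hub hub' hK hmO hbO hKO using
    fun i : Fin δ => h2 (e (Sum.inr i)) (e (Sum.inr i)).2
  have hl : ∀ i : Fin δ, ∃ l : Fin δ → V, Function.Injective l ∧ ∀ j, l j ∈ L i := fun i => by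
    let f := (L i).equivFinOfCardEq (ha i).card
    exact ⟨fun j => (f.symm j : V), fun j j' hj => f.symm.injective (Subtype.ext hj),
      fun j => (f.symm j).2⟩
  have hk : ∀ i : Fin δ, ∃ l : Fin δ → V, Function.Injective l ∧ ∀ j, l j ∈ K i := fun i => by
    let f := (K i).equivFinOfCardEq (hb i).card
    exact ⟨fun j => (f.symm j : V), fun j j' hj => f.symm.injective (Subtype.ext hj),
      fun j => (f.symm j).2⟩
  choose l hlinj hlL using hl
  choose k hkinj hkK using hk
  have hne : ∀ p q : Fin δ ⊕ Fin δ, p ≠ q → ((e p : S) : ι) ≠ (e q : S) := fun p q hpq h =>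
    hpq (e.injective (Subtype.ext h))
  have hA : ∀ p q : Fin δ ⊕ Fin δ, p ≠ q → Apart G (O (e p)) (O (e q)) := fun p q hpq =>
    hO _ (e p).2 _ (e q).2 (hne p q hpq)
  have hAll : ∀ i j : Fin δ, i ≠ j → Apart G (O (e (Sum.inl i))) (O (e (Sum.inl j))) :=
    fun i j hij => hA _ _ (by simpa using hij)
  have hArr : ∀ i j : Fin δ, i ≠ j → Apart G (O (e (Sum.inr i))) (O (e (Sum.inr j))) :=
    fun i j hij => hA _ _ (by simpa using hij)
  have hAlr : ∀ i j : Fin δ, Apart G (O (e (Sum.inl i))) (O (e (Sum.inr j))) :=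
    fun i j => hA _ _ (by simp)
  let φ : TVertex δ → V := fun v => match v with
    | .handle => u
    | .hubOne i => a i
    | .leafOne i j => l i j
    | .midTwo i => m i
    | .hubTwo i => b i
    | .leafTwo i j => k i j
  have hlO : ∀ i j, l i j ∈ O (e (Sum.inl i)) := fun i j => hL i _ (hlL i j)
  have hkO : ∀ i j, k i j ∈ O (e (Sum.inr i)) := fun i j => hKO i _ (hkK i j)
  let rank : TVertex δ → ℕ := fun v => match v with
    | .handle => 0
    | .hubOne _ => 1
    | .leafOne _ _ => 2
    | .midTwo _ => 3
    | .hubTwo _ => 4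
    | .leafTwo _ _ => 5
  have key : ∀ v w : TVertex δ, rank v ≤ rank w → v ≠ w →
      φ v ≠ φ w ∧ (G.Adj (φ v) (φ w) ↔ IsParent v w) := by
    rintro (_ | i | ⟨i, j⟩ | i | i | ⟨i, j⟩) (_ | i' | ⟨i', j'⟩ | i' | i' | ⟨i', j'⟩) hr hne
    all_goals first
      | (exfalso; simp [rank] at hr; done)
      | skip
    · exact (hne rfl).elim
    · exact ⟨(ha i').adj.ne, iff_of_true (ha i').adj (.handle_hubOne i')⟩
    · exact ⟨(ha i').ne_leaf _ (hlL i' j'), iff_of_false ((ha i').not_adj_leaf _ (hlL i' j'))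
        (by rintro ⟨⟩)⟩
    · exact ⟨(hum i').ne, iff_of_true (hum i') (.handle_midTwo i')⟩
    · exact ⟨hub i', iff_of_false (hub' i') (by rintro ⟨⟩)⟩
    · exact ⟨(hK i' _ (hkK i' j')).1, iff_of_false (hK i' _ (hkK i' j')).2 (by rintro ⟨⟩)⟩
    · have h := hAll i i' (by rintro rfl; exact hne rfl) _ (haO i) _ (haO i')
      exact ⟨h.1, iff_of_false h.2 (by rintro ⟨⟩)⟩
    · by_cases hii : i = i'
      · subst hii
        have h := (ha i).adj_leaf _ (hlL i j')
        exact ⟨h.ne, iff_of_true h (.hubOne_leafOne i j')⟩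
      · have h := hAll i i' hii _ (haO i) _ (hlO i' j')
        exact ⟨h.1, iff_of_false h.2 (by rintro ⟨⟩; exact hii rfl)⟩
    · have h := hAlr i i' _ (haO i) _ (hmO i')
      exact ⟨h.1, iff_of_false h.2 (by rintro ⟨⟩)⟩
    · have h := hAlr i i' _ (haO i) _ (hbO i')
      exact ⟨h.1, iff_of_false h.2 (by rintro ⟨⟩)⟩
    · have h := hAlr i i' _ (haO i) _ (hkO i' j')
      exact ⟨h.1, iff_of_false h.2 (by rintro ⟨⟩)⟩
    · by_cases hii : i = i'
      · subst hii
        refine ⟨fun h => hne ?_, iff_of_false ((ha i).stable _ (hlL i j) _ (hlL i j'))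
          (by rintro ⟨⟩)⟩
        rw [hlinj i h]
      · have h := hAll i i' hii _ (hlO i j) _ (hlO i' j')
        exact ⟨h.1, iff_of_false h.2 (by rintro ⟨⟩)⟩
    · have h := hAlr i i' _ (hlO i j) _ (hmO i')
      exact ⟨h.1, iff_of_false h.2 (by rintro ⟨⟩)⟩
    · have h := hAlr i i' _ (hlO i j) _ (hbO i')
      exact ⟨h.1, iff_of_false h.2 (by rintro ⟨⟩)⟩
    · have h := hAlr i i' _ (hlO i j) _ (hkO i' j')
      exact ⟨h.1, iff_of_false h.2 (by rintro ⟨⟩)⟩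
    · have h := hArr i i' (by rintro rfl; exact hne rfl) _ (hmO i) _ (hmO i')
      exact ⟨h.1, iff_of_false h.2 (by rintro ⟨⟩)⟩
    · by_cases hii : i = i'
      · subst hii
        exact ⟨(hb i).adj.ne, iff_of_true (hb i).adj (.midTwo_hubTwo i)⟩
      · have h := hArr i i' hii _ (hmO i) _ (hbO i')
        exact ⟨h.1, iff_of_false h.2 (by rintro ⟨⟩; exact hii rfl)⟩
    · by_cases hii : i = i'
      · subst hii
        exact ⟨(hb i).ne_leaf _ (hkK i j'), iff_of_false ((hb i).not_adj_leaf _ (hkK i j'))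
          (by rintro ⟨⟩)⟩
      · have h := hArr i i' hii _ (hmO i) _ (hkO i' j')
        exact ⟨h.1, iff_of_false h.2 (by rintro ⟨⟩)⟩
    · have h := hArr i i' (by rintro rfl; exact hne rfl) _ (hbO i) _ (hbO i')
      exact ⟨h.1, iff_of_false h.2 (by rintro ⟨⟩)⟩
    · by_cases hii : i = i'
      · subst hii
        have h := (hb i).adj_leaf _ (hkK i j')
        exact ⟨h.ne, iff_of_true h (.hubTwo_leafTwo i j')⟩
      · have h := hArr i i' hii _ (hbO i) _ (hkO i' j')
        exact ⟨h.1, iff_of_false h.2 (by rintro ⟨⟩; exact hii rfl)⟩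
    · by_cases hii : i = i'
      · subst hii
        refine ⟨fun h => hne ?_, iff_of_false ((hb i).stable _ (hkK i j) _ (hkK i j'))
          (by rintro ⟨⟩)⟩
        rw [hkinj i h]
      · have h := hArr i i' hii _ (hkO i j) _ (hkO i' j')
        exact ⟨h.1, iff_of_false h.2 (by rintro ⟨⟩)⟩
  have hrank : ∀ v w : TVertex δ, IsParent v w → rank v ≤ rank w := by
    rintro _ _ (_ | _ | _ | _ | _) <;> simp [rank]
  have hinj : Function.Injective φ := by
    intro v w hvw
    by_contra hne
    rcases le_total (rank v) (rank w) with h | h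
    · exact (key v w h hne).1 hvw
    · exact (key w v h (Ne.symm hne)).1 hvw.symm
  refine ⟨⟨⟨φ, hinj⟩, ?_⟩⟩
  intro v w
  simp only [Function.Embedding.coeFn_mk, T, SimpleGraph.fromRel_adj]
  by_cases hvw : v = w
  · subst hvw; simp
  · have aux : ∀ v w : TVertex δ, v ≠ w → rank v ≤ rank w →
        (G.Adj (φ v) (φ w) ↔ IsParent v w ∨ IsParent w v) := by
      intro v w hvw h
      rw [(key v w h hvw).2]
      refine ⟨Or.inl, fun h' => h'.resolve_right fun h'' => ?_⟩
      have := hrank _ _ h''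
      rcases h'' with _ | _ | _ | _ | _ <;> simp [rank] at this h
    rcases le_total (rank v) (rank w) with h | h
    · simpa [hvw] using aux v w hvw h
    · have := aux w v (Ne.symm hvw) h
      rw [G.adj_comm, this]
      simp [hvw, or_comm]

end Brooms

/-! ### Tame graphs -/

section Tame
variable {V : Type*}

/-- The standing assumptions, with colourings in place of chromatic numbers: `G` is `T δ`-free, and
balls of radius two and matching-covered sets are `τ`-colourable. -/
structure Tame (G : SimpleGraph V) (δ τ : ℕ) : Prop where
  free : ¬ (T δ).IsIndContained G
  ball : ∀ v, ColorableOn G.Adj {w | w = v ∨ G.Adj v w ∨ ∃ m, G.Adj v m ∧ G.Adj m w} τ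
  matching : ∀ X : Set V, (∀ x ∈ X, ∃ y, y ∉ X ∧ G.Adj y x ∧ ∀ z ∈ X, G.Adj y z → z = x) →
    ColorableOn G.Adj X τ

/-- `x` lies in `O` or has a neighbour there. -/
def Touches (G : SimpleGraph V) (x : V) (O : Set V) : Prop :=
  ∃ y ∈ O, x = y ∨ G.Adj x y

theorem apart_iff {G : SimpleGraph V} {O O' : Set V} :
    Apart G O O' ↔ ∀ x ∈ O, ¬ Touches G x O' := by
  constructor
  · rintro h x hx ⟨y, hy, h' | h'⟩
    · exact (h x hx y hy).1 h'
    · exact (h x hx y hy).2 h'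
  · intro h x hx y hy
    exact ⟨fun h' => h x hx ⟨y, hy, Or.inl h'⟩, fun h' => h x hx ⟨y, hy, Or.inr h'⟩⟩

theorem Tame.card_clique_le {G : SimpleGraph V} {δ τ : ℕ} (hG : Tame G δ τ) (S : Finset V)
    (hS : ∀ u ∈ S, ∀ v ∈ S, u ≠ v → G.Adj u v) : S.card ≤ τ := by
  classical
  rcases S.eq_empty_or_nonempty with rfl | ⟨v, hv⟩
  · simp
  obtain ⟨f, h1, h2⟩ := hG.ball v
  have hball : ∀ w ∈ S, w ∈ {w | w = v ∨ G.Adj v w ∨ ∃ m, G.Adj v m ∧ G.Adj m w} := fun w hw => by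
    by_cases h : w = v
    · exact Or.inl h
    · exact Or.inr (Or.inl (hS v hv w hw (Ne.symm h)))
  have := Finset.card_le_card_of_injOn (s := S) (t := Finset.range τ) f
    (fun w hw => by simpa using h1 w (hball w hw)) (fun a ha b hb hab => by
      by_contra hne
      exact h2 a (hball a ha) b (hball b hb) (hS a ha b hb hne) hab)
  simpa using this

/-- Among many vertices, indexed by `ι`, many are pairwise nonadjacent. -/
theorem Tame.exists_nonadj {ι : Type*} {G : SimpleGraph V} {δ τ : ℕ} (hG : Tame G δ τ) (k : ℕ)
    (φ : ι → V) (S : Finset ι) (hS : ram (τ + 1) k ≤ S.card) :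
    ∃ S' ⊆ S, S'.card = k ∧ ∀ i ∈ S', ∀ j ∈ S', ¬ G.Adj (φ i) (φ j) := by
  classical
  rcases ramsey (τ + 1) k (fun i j => G.Adj (φ i) (φ j)) (fun i j h => h.symm) S hS with
    ⟨A, -, hA, h⟩ | ⟨A, hAS, hA, h⟩
  · exfalso
    have hinj : Set.InjOn φ A := fun i hi j hj hij => by
      by_contra hne
      exact (h i hi j hj hne).ne hij
    have := hG.card_clique_le (A.image φ) (by
      intro u hu v hv huv
      obtain ⟨i, hi, rfl⟩ := Finset.mem_image.1 hu
      obtain ⟨j, hj, rfl⟩ := Finset.mem_image.1 hv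
      exact h i hi j hj fun hij => huv (by rw [hij]))
    rw [Finset.card_image_of_injOn hinj] at this
    omega
  · refine ⟨A, hAS, hA, fun i hi j hj => ?_⟩
    by_cases hij : i = j
    · subst hij; exact G.irrefl
    · exact h i hi j hj hij

/-- The version of `Tame.exists_nonadj` for several indexed families simultaneously. -/
theorem Tame.exists_nonadj_family {ι κ : Type*} {G : SimpleGraph V} {δ τ : ℕ} (hG : Tame G δ τ)
    (k : ℕ) (Ξ : Finset κ) (φ : κ → ι → V) (S : Finset ι)
    (hS : (ram (τ + 1))^[Ξ.card] k ≤ S.card) :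
    ∃ S' ⊆ S, S'.card = k ∧ ∀ s ∈ Ξ, ∀ i ∈ S', ∀ j ∈ S', ¬ G.Adj (φ s i) (φ s j) := by
  classical
  induction Ξ using Finset.induction_on generalizing S with
  | empty =>
    obtain ⟨S', h1, h2⟩ := Finset.exists_subset_card_eq (by simpa using hS : k ≤ S.card)
    exact ⟨S', h1, h2, by simp⟩
  | insert s Ξ hs ih =>
    rw [Finset.card_insert_of_notMem hs, Function.iterate_succ_apply'] at hS
    obtain ⟨S₁, h1, h2, h3⟩ := hG.exists_nonadj _ (φ s) S hS
    obtain ⟨S₂, h4, h5, h6⟩ := ih S₁ h2.ge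
    refine ⟨S₂, h4.trans h1, h5, fun s' hs' i hi j hj => ?_⟩
    rcases Finset.mem_insert.1 hs' with rfl | hs'
    · exact h3 i (h4 hi) j (h4 hj)
    · exact h6 s' hs' i hi j hj

/-- `v` has `δ` pairwise nonadjacent neighbours in `Z`. -/
def HasLeaves (G : SimpleGraph V) (δ : ℕ) (v : V) (Z : Set V) : Prop :=
  ∃ L : Finset V, L.card = δ ∧ (∀ l ∈ L, l ∈ Z ∧ G.Adj v l) ∧ ∀ l ∈ L, ∀ l' ∈ L, ¬ G.Adj l l'

theorem HasLeaves.hasBroomOne {G : SimpleGraph V} {δ : ℕ} {u v : V} {Z : Set V}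
    (h : HasLeaves G δ v Z) (huv : G.Adj u v) (hZ : ¬ Touches G u Z) :
    HasBroomOne G δ u (insert v Z) := by
  obtain ⟨L, h1, h2, h3⟩ := h
  exact ⟨v, L, ⟨huv, h1, fun l hl => (h2 l hl).2, fun l hl h => hZ ⟨l, (h2 l hl).1, Or.inr h⟩,
    fun l hl h => hZ ⟨l, (h2 l hl).1, Or.inl h⟩, h3⟩, Or.inl rfl, fun l hl => Or.inr (h2 l hl).1⟩

/-- Many neighbours of `u`, each carrying brooms in sets that are pairwise apart and mostly not
touched by `u`, give the tree. -/
theorem isIndContained_of_star {ι : Type*} {G : SimpleGraph V} {δ D : ℕ} {u : V} (S : Finset ι)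
    (v : ι → V) (Z : ι → Set V) (hS : D + 2 * δ ≤ S.card) (hadj : ∀ t ∈ S, G.Adj u (v t))
    (hfew : Few D (fun t => t ∈ S ∧ Touches G u (Z t)))
    (hZ : ∀ t ∈ S, ∀ t' ∈ S, t ≠ t' → Apart G (insert (v t) (Z t)) (insert (v t') (Z t')))
    (h1 : ∀ t ∈ S, HasLeaves G δ (v t) (Z t)) (h2 : ∀ t ∈ S, HasBroomOne G δ (v t) (Z t)) :
    (T δ).IsIndContained G := by
  obtain ⟨S', hS', hc, h⟩ := hfew.exists_subset hS
  have h' : ∀ t ∈ S', ¬ Touches G u (Z t) := fun t ht hT => h t ht ⟨hS' ht, hT⟩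
  refine isIndContained_of_brooms S' hc.ge (fun t => insert (v t) (Z t))
    (fun t ht => (h1 t (hS' ht)).hasBroomOne (hadj t (hS' ht)) (h' t ht))
    (fun t ht => (h2 t (hS' ht)).extend (hadj t (hS' ht)) ?_)
    (fun t ht t' ht' htt => hZ t (hS' ht) t' (hS' ht') htt)
  rw [apart_iff]
  rintro _ rfl
  exact h' t ht

end Tame

/-! ### Layers of cores -/

/-- A layer of `U` over `U'`. The sets `Y c` are the vertex sets of pairwise anticomplete cores in
`U`, and `M c` is a set of hubs attached to `Y c`: every vertex of `U'` has a neighbour in some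
`M c`, and through it a broom with all leaves in `Y c`. Each vertex of `U'` touches only few of the
sets `M c ∪ Y c`. -/
structure Layer {V : Type*} (G : SimpleGraph V) (δ K : ℕ) (U U' : Set V) where
  /-- the vertex set of the core with index `c` -/
  Y : ℕ → Finset V
  /-- the set of hubs with index `c` -/
  M : ℕ → Set V
  /-- `out m c` : one of the few indices `c` whose core is touched by the hub `m` -/
  out : V → ℕ → Prop
  /-- `into m c` : one of the few hubs `m` that touch the core of index `c` -/
  into : V → ℕ → Prop
  sub : U' ⊆ U
  Y_sub : ∀ c, ∀ y ∈ Y c, y ∈ U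
  M_sub : ∀ c, ∀ m ∈ M c, m ∈ U
  Y_notMem : ∀ c, ∀ y ∈ Y c, y ∉ U'
  M_notMem : ∀ c, ∀ m ∈ M c, m ∉ U'
  card_Y : ∀ c, (Y c).card ≤ K
  Y_apart : ∀ c c', c ≠ c' → Apart G (Y c) (Y c')
  M_disj : ∀ c c' m, m ∈ M c → m ∈ M c' → c = c'
  touch : ∀ c c', c ≠ c' → ∀ m ∈ M c, Touches G m (Y c') → out m c' ∨ into m c'
  out_few : ∀ m, Few K (fun c => out m c)
  into_few : ∀ c, Few K (fun m => into m c)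
  near : ∀ x ∈ U', Few K (fun c => Touches G x (M c ∪ Y c))
  cover : ∀ x ∈ U', ∃ c, ∃ m ∈ M c, G.Adj x m
  broom : ∀ x ∈ U', ∀ c, ∀ m ∈ M c, G.Adj x m → HasBroomOne G δ x (insert m (Y c))
  color : ∀ c, ColorableOn G.Adj {x | x ∈ U' ∧ ∃ m ∈ M c, G.Adj x m} K
  alt : (∀ c, M c = Y c) ∨
    ∀ c, (∀ m ∈ M c, ∃ y ∈ Y c, G.Adj y m) ∧ ∀ y ∈ Y c, ∀ x ∈ U', ¬ G.Adj y x

/-- A choice, for every vertex of `Q`, of an index `idx v` and a hub of this index adjacent to `v`,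
such that a chosen hub has few neighbours in `Q` with larger index, and, unless there are few hubs
for each index, each hub has many private neighbours in `X`. -/
structure IsRefined {V : Type*} {G : SimpleGraph V} {δ K : ℕ} {U U' : Set V}
    (L : Layer G δ K U U') (K' : ℕ) (X Q : Set V) (idx : V → ℕ) (hub : V → V) (H : ℕ → Set V) :
    Prop where
  H_sub : ∀ c, H c ⊆ L.M c
  hub_mem : ∀ v ∈ Q, hub v ∈ H (idx v)
  adj_hub : ∀ v ∈ Q, G.Adj v (hub v)
  late : ∀ c, ∀ m ∈ H c, Few K' (fun w => w ∈ Q ∧ c < idx w ∧ G.Adj m w)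
  alt : (∀ c, Few K' (fun m => m ∈ H c)) ∨
    ∀ c, (∀ m ∈ H c, ∃ y ∈ L.Y c, G.Adj y m) ∧ (∀ y ∈ L.Y c, ∀ x ∈ X, ¬ G.Adj y x) ∧
      ∀ m ∈ H c, ∃ P : Finset V, P.card = K * δ + 1 ∧
        ∀ p ∈ P, p ∈ X ∧ G.Adj m p ∧ ∀ m' ∈ H c, G.Adj m' p → m' = m

/-- A nested sequence of layers with refined choices of hubs for the first `R` of them. The private
neighbours of the hubs are in `X`, and the choices are made for the vertices of `Q`. -/
structure Nest {V : Type*} (G : SimpleGraph V) (δ K K' R : ℕ) where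
  U : ℕ → Set V
  layer : ∀ r, Layer G δ K (U r) (U (r + 1))
  X : Set V
  X_sub : X ⊆ U R
  Q : Set V
  Q_sub : Q ⊆ X
  idx : ℕ → V → ℕ
  hub : ℕ → V → V
  H : ℕ → ℕ → Set V
  refined : ∀ r < R, IsRefined (layer r) K' X Q (idx r) (hub r) (H r)

namespace Nest
variable {V : Type*} {G : SimpleGraph V} {δ τ K K' R : ℕ} (𝒩 : Nest G δ K K' R)

theorem antitone : Antitone 𝒩.U := antitone_nat_of_succ_le fun r => (𝒩.layer r).sub

/-- The hubs of `v` in the layers of `Ξ`, together with the cores that they belong to. -/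
def obj (Ξ : Finset ℕ) (v : V) : Set V :=
  {x | ∃ s ∈ Ξ, x = 𝒩.hub s v ∨ x ∈ (𝒩.layer s).Y (𝒩.idx s v)}

theorem hub_mem_M {s : ℕ} (hs : s < R) {v : V} (hv : v ∈ 𝒩.Q) :
    𝒩.hub s v ∈ (𝒩.layer s).M (𝒩.idx s v) :=
  (𝒩.refined s hs).H_sub _ ((𝒩.refined s hs).hub_mem v hv)

theorem few_obj (Ξ : Finset ℕ) (v : V) : Few (Ξ.card * (1 + K)) (fun x => x ∈ 𝒩.obj Ξ v) := by
  refine Few.bind Ξ fun s _ => Few.or ((few_mem {𝒩.hub s v}).mono (by simp) (by simp)) ?_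
  exact (few_mem _).mono ((𝒩.layer s).card_Y _) (fun _ h => h)

theorem obj_sub {Ξ : Finset ℕ} (hΞ : ∀ s ∈ Ξ, s < R) {v : V} (hv : v ∈ 𝒩.Q) {x : V} {s : ℕ}
    (hs : s ∈ Ξ) (hx : x = 𝒩.hub s v ∨ x ∈ (𝒩.layer s).Y (𝒩.idx s v)) :
    x ∈ 𝒩.U s ∧ x ∈ (𝒩.layer s).M (𝒩.idx s v) ∪ ((𝒩.layer s).Y (𝒩.idx s v) : Set V) := by
  rcases hx with rfl | hx
  · have := 𝒩.hub_mem_M (hΞ s hs) hv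
    exact ⟨(𝒩.layer s).M_sub _ _ this, Or.inl this⟩
  · exact ⟨(𝒩.layer s).Y_sub _ _ hx, Or.inr hx⟩

theorem mem_U {Ξ : Finset ℕ} (hΞ : ∀ s ∈ Ξ, s < R) {x : V} (hx : x ∈ 𝒩.X) :
    ∀ s ∈ Ξ, x ∈ 𝒩.U (s + 1) := fun s hs => 𝒩.antitone (hΞ s hs) (𝒩.X_sub hx)

section family
variable {ι : Type*} {Ξ : Finset ℕ} {S : Finset ι} {w : ι → V}

/-- A vertex that survives in the layers of `Ξ` touches few objects with pairwise different indices
in each of these layers. -/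
theorem few_touches_obj (hΞ : ∀ s ∈ Ξ, s < R) (hw : ∀ t ∈ S, w t ∈ 𝒩.Q)
    (hinj : ∀ s ∈ Ξ, ∀ t ∈ S, ∀ t' ∈ S, 𝒩.idx s (w t) = 𝒩.idx s (w t') → t = t')
    {x : V} (hx : ∀ s ∈ Ξ, x ∈ 𝒩.U (s + 1)) :
    Few (Ξ.card * K) (fun t => t ∈ S ∧ Touches G x (𝒩.obj Ξ (w t))) := by
  refine (Few.bind Ξ (D := K) (P := fun s t => t ∈ S ∧ Touches G x ((𝒩.layer s).M (𝒩.idx s (w t)) ∪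
    ((𝒩.layer s).Y (𝒩.idx s (w t)) : Set V))) fun s hs => ?_).mono le_rfl ?_
  · exact ((𝒩.layer s).near x (hx s hs)).preimage (P := fun t => t ∈ S)
      (fun t => 𝒩.idx s (w t)) (fun a ha b hb h => hinj s hs a ha b hb h)
  · rintro t ⟨ht, y, ⟨s, hs, hy⟩, hxy⟩
    exact ⟨s, hs, ht, y, (𝒩.obj_sub hΞ (hw t ht) hs hy).2, hxy⟩

/-- Many objects with pairwise different indices include many that are pairwise apart. -/
theorem exists_apart_obj (hG : Tame G δ τ) (hΞ : ∀ s ∈ Ξ, s < R) (hw : ∀ t ∈ S, w t ∈ 𝒩.Q)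
    (hinj : ∀ s ∈ Ξ, ∀ t ∈ S, ∀ t' ∈ S, 𝒩.idx s (w t) = 𝒩.idx s (w t') → t = t') (k : ℕ)
    (hS : (ram (τ + 1))^[Ξ.card] ((2 * (Ξ.card * (1 + K) * (Ξ.card * K) + (Ξ.card * K + Ξ.card * K))
      + 1) * k + 1) ≤ S.card) :
    ∃ S' ⊆ S, S'.card = k ∧ ∀ t ∈ S', ∀ t' ∈ S', t ≠ t' →
      Apart G (𝒩.obj Ξ (w t)) (𝒩.obj Ξ (w t')) := by
  obtain ⟨S₁, hS₁, hc₁, hna⟩ := hG.exists_nonadj_family _ Ξ (fun s t => 𝒩.hub s (w t)) S hS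
  -- conflicts between different layers, and between hubs and cores of the same layer
  let R₁ : ι → ι → Prop := fun t t' => ∃ x, x ∈ 𝒩.obj Ξ (w t) ∧ ∃ s ∈ Ξ, t' ∈ S ∧ x ∈ 𝒩.U (s + 1) ∧
    Touches G x ((𝒩.layer s).M (𝒩.idx s (w t')) ∪ ((𝒩.layer s).Y (𝒩.idx s (w t')) : Set V))
  let R₂ : ι → ι → Prop := fun t t' => ∃ s ∈ Ξ, t' ∈ S ∧
    (𝒩.layer s).out (𝒩.hub s (w t)) (𝒩.idx s (w t'))
  let R₃ : ι → ι → Prop := fun t t' => ∃ s ∈ Ξ, t' ∈ S ∧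
    (𝒩.layer s).into (𝒩.hub s (w t')) (𝒩.idx s (w t))
  have hR₁ : ∀ t ∈ S, Few (Ξ.card * (1 + K) * (Ξ.card * K)) (R₁ t) := by
    intro t ht
    refine (𝒩.few_obj Ξ (w t)).bind_few fun x hx => ?_
    refine Few.bind Ξ fun s hs => ?_
    by_cases hxU : x ∈ 𝒩.U (s + 1)
    · exact (((𝒩.layer s).near x hxU).preimage (P := fun t => t ∈ S)
        (fun t => 𝒩.idx s (w t)) (fun a ha b hb h => hinj s hs a ha b hb h)).mono le_rfl
        (fun t' ht' => ⟨ht'.1, ht'.2.2⟩)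
    · exact (few_false fun t' ht' => hxU ht'.2.1).mono (Nat.zero_le _) fun _ h => h
  have hR₂ : ∀ t ∈ S, Few (Ξ.card * K) (R₂ t) := fun t _ => Few.bind Ξ fun s hs =>
    ((𝒩.layer s).out_few (𝒩.hub s (w t))).preimage (P := fun t => t ∈ S)
        (fun t => 𝒩.idx s (w t)) (fun a ha b hb h => hinj s hs a ha b hb h)
  have hub_inj : ∀ s ∈ Ξ, ∀ t ∈ S, ∀ t' ∈ S, 𝒩.hub s (w t) = 𝒩.hub s (w t') → t = t' := by
    intro s hs t ht t' ht' h
    refine hinj s hs t ht t' ht' ((𝒩.layer s).M_disj _ _ _ (𝒩.hub_mem_M (hΞ s hs) (hw t ht)) ?_)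
    rw [h]
    exact 𝒩.hub_mem_M (hΞ s hs) (hw t' ht')
  have hR₃ : ∀ t ∈ S, Few (Ξ.card * K) (R₃ t) := fun t _ => Few.bind Ξ fun s hs =>
    ((𝒩.layer s).into_few (𝒩.idx s (w t))).preimage (P := fun t => t ∈ S)
        (fun t => 𝒩.hub s (w t)) (fun a ha b hb h => hub_inj s hs a ha b hb h)
  obtain ⟨S₂, hS₂, hc₂, hfree⟩ := exists_free_subset (s := S₁)
    (R := fun t t' => R₁ t t' ∨ R₂ t t' ∨ R₃ t t')
    (fun t ht => ((hR₁ t (hS₁ ht)).or ((hR₂ t (hS₁ ht)).or (hR₃ t (hS₁ ht)))).mono le_rfl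
      fun t' ht' => ht'.2.2) hc₁.ge
  refine ⟨S₂, hS₂.trans hS₁, hc₂, fun t ht t' ht' htt => apart_iff.2 ?_⟩
  have htS := hS₁ (hS₂ ht)
  have htS' := hS₁ (hS₂ ht')
  rintro x hxo ⟨y, hyo, hxy⟩
  obtain ⟨s, hs, hx⟩ := hxo
  obtain ⟨s', hs', hy⟩ := hyo
  have hxs := 𝒩.obj_sub hΞ (hw t htS) hs hx
  have hys := 𝒩.obj_sub hΞ (hw t' htS') hs' hy
  have hyx : y = x ∨ G.Adj y x := hxy.imp Eq.symm fun h => h.symm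
  rcases lt_trichotomy s s' with hlt | rfl | hlt
  · exact hfree t' ht' t ht (Ne.symm htt) (Or.inl ⟨y, ⟨s', hs', hy⟩, s, hs, htS,
      𝒩.antitone hlt hys.1, x, hxs.2, hyx⟩)
  · have hidx : 𝒩.idx s (w t) ≠ 𝒩.idx s (w t') := fun h => htt (hinj s hs t htS t' htS' h)
    rcases hx with rfl | hx
    · rcases hy with rfl | hy
      · rcases hxy with hxy | hxy
        · exact htt (hub_inj s hs t htS t' htS' hxy)
        · exact hna s hs t (hS₂ ht) t' (hS₂ ht') hxy
      · rcases (𝒩.layer s).touch _ _ hidx _ (𝒩.hub_mem_M (hΞ s hs) (hw t htS)) ⟨y, hy, hxy⟩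
          with h | h
        · exact hfree t ht t' ht' htt (Or.inr (Or.inl ⟨s, hs, htS', h⟩))
        · exact hfree t' ht' t ht (Ne.symm htt) (Or.inr (Or.inr ⟨s, hs, htS, h⟩))
    · rcases hy with rfl | hy
      · rcases (𝒩.layer s).touch _ _ hidx.symm _ (𝒩.hub_mem_M (hΞ s hs) (hw t' htS')) ⟨x, hx, hyx⟩
          with h | h
        · exact hfree t' ht' t ht (Ne.symm htt) (Or.inr (Or.inl ⟨s, hs, htS, h⟩))
        · exact hfree t ht t' ht' htt (Or.inr (Or.inr ⟨s, hs, htS', h⟩))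
      · have := (𝒩.layer s).Y_apart _ _ hidx x hx y hy
        rcases hxy with h | h
        · exact this.1 h
        · exact this.2 h
  · exact hfree t ht t' ht' htt (Or.inl ⟨x, ⟨s, hs, hx⟩, s', hs', htS',
      𝒩.antitone hlt hxs.1, y, hys.2, hxy⟩)

end family

/-- The hubs of `v` in enough layers contain the leaves of a broom with hub `v`. -/
theorem exists_leaves (hG : Tame G δ τ) {Ξ : Finset ℕ} (hΞ : ∀ s ∈ Ξ, s < R)
    (hcard : ram (τ + 1) δ ≤ Ξ.card) {v : V} (hv : v ∈ 𝒩.Q) :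
    ∃ L : Finset V, L.card = δ ∧ (∀ l ∈ L, ∃ s ∈ Ξ, l = 𝒩.hub s v) ∧
      ∀ l ∈ L, ∀ l' ∈ L, ¬ G.Adj l l' := by
  classical
  obtain ⟨Ξ', h1, h2, h3⟩ := hG.exists_nonadj δ (fun s => 𝒩.hub s v) Ξ hcard
  refine ⟨Ξ'.image fun s => 𝒩.hub s v, ?_, ?_, ?_⟩
  · rw [Finset.card_image_of_injOn, h2]
    have aux : ∀ s s', s < s' → s < R → s' < R → 𝒩.hub s v ≠ 𝒩.hub s' v := by
      intro s s' hlt hs hs' h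
      refine (𝒩.layer s).M_notMem _ _ (𝒩.hub_mem_M hs hv) ?_
      rw [h]
      exact 𝒩.antitone hlt ((𝒩.layer s').M_sub _ _ (𝒩.hub_mem_M hs' hv))
    intro s hs s' hs' h
    by_contra hne
    rcases lt_or_gt_of_ne hne with hlt | hlt
    · exact aux s s' hlt (hΞ s (h1 hs)) (hΞ s' (h1 hs')) h
    · exact aux s' s hlt (hΞ s' (h1 hs')) (hΞ s (h1 hs)) h.symm
  · intro l hl
    obtain ⟨s, hs, rfl⟩ := Finset.mem_image.1 hl
    exact ⟨s, h1 hs, rfl⟩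
  · intro l hl l' hl'
    obtain ⟨s, hs, rfl⟩ := Finset.mem_image.1 hl
    obtain ⟨s', hs', rfl⟩ := Finset.mem_image.1 hl'
    exact h3 s hs s' hs'

theorem hasLeaves (hG : Tame G δ τ) {Ξ : Finset ℕ} (hΞ : ∀ s ∈ Ξ, s < R)
    (hcard : ram (τ + 1) δ ≤ Ξ.card) {v : V} (hv : v ∈ 𝒩.Q) : HasLeaves G δ v (𝒩.obj Ξ v) := by
  obtain ⟨L, h1, h2, h3⟩ := 𝒩.exists_leaves hG hΞ hcard hv
  refine ⟨L, h1, fun l hl => ?_, h3⟩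
  obtain ⟨s, hs, rfl⟩ := h2 l hl
  exact ⟨⟨s, hs, Or.inl rfl⟩, (𝒩.refined s (hΞ s hs)).adj_hub v hv⟩

theorem hasBroomOne_obj {Ξ : Finset ℕ} (hΞ : ∀ s ∈ Ξ, s < R) (hne : Ξ.Nonempty) {v : V}
    (hv : v ∈ 𝒩.Q) : HasBroomOne G δ v (𝒩.obj Ξ v) := by
  obtain ⟨s, hs⟩ := hne
  refine ((𝒩.layer s).broom v (𝒩.mem_U hΞ (𝒩.Q_sub hv) s hs) _ _ (𝒩.hub_mem_M (hΞ s hs) hv)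
    ((𝒩.refined s (hΞ s hs)).adj_hub v hv)).mono ?_
  rintro x (rfl | hx)
  · exact ⟨s, hs, Or.inl rfl⟩
  · exact ⟨s, hs, Or.inr hx⟩

/-- An edge `x v` extends to a broom with handle `x`, either through `v` or through a hub of `v`
that is adjacent to `x`. -/
theorem hasBroomOne_insert (hG : Tame G δ τ) {Ξ : Finset ℕ} (hΞ : ∀ s ∈ Ξ, s < R)
    (hcard : ram (τ + 1) δ ≤ Ξ.card) {x v : V} (hx : ∀ s ∈ Ξ, x ∈ 𝒩.U (s + 1)) (hv : v ∈ 𝒩.Q)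
    (hxv : G.Adj x v) : HasBroomOne G δ x (insert v (𝒩.obj Ξ v)) := by
  by_cases h : ∃ s ∈ Ξ, G.Adj x (𝒩.hub s v)
  · obtain ⟨s, hs, h⟩ := h
    refine ((𝒩.layer s).broom x (hx s hs) _ _ (𝒩.hub_mem_M (hΞ s hs) hv) h).mono ?_
    rintro y (rfl | hy)
    · exact Or.inr ⟨s, hs, Or.inl rfl⟩
    · exact Or.inr ⟨s, hs, Or.inr hy⟩
  · push Not at h
    obtain ⟨L, h1, h2, h3⟩ := 𝒩.exists_leaves hG hΞ hcard hv
    refine ⟨v, L, ⟨hxv, h1, ?_, ?_, ?_, h3⟩, Or.inl rfl, ?_⟩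
    · intro l hl
      obtain ⟨s, hs, rfl⟩ := h2 l hl
      exact (𝒩.refined s (hΞ s hs)).adj_hub v hv
    · intro l hl
      obtain ⟨s, hs, rfl⟩ := h2 l hl
      exact h s hs
    · intro l hl hxl
      obtain ⟨s, hs, rfl⟩ := h2 l hl
      exact (𝒩.layer s).M_notMem _ _ (𝒩.hub_mem_M (hΞ s hs) hv) (hxl ▸ hx s hs)
    · intro l hl
      obtain ⟨s, hs, rfl⟩ := h2 l hl
      exact Or.inr ⟨s, hs, Or.inl rfl⟩

end Nest

/-! ### Embedding the tree into nested layers -/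

/-- Size of a family that guarantees a subfamily of size `k` with pairwise apart objects. -/
def objBound (τ K n k : ℕ) : ℕ :=
  (ram (τ + 1))^[n] ((2 * (n * (1 + K) * (n * K) + (n * K + n * K)) + 1) * k + 1)

/-- The analogue of `objBound` for objects together with the vertices that carry them. -/
def vertexObjBound (τ K n k : ℕ) : ℕ :=
  ram (τ + 1) (objBound τ K n ((2 * (n * K) + 1) * k + 1))

/-- An upper bound for the number of neighbours with pairwise different indices. -/
def adjBound (δ τ K n : ℕ) : ℕ := vertexObjBound τ K n (n * K + 2 * δ)

/-- Size of a family that guarantees the tree in `Nest.isIndContained_of_root`. -/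
def rootBound (δ τ K K' D : ℕ) : ℕ :=
  (2 * D + 1) * (K * (ram (τ + 1) (K * ((2 * (δ * (D + D) + D) + 1) * (D + 2 * δ) + 1) + 1)) + 1
    + K' + 1) + 1

theorem le_ram_one (τ k : ℕ) : 1 ≤ ram (τ + 1) k := by simp [ram]

/-- An upper bound for the number of vertices with the same index in one layer and pairwise different
indices in `n` lower layers. -/
def pieceBound (δ τ K K' n : ℕ) : ℕ :=
  vertexObjBound τ K n (rootBound δ τ K K' (adjBound δ τ K n + n * K))

namespace Nest
variable {V : Type*} {G : SimpleGraph V} {δ τ K K' R : ℕ} (𝒩 : Nest G δ K K' R)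

section family
variable {ι : Type*} {Ξ : Finset ℕ} {S : Finset ι} {w : ι → V}

/-- The version of `Nest.exists_apart_obj` for objects together with the vertices that carry them. -/
theorem exists_apart_vertex_obj (hG : Tame G δ τ) (hΞ : ∀ s ∈ Ξ, s < R) (hne : Ξ.Nonempty)
    (hw : ∀ t ∈ S, w t ∈ 𝒩.Q)
    (hinj : ∀ s ∈ Ξ, ∀ t ∈ S, ∀ t' ∈ S, 𝒩.idx s (w t) = 𝒩.idx s (w t') → t = t') (k : ℕ)
    (hS : vertexObjBound τ K Ξ.card k ≤ S.card) :
    ∃ S' ⊆ S, S'.card = k ∧ ∀ t ∈ S', ∀ t' ∈ S', t ≠ t' →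
      Apart G (insert (w t) (𝒩.obj Ξ (w t))) (insert (w t') (𝒩.obj Ξ (w t'))) := by
  obtain ⟨S₁, hS₁, hc₁, hna⟩ := hG.exists_nonadj _ w S hS
  obtain ⟨S₂, hS₂, hc₂, hap⟩ := 𝒩.exists_apart_obj hG hΞ (fun t ht => hw t (hS₁ ht))
    (fun s hs t ht t' ht' => hinj s hs t (hS₁ ht) t' (hS₁ ht')) _ hc₁.ge
  obtain ⟨S₃, hS₃, hc₃, hfree⟩ := exists_free_subset (s := S₂) (D := Ξ.card * K) (k := k)
    (R := fun t t' => Touches G (w t) (𝒩.obj Ξ (w t')))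
    (fun t ht => (𝒩.few_touches_obj (S := S) hΞ hw hinj (x := w t)
      (𝒩.mem_U hΞ (𝒩.Q_sub (hw t (hS₁ (hS₂ ht)))))).mono le_rfl
      fun t' ht' => ⟨hS₁ (hS₂ ht'.1), ht'.2.2⟩) hc₂.ge
  refine ⟨S₃, hS₃.trans (hS₂.trans hS₁), hc₃, fun t ht t' ht' htt => ?_⟩
  rintro x (rfl | hx) y (rfl | hy)
  · refine ⟨fun h => htt ?_, hna t (hS₂ (hS₃ ht)) t' (hS₂ (hS₃ ht'))⟩
    obtain ⟨s, hs⟩ := hne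
    exact hinj s hs t (hS₁ (hS₂ (hS₃ ht))) t' (hS₁ (hS₂ (hS₃ ht'))) (by rw [h])
  · exact ⟨fun h => hfree t ht t' ht' htt ⟨y, hy, Or.inl h⟩,
      fun h => hfree t ht t' ht' htt ⟨y, hy, Or.inr h⟩⟩
  · exact ⟨fun h => hfree t' ht' t ht (Ne.symm htt) ⟨x, hx, Or.inl h.symm⟩,
      fun h => hfree t' ht' t ht (Ne.symm htt) ⟨x, hx, Or.inr h.symm⟩⟩
  · exact hap t (hS₃ ht) t' (hS₃ ht') htt x hx y hy

/-- A vertex that survives in the layers of `Ξ` has few neighbours with pairwise different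
indices in each of these layers. -/
theorem few_adj (hG : Tame G δ τ) (hΞ : ∀ s ∈ Ξ, s < R) (hcard : ram (τ + 1) δ ≤ Ξ.card)
    (hw : ∀ t ∈ S, w t ∈ 𝒩.Q)
    (hinj : ∀ s ∈ Ξ, ∀ t ∈ S, ∀ t' ∈ S, 𝒩.idx s (w t) = 𝒩.idx s (w t') → t = t')
    {x : V} (hx : ∀ s ∈ Ξ, x ∈ 𝒩.U (s + 1)) :
    Few (adjBound δ τ K Ξ.card) (fun t => t ∈ S ∧ G.Adj x (w t)) := by
  by_contra hcon
  obtain ⟨S₁, hc₁, hS₁⟩ := exists_many_of_not_few hcon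
  have hne : Ξ.Nonempty := Finset.card_pos.1 ((le_ram_one τ δ).trans hcard)
  obtain ⟨S₂, hS₂, hc₂, hap⟩ := 𝒩.exists_apart_vertex_obj hG hΞ hne
    (fun t ht => hw t (hS₁ t ht).1) (fun s hs t ht t' ht' => hinj s hs t (hS₁ t ht).1 t'
      (hS₁ t' ht').1) (Ξ.card * K + 2 * δ) (by rw [hc₁]; exact Nat.le_succ _)
  exact hG.free (isIndContained_of_star S₂ w (fun t => 𝒩.obj Ξ (w t)) hc₂.ge
    (fun t ht => (hS₁ t (hS₂ ht)).2)
    ((𝒩.few_touches_obj hΞ hw hinj hx).mono le_rfl fun t ht => ⟨(hS₁ t (hS₂ ht.1)).1, ht.2⟩)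
    hap (fun t ht => 𝒩.hasLeaves hG hΞ hcard (hw t (hS₁ t (hS₂ ht)).1))
    (fun t ht => 𝒩.hasBroomOne_obj hΞ hne (hw t (hS₁ t (hS₂ ht)).1)))

end family

/-- A large family of vertices with the same index in layer `r`, such that no hub of this index and
no vertex of `X` has many neighbours in the family, gives the tree: the root is a vertex `y` of the
core of this index, the brooms of length one have the hubs of the family with private neighbours as
leaves, and the brooms of length two pass through the hubs and the family. -/
theorem isIndContained_of_root {ι : Type*} (hG : Tame G δ τ) {r : ℕ} (hr : r < R) {c D : ℕ}
    (S : Finset ι) (v : ι → V) (Z : ι → Set V) (hS : rootBound δ τ K K' D ≤ S.card)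
    (hv : ∀ t ∈ S, v t ∈ 𝒩.Q ∧ 𝒩.idx r (v t) = c)
    (hZ : ∀ t ∈ S, ∀ t' ∈ S, t ≠ t' → Apart G (insert (v t) (Z t)) (insert (v t') (Z t')))
    (hM : ∀ m ∈ 𝒩.H r c, Few D (fun t => t ∈ S ∧ G.Adj m (v t)))
    (hMZ : ∀ m ∈ 𝒩.H r c, Few D (fun t => t ∈ S ∧ Touches G m (Z t)))
    (hX : ∀ p ∈ 𝒩.X, Few D (fun t => t ∈ S ∧ G.Adj p (v t)))
    (hXZ : ∀ p ∈ 𝒩.X, Few D (fun t => t ∈ S ∧ Touches G p (Z t)))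
    (hYZ : ∀ y ∈ (𝒩.layer r).Y c, (∀ x ∈ 𝒩.X, ¬ G.Adj y x) → Few D (fun t => t ∈ S ∧ Touches G y (Z t)))
    (h1 : ∀ t ∈ S, HasBroomOne G δ (𝒩.hub r (v t)) (insert (v t) (Z t))) :
    (T δ).IsIndContained G := by
  classical
  have href := 𝒩.refined r hr
  set m : ι → V := fun t => 𝒩.hub r (v t) with hm
  have hmH : ∀ t ∈ S, m t ∈ 𝒩.H r c := fun t ht => by
    have := href.hub_mem (v t) (hv t ht).1
    rwa [(hv t ht).2] at this
  have hmv : ∀ t ∈ S, G.Adj (m t) (v t) := fun t ht => (href.adj_hub (v t) (hv t ht).1).symm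
  have hmU : ∀ t ∈ S, m t ∉ 𝒩.U (r + 1) := fun t ht =>
    (𝒩.layer r).M_notMem _ _ (href.H_sub _ (hmH t ht))
  have hXU : ∀ x ∈ 𝒩.X, x ∈ 𝒩.U (r + 1) := fun x hx => 𝒩.antitone hr (𝒩.X_sub hx)
  have hvX : ∀ t ∈ S, v t ∈ 𝒩.X := fun t ht => 𝒩.Q_sub (hv t ht).1
  -- an induced matching between hubs and family
  obtain ⟨S₁, hS₁, hc₁, hmatch⟩ := exists_free_subset (s := S)
    (R := fun t t' => G.Adj (m t) (v t')) (fun t ht => (hM (m t) (hmH t ht)).mono le_rfl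
      fun t' ht' => ⟨ht'.1, ht'.2.2⟩) hS
  have hmne : ∀ t ∈ S₁, ∀ t' ∈ S₁, m t = m t' → t = t' := by
    intro t ht t' ht' h
    by_contra htt
    exact hmatch t ht t' ht' htt (h ▸ hmv t' (hS₁ ht'))
  rcases href.alt with hH | hH
  · exfalso
    refine not_few_of_card_lt (D := K') (P := fun t => t ∈ S₁ ∧ m t ∈ 𝒩.H r c) (S := S₁) (by omega)
      (fun t ht => ⟨ht, hmH t (hS₁ ht)⟩) ?_
    exact (hH c).preimage (P := fun t => t ∈ S₁) m fun a ha b hb h => hmne a ha b hb h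
  obtain ⟨hHY, hYX, hpriv⟩ := hH c
  -- a common root
  have hHY' : ∀ t, ∃ y, t ∈ S₁ → y ∈ (𝒩.layer r).Y c ∧ G.Adj y (m t) := fun t => by
    by_cases ht : t ∈ S₁
    · obtain ⟨y, hy⟩ := hHY (m t) (hmH t (hS₁ ht))
      exact ⟨y, fun _ => hy⟩
    · exact ⟨v t, fun h => (ht h).elim⟩
  choose y hyp using hHY'
  have hyY : ∀ t ∈ S₁, y t ∈ (𝒩.layer r).Y c := fun t ht => (hyp t ht).1
  have hym : ∀ t ∈ S₁, G.Adj (y t) (m t) := fun t ht => (hyp t ht).2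
  obtain ⟨y₀, hy₀, S₂, hS₂, hc₂, hy⟩ := exists_fiber (S := S₁) y _ ((𝒩.layer r).card_Y c) hyY
    (k := ram (τ + 1) (K * ((2 * (δ * (D + D) + D) + 1) * (D + 2 * δ) + 1) + 1)) (by omega)
  obtain ⟨S₃, hS₃, hc₃, hmm⟩ := hG.exists_nonadj _ m S₂ hc₂.ge
  -- private neighbours of the same colour
  obtain ⟨f, hf, hf'⟩ := (𝒩.layer r).color c
  have hp : ∀ t ∈ S₃, ∃ P : Finset V, ∃ a < K, P.card = δ ∧ ∀ p ∈ P, p ∈ 𝒩.X ∧ G.Adj (m t) p ∧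
      (∀ m' ∈ 𝒩.H r c, G.Adj m' p → m' = m t) ∧ f p = a := by
    intro t ht
    have htH := hmH t (hS₁ (hS₂ (hS₃ ht)))
    obtain ⟨P, hPc, hP⟩ := hpriv (m t) htH
    obtain ⟨a, ha, P', hP', hPc', h⟩ := exists_fiber_nat (S := P) f (fun p hp =>
      hf p ⟨hXU p (hP p hp).1, m t, href.H_sub _ htH, (hP p hp).2.1.symm⟩) hPc.ge
    exact ⟨P', a, ha, hPc', fun p hp => ⟨(hP p (hP' hp)).1, (hP p (hP' hp)).2.1,
      (hP p (hP' hp)).2.2, h p hp⟩⟩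
  choose! P a ha hPc hPX hmP hPpriv hPa using hp
  obtain ⟨a₀, -, S₄, hS₄, hc₄, ha₀⟩ := exists_fiber_nat (S := S₃) a ha hc₃.ge
  have hPcol : ∀ t ∈ S₄, ∀ p ∈ P t, p ∈ {x | x ∈ 𝒩.U (r + 1) ∧ ∃ m ∈ (𝒩.layer r).M c, G.Adj x m} :=
    fun t ht p hp => ⟨hXU p (hPX t (hS₄ ht) p hp), m t,
      href.H_sub _ (hmH t (hS₁ (hS₂ (hS₃ (hS₄ ht))))), (hmP t (hS₄ ht) p hp).symm⟩
  have hPna : ∀ t ∈ S₄, ∀ t' ∈ S₄, ∀ p ∈ P t, ∀ p' ∈ P t', ¬ G.Adj p p' := by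
    intro t ht t' ht' p hp p' hp' hadj
    refine hf' p (hPcol t ht p hp) p' (hPcol t' ht' p' hp') hadj ?_
    rw [hPa t (hS₄ ht) p hp, hPa t' (hS₄ ht') p' hp', ha₀ t ht, ha₀ t' ht']
  have hsub : ∀ t ∈ S₄, t ∈ S := fun t ht => hS₁ (hS₂ (hS₃ (hS₄ ht)))
  -- remove the remaining conflicts
  obtain ⟨S₅, hS₅, hc₅, hfree⟩ := exists_free_subset (s := S₄) (D := δ * (D + D) + D)
    (R := fun t t' => (∃ p ∈ P t, (t' ∈ S ∧ G.Adj p (v t')) ∨ (t' ∈ S ∧ Touches G p (Z t'))) ∨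
      (t' ∈ S ∧ Touches G (m t) (Z t'))) (fun t ht => by
        refine Few.mono ?_ le_rfl fun t' (ht' : _ ∧ _) => ht'.2.2
        refine Few.or ?_ (hMZ (m t) (hmH t (hsub t ht)))
        have := Few.bind (P t) (P := fun p t' => (t' ∈ S ∧ G.Adj p (v t')) ∨
          (t' ∈ S ∧ Touches G p (Z t'))) fun p hp =>
          (hX p (hPX t (hS₄ ht) p hp)).or (hXZ p (hPX t (hS₄ ht) p hp))
        rwa [hPc t (hS₄ ht)] at this) hc₄.ge
  obtain ⟨S₆, hS₆, hc₆, hyZ⟩ := (hYZ y₀ hy₀ (hYX y₀ hy₀)).exists_subset (S := S₅) (k := 2 * δ) hc₅.ge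
  have hs4 : ∀ t ∈ S₆, t ∈ S₄ := fun t ht => hS₅ (hS₆ ht)
  have hs3 : ∀ t ∈ S₆, t ∈ S₃ := fun t ht => hS₄ (hs4 t ht)
  have hs2 : ∀ t ∈ S₆, t ∈ S₂ := fun t ht => hS₃ (hs3 t ht)
  have hs1 : ∀ t ∈ S₆, t ∈ S₁ := fun t ht => hS₂ (hs2 t ht)
  have hs : ∀ t ∈ S₆, t ∈ S := fun t ht => hS₁ (hs1 t ht)
  have hy₀U := (𝒩.layer r).Y_notMem c y₀ hy₀
  have hy₀m : ∀ t ∈ S₆, G.Adj y₀ (m t) := fun t ht => by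
    rw [← hy t (hs2 t ht)]
    exact hym t (hs1 t ht)
  have hyne : ∀ x ∈ 𝒩.X, y₀ ≠ x := fun x hx h => hy₀U (h ▸ hXU x hx)
  refine isIndContained_of_brooms (u := y₀) S₆ hc₆.ge
    (fun t => insert (m t) (P t : Set V) ∪ insert (v t) (Z t)) ?_ ?_ ?_
  · intro t ht
    refine ⟨m t, P t, ⟨hy₀m t ht, hPc t (hs3 t ht), hmP t (hs3 t ht),
      fun p hp => hYX y₀ hy₀ p (hPX t (hs3 t ht) p hp), fun p hp => hyne p (hPX t (hs3 t ht) p hp),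
      hPna t (hs4 t ht) t (hs4 t ht)⟩, Or.inl (Or.inl rfl), fun l hl => Or.inl (Or.inr hl)⟩
  · intro t ht
    refine ((h1 t (hs t ht)).extend (hy₀m t ht) ?_).mono ?_
    · rw [apart_iff]
      rintro y hyy ⟨x, hx | hx, h⟩ <;> rw [Set.mem_singleton_iff.1 hyy] at h
      · subst hx
        rcases h with h | h
        · exact hyne _ (hvX t (hs t ht)) h
        · exact hYX y₀ hy₀ _ (hvX t (hs t ht)) h
      · exact hyZ t ht ⟨hs t ht, x, hx, h⟩
    · rintro x (rfl | hx)
      · exact Or.inl (Or.inl rfl)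
      · exact Or.inr hx
  · intro t ht t' ht' htt
    -- the two mixed cases are symmetric
    have hmix : ∀ t ∈ S₆, ∀ t' ∈ S₆, t ≠ t' →
        Apart G (insert (m t) (P t : Set V)) (insert (v t') (Z t')) := by
      intro t ht t' ht' htt
      rintro x (rfl | hx) y (rfl | hy)
      · exact ⟨fun h => hmU t (hs t ht) (h ▸ hXU _ (hvX t' (hs t' ht'))),
          hmatch t (hs1 t ht) t' (hs1 t' ht') htt⟩
      · have h := hfree t (hS₆ ht) t' (hS₆ ht') htt
        exact ⟨fun hxy => h (Or.inr ⟨hs t' ht', y, hy, Or.inl hxy⟩),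
          fun hxy => h (Or.inr ⟨hs t' ht', y, hy, Or.inr hxy⟩)⟩
      · refine ⟨fun hxy => ?_, fun hxy =>
          hfree t (hS₆ ht) t' (hS₆ ht') htt (Or.inl ⟨x, hx, Or.inl ⟨hs t' ht', hxy⟩⟩)⟩
        exact hmatch t (hs1 t ht) t' (hs1 t' ht') htt (hxy ▸ hmP t (hs3 t ht) x hx)
      · have h := hfree t (hS₆ ht) t' (hS₆ ht') htt
        exact ⟨fun hxy => h (Or.inl ⟨x, hx, Or.inr ⟨hs t' ht', y, hy, Or.inl hxy⟩⟩),
          fun hxy => h (Or.inl ⟨x, hx, Or.inr ⟨hs t' ht', y, hy, Or.inr hxy⟩⟩)⟩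
    have hmP' : ∀ t ∈ S₆, ∀ t' ∈ S₆, t ≠ t' → ∀ p ∈ P t', m t ≠ p ∧ ¬ G.Adj (m t) p := by
      intro t ht t' ht' htt p hp
      refine ⟨fun h => hmU t (hs t ht) (h ▸ hXU _ (hPX t' (hs3 t' ht') p hp)), fun h => ?_⟩
      exact htt (hmne t (hs1 t ht) t' (hs1 t' ht')
        (hPpriv t' (hs3 t' ht') p hp _ (hmH t (hs t ht)) h))
    rintro x (hx | hx) y (hy | hy)
    · rcases hx with rfl | hx <;> rcases hy with rfl | hy
      · exact ⟨fun h => htt (hmne t (hs1 t ht) t' (hs1 t' ht') h),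
          hmm t (hs3 t ht) t' (hs3 t' ht')⟩
      · exact hmP' t ht t' ht' htt y hy
      · have := hmP' t' ht' t ht (Ne.symm htt) x hx
        exact ⟨this.1.symm, fun h => this.2 h.symm⟩
      · refine ⟨fun h => htt ?_, hPna t (hs4 t ht) t' (hs4 t' ht') x hx y hy⟩
        subst h
        exact hmne t (hs1 t ht) t' (hs1 t' ht') (hPpriv t' (hs3 t' ht') x hy _ (hmH t (hs t ht))
          (hmP t (hs3 t ht) x hx))
    · exact hmix t ht t' ht' htt x hx y hy
    · exact (hmix t' ht' t ht (Ne.symm htt)).symm x hx y hy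
    · exact hZ t (hs t ht) t' (hs t' ht') htt x hx y hy

/-- Vertices with the same index in layer `r` have few different indices in the lower layers. -/
theorem not_large_of_idx_eq {ι : Type*} (hG : Tame G δ τ) {r : ℕ} (hr : r < R) {Ξ : Finset ℕ}
    (hΞ : ∀ s ∈ Ξ, s < r) (hcard : ram (τ + 1) δ ≤ Ξ.card) {c : ℕ} (S : Finset ι) (v : ι → V)
    (hv : ∀ t ∈ S, v t ∈ 𝒩.Q ∧ 𝒩.idx r (v t) = c)
    (hinj : ∀ s ∈ Ξ, ∀ t ∈ S, ∀ t' ∈ S, 𝒩.idx s (v t) = 𝒩.idx s (v t') → t = t') :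
    S.card < pieceBound δ τ K K' Ξ.card := by
  by_contra hcon
  push Not at hcon
  have hΞ' : ∀ s ∈ Ξ, s < R := fun s hs => (hΞ s hs).trans hr
  have hne : Ξ.Nonempty := Finset.card_pos.1 ((le_ram_one τ δ).trans hcard)
  obtain ⟨S', hS', hc, hap⟩ := 𝒩.exists_apart_vertex_obj hG hΞ' hne (fun t ht => (hv t ht).1)
    hinj _ hcon
  have hadj : ∀ x, (∀ s ∈ Ξ, x ∈ 𝒩.U (s + 1)) →
      Few (adjBound δ τ K Ξ.card + Ξ.card * K) (fun t => t ∈ S' ∧ G.Adj x (v t)) := fun x hx =>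
    (𝒩.few_adj hG hΞ' hcard (fun t ht => (hv t ht).1) hinj hx).mono (Nat.le_add_right _ _)
      fun t ht => ⟨hS' ht.1, ht.2⟩
  have htou : ∀ x, (∀ s ∈ Ξ, x ∈ 𝒩.U (s + 1)) →
      Few (adjBound δ τ K Ξ.card + Ξ.card * K) (fun t => t ∈ S' ∧ Touches G x (𝒩.obj Ξ (v t))) :=
    fun x hx => (𝒩.few_touches_obj hΞ' (fun t ht => (hv t ht).1) hinj hx).mono
      (Nat.le_add_left _ _) fun t ht => ⟨hS' ht.1, ht.2⟩
  have hUr : ∀ x ∈ 𝒩.U r, ∀ s ∈ Ξ, x ∈ 𝒩.U (s + 1) := fun x hx s hs => 𝒩.antitone (hΞ s hs) hx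
  have hMU : ∀ m ∈ 𝒩.H r c, m ∈ 𝒩.U r := fun m hm =>
    (𝒩.layer r).M_sub _ _ ((𝒩.refined r hr).H_sub _ hm)
  refine hG.free (𝒩.isIndContained_of_root hG hr S' v (fun t => 𝒩.obj Ξ (v t)) hc.ge
    (fun t ht => hv t (hS' ht)) hap (fun m hm => hadj m (hUr m (hMU m hm)))
    (fun m hm => htou m (hUr m (hMU m hm))) (fun p hp => hadj p (𝒩.mem_U hΞ' hp))
    (fun p hp => htou p (𝒩.mem_U hΞ' hp))
    (fun y hy _ => htou y (hUr y ((𝒩.layer r).Y_sub _ _ hy))) fun t ht => ?_)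
  have hm := (𝒩.refined r hr).hub_mem (v t) (hv t (hS' ht)).1
  rw [(hv t (hS' ht)).2] at hm
  exact 𝒩.hasBroomOne_insert hG hΞ' hcard (hUr _ (hMU _ hm)) (hv t (hS' ht)).1
    ((𝒩.refined r hr).adj_hub (v t) (hv t (hS' ht)).1).symm

end Nest

theorem ColorableOn.fibers_fintype {V α : Type*} [Fintype α] {R : V → V → Prop} {X : Set V} {k : ℕ}
    (g : V → α) (h : ∀ a, ColorableOn R {v | v ∈ X ∧ g v = a} k) :
    ColorableOn R X (Fintype.card α * k) := by
  refine ColorableOn.fibers (fun v => (Fintype.equivFin α (g v) : ℕ)) (fun v _ => Fin.isLt _)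
    fun i hi => (h ((Fintype.equivFin α).symm ⟨i, hi⟩)).mono ?_ le_rfl
  rintro v ⟨hv, hgv⟩
  refine ⟨hv, ?_⟩
  rw [Equiv.eq_symm_apply]
  exact Fin.ext hgv

/-! ### Chains of layers -/

namespace Nest
variable {V : Type*} {G : SimpleGraph V} {δ τ K K' R : ℕ} (𝒩 : Nest G δ K K' R)

/-- On `Q`, the index in layer `r` determines the index in layer `s`. -/
def Determines (r s : ℕ) (Q : Set V) : Prop :=
  ∀ v ∈ Q, ∀ v' ∈ Q, 𝒩.idx r v = 𝒩.idx r v' → 𝒩.idx s v = 𝒩.idx s v'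

/-- As a set of vertices with the same index in layer `r` contains only bounded families with
pairwise different indices in all lower layers of `Ξ`, such a family and a layer of `Ξ` can be used to
split `Q` into few parts, on each of which the index in `r` determines the index in a layer of `Ξ`. -/
theorem colorableOn_of_determines [Finite V] (hG : Tame G δ τ) {r : ℕ} (hr : r < R) {Ξ : Finset ℕ}
    (hΞ : ∀ s ∈ Ξ, s < r) (hcard : ram (τ + 1) δ ≤ Ξ.card) {Q : Set V} (hQ : Q ⊆ 𝒩.Q) {k : ℕ}
    (h : ∀ Q' ⊆ Q, ∀ s ∈ Ξ, 𝒩.Determines r s Q' → ColorableOn G.Adj Q' k) :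
    ColorableOn G.Adj Q (R * (pieceBound δ τ K K' Ξ.card * k)) := by
  classical
  -- a maximal family in each piece with different indices in all layers of `Ξ`
  let P : ℕ → Finset V → Prop := fun c F => (∀ v ∈ F, v ∈ Q ∧ 𝒩.idx r v = c) ∧
    ∀ s ∈ Ξ, ∀ v ∈ F, ∀ v' ∈ F, 𝒩.idx s v = 𝒩.idx s v' → v = v'
  have hmax : ∀ c, ∃ F, Maximal (P c) F := fun c => by
    obtain ⟨F, hF⟩ := (Set.toFinite {F | P c F}).exists_maximal ⟨∅, by simp [P]⟩
    exact ⟨F, hF⟩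
  choose F hF using hmax
  have hFc : ∀ c, (F c).card < pieceBound δ τ K K' Ξ.card := fun c =>
    𝒩.not_large_of_idx_eq hG hr hΞ hcard (F c) id
      (fun t ht => ⟨hQ ((hF c).prop.1 t ht).1, ((hF c).prop.1 t ht).2⟩) (hF c).prop.2
  have hΞne : Ξ.Nonempty := Finset.card_pos.1 ((le_ram_one τ δ).trans hcard)
  have hrep : ∀ v, ∃ s f, v ∈ Q → s ∈ Ξ ∧ f ∈ F (𝒩.idx r v) ∧ 𝒩.idx s v = 𝒩.idx s f := by
    intro v
    by_cases hv : v ∈ Q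
    swap
    · exact ⟨0, v, fun h => (hv h).elim⟩
    by_contra hcon
    push Not at hcon
    have hcon' : ∀ s ∈ Ξ, ∀ f ∈ F (𝒩.idx r v), 𝒩.idx s v ≠ 𝒩.idx s f := fun s hs f hf =>
      (hcon s f).2 hs hf
    have hins : P (𝒩.idx r v) (insert v (F (𝒩.idx r v))) := by
      constructor
      · intro x hx
        rcases Finset.mem_insert.1 hx with rfl | hx
        · exact ⟨hv, rfl⟩
        · exact (hF _).prop.1 x hx
      · intro s hs x hx x' hx' hxx
        rcases Finset.mem_insert.1 hx with h1 | h1 <;> rcases Finset.mem_insert.1 hx' with h2 | h2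
        · rw [h1, h2]
        · exact (hcon' s hs x' h2 (h1 ▸ hxx)).elim
        · exact (hcon' s hs x h1 (h2 ▸ hxx).symm).elim
        · exact (hF _).prop.2 s hs x h1 x' h2 hxx
    have := (hF (𝒩.idx r v)).le_of_ge hins (Finset.subset_insert _ _) (Finset.mem_insert_self v _)
    obtain ⟨s, hs⟩ := hΞne
    exact hcon' s hs v this rfl
  choose s f hsf using hrep
  refine ColorableOn.fibers s (fun v hv => (hΞ _ (hsf v hv).1).trans hr) fun i _ => ?_
  by_cases hi : i ∈ Ξ
  swap
  · exact ColorableOn.of_isEmpty fun v hv => hi (hv.2 ▸ (hsf v hv.1).1)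
  have henum : ∀ c, ∃ e : V → ℕ, (∀ x ∈ F c, e x < (F c).card) ∧
      ∀ x ∈ F c, ∀ x' ∈ F c, e x = e x' → x = x' := fun c => by
    refine ⟨fun x => if hx : x ∈ F c then ((F c).equivFin ⟨x, hx⟩ : ℕ) else 0, ?_, ?_⟩
    · intro x hx
      simp only [hx, dif_pos]
      exact Fin.isLt _
    · intro x hx x' hx' h
      simp only [hx, hx', dif_pos] at h
      simpa using (F c).equivFin.injective (Fin.ext h)
  choose e he he' using henum
  refine ColorableOn.fibers (fun v => e (𝒩.idx r v) (f v))
    (fun v hv => (he _ _ (hsf v hv.1).2.1).trans (hFc _)) fun j _ => ?_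
  refine h _ (fun v hv => hv.1.1) i hi ?_
  rintro v ⟨⟨hv, hvi⟩, hvj⟩ v' ⟨⟨hv', hvi'⟩, hvj'⟩ hidx
  have h1 := hsf v hv
  have h2 := hsf v' hv'
  have : f v = f v' := by
    refine he' (𝒩.idx r v) _ h1.2.1 _ (hidx ▸ h2.2.1) (hvj.trans ?_)
    rw [← hvj', hidx]
  have h3 := h1.2.2
  have h4 := h2.2.2
  rw [hvi] at h3
  rw [hvi', ← this] at h4
  rw [h3, h4]

/-- To colour `Q` it suffices to colour the subsets on which, for a sufficiently large set of layers,
the lowest one has an index that is determined by the index in each of the others. -/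
theorem colorableOn_of_chain [Finite V] {B : ℕ} (hB : ram (τ + 1) δ ≤ B) (hG : Tame G δ τ)
    (hR : R = B * B) {k : ℕ}
    (h : ∀ Q' ⊆ 𝒩.Q, ∀ Ξ : Finset ℕ, (∀ s ∈ Ξ, s < R) → Ξ.card = B → ∀ z ∈ Ξ,
      (∀ s ∈ Ξ, 𝒩.Determines s z Q') → ColorableOn G.Adj Q' k) :
    ColorableOn G.Adj 𝒩.Q ((R * pieceBound δ τ K K' B) ^ (B - 1) * k) := by
  classical
  have hB1 : 1 ≤ B := (le_ram_one τ δ).trans hB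
  -- chains of length `i`, one layer from each block of `B` layers, from the top downwards
  let C : ℕ → (ℕ → ℕ) → Set V → Prop := fun i ρ Q =>
    (∀ j < i, (B - 1 - j) * B ≤ ρ j ∧ ρ j < (B - 1 - j) * B + B) ∧
      ∀ j, j + 1 < i → 𝒩.Determines (ρ j) (ρ (j + 1)) Q
  have key : ∀ i, i + 1 ≤ B → ∀ k, (∀ Q' ⊆ 𝒩.Q, ∀ ρ, C (i + 1) ρ Q' → ColorableOn G.Adj Q' k) →
      ColorableOn G.Adj 𝒩.Q ((R * pieceBound δ τ K K' B) ^ i * k) := by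
    intro i
    induction i with
    | zero =>
      intro _ k hk
      rw [pow_zero, one_mul]
      refine hk _ le_rfl (fun _ => (B - 1) * B) ⟨fun j hj => ?_, fun j hj => by omega⟩
      have : j = 0 := by omega
      subst this
      simp only [Nat.sub_zero]
      omega
    | succ i ih =>
      intro hi k hk
      rw [pow_succ, mul_assoc]
      refine ih (by omega) _ fun Q hQ ρ hρ => ?_
      rw [mul_assoc]
      have hblock : (B - 1 - (i + 1)) * B + B = (B - 1 - i) * B := by
        have : B - 1 - i = (B - 1 - (i + 1)) + 1 := by omega
        rw [this]; ring
      have hΞ : ((Finset.range B).image fun a => (B - 1 - (i + 1)) * B + a).card = B := by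
        rw [Finset.card_image_of_injective _ (fun a b hab => by simpa using hab),
          Finset.card_range]
      have hρi := hρ.1 i (by omega)
      have := 𝒩.colorableOn_of_determines hG (r := ρ i)
        (Ξ := (Finset.range B).image fun a => (B - 1 - (i + 1)) * B + a) (Q := Q) (k := k)
        ?_ ?_ ?_ hQ ?_
      · rwa [hΞ] at this
      · have : (B - 1 - i + 1) * B ≤ B * B := Nat.mul_le_mul_right _ (by omega)
        rw [hR]
        nlinarith
      · intro s hs
        obtain ⟨a, ha, rfl⟩ := Finset.mem_image.1 hs
        have := Finset.mem_range.1 ha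
        omega
      · rw [hΞ]; exact hB
      · intro Q' hQ' s hs hdet
        obtain ⟨a, ha, rfl⟩ := Finset.mem_image.1 hs
        have haB := Finset.mem_range.1 ha
        refine hk Q' (hQ'.trans hQ) (Function.update ρ (i + 1) ((B - 1 - (i + 1)) * B + a))
          ⟨fun j hj => ?_, fun j hj => ?_⟩
        · by_cases hji : j = i + 1
          · subst hji
            rw [Function.update_self]
            omega
          · rw [Function.update_of_ne hji]
            exact hρ.1 j (by omega)
        · rw [Function.update_of_ne (by omega : j ≠ i + 1)]
          by_cases hji : j = i
          · subst hji
            rw [Function.update_self]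
            exact hdet
          · rw [Function.update_of_ne (by omega : j + 1 ≠ i + 1)]
            exact fun v hv v' hv' => hρ.2 j (by omega) v (hQ' hv) v' (hQ' hv')
  refine key (B - 1) (by omega) k fun Q hQ ρ hρ => ?_
  have hBB : B - 1 + 1 = B := by omega
  rw [hBB] at hρ
  have hlt : ∀ j < B, ∀ j' < B, j < j' → ρ j' < ρ j := by
    intro j hj j' hj' hjj
    have h1 := hρ.1 j hj
    have h2 := hρ.1 j' hj'
    have : (B - 1 - j' + 1) * B ≤ (B - 1 - j) * B := Nat.mul_le_mul_right _ (by omega)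
    have h3 : (B - 1 - j' + 1) * B = (B - 1 - j') * B + B := by ring
    omega
  have hinj : Set.InjOn ρ (Finset.range B) := by
    intro j hj j' hj' h
    have hj := Finset.mem_range.1 hj
    have hj' := Finset.mem_range.1 hj'
    rcases lt_trichotomy j j' with hlt' | h' | hlt'
    · have := hlt j hj j' hj' hlt'; omega
    · exact h'
    · have := hlt j' hj' j hj hlt'; omega
  have hdet : ∀ d j, j + d < B → 𝒩.Determines (ρ j) (ρ (j + d)) Q := by
    intro d
    induction d with
    | zero => exact fun j _ v _ v' _ h => h
    | succ d ih =>
      exact fun j hj v hv v' hv' h => hρ.2 (j + d) (by omega) v hv v' hv'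
          (ih j (by omega) v hv v' hv' h)
  refine h Q hQ ((Finset.range B).image ρ) ?_ ?_ (ρ (B - 1)) ?_ ?_
  · intro s hs
    obtain ⟨j, hj, rfl⟩ := Finset.mem_image.1 hs
    have h1 := hρ.1 j (Finset.mem_range.1 hj)
    have : (B - 1 - j + 1) * B ≤ B * B := Nat.mul_le_mul_right _ (by omega)
    rw [hR]
    nlinarith
  · rw [Finset.card_image_of_injOn hinj, Finset.card_range]
  · exact Finset.mem_image_of_mem ρ (Finset.mem_range.2 (by omega))
  · intro s hs
    obtain ⟨j, hj, rfl⟩ := Finset.mem_image.1 hs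
    have hj := Finset.mem_range.1 hj
    have := hdet (B - 1 - j) j (by omega)
    rwa [show j + (B - 1 - j) = B - 1 by omega] at this

end Nest

/-- Bound for the number of family members adjacent to a vertex of `X`. -/
def edgeBound (δ τ K ν L n : ℕ) : ℕ :=
  (2 * ((1 + (1 + ν)) * L) + 1) *
    objBound τ K n ((2 * ((1 + (1 + ν)) * (n * K)) + 1) * (L + n * K + 2 * δ) + 1) + 1

namespace Nest
variable {V : Type*} {G : SimpleGraph V} {δ τ K K' R : ℕ} (𝒩 : Nest G δ K K' R)

/-! ### Colouring by the index in one layer -/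

/-- A family of edges `v t - w t` from the piece of index `c` in layer `z` to the pieces with
larger indices `t ∈ S`, with sets `W t` of further neighbours of `v t` in these pieces. -/
structure EdgeFamily (z c ν : ℕ) (Q₁ : Set V) (S : Finset ℕ) (v w : ℕ → V) (W : ℕ → Finset V) :
    Prop where
  Q_sub : Q₁ ⊆ 𝒩.Q
  stable : ∀ x ∈ Q₁, ∀ y ∈ Q₁, 𝒩.idx z x = 𝒩.idx z y → ¬ G.Adj x y
  v_mem : ∀ t ∈ S, v t ∈ Q₁
  idx_v : ∀ t ∈ S, 𝒩.idx z (v t) = c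
  lt : ∀ t ∈ S, c < t
  w_mem : ∀ t ∈ S, w t ∈ Q₁
  idx_w : ∀ t ∈ S, 𝒩.idx z (w t) = t
  adj : ∀ t ∈ S, G.Adj (v t) (w t)
  W_card : ∀ t ∈ S, (W t).card = ν
  W_mem : ∀ t ∈ S, ∀ x ∈ W t, x ∈ Q₁
  idx_W : ∀ t ∈ S, ∀ x ∈ W t, 𝒩.idx z x = t
  adj_W : ∀ t ∈ S, ∀ x ∈ W t, G.Adj (v t) x

/-- Every vertex of `X` touches at most `L` of the pieces of layer `z`. -/
def SeesFew (z L : ℕ) : Prop :=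
  ∀ x ∈ 𝒩.X, Few L (fun c => ∃ y ∈ 𝒩.Q, (x = y ∨ G.Adj x y) ∧ 𝒩.idx z y = c)

variable {𝒩} {z c ν L : ℕ} {Q₁ : Set V} {S : Finset ℕ} {v w : ℕ → V} {W : ℕ → Finset V}

theorem seesFew_of_determines (hG : Tame G δ τ) {Ξ : Finset ℕ} (hΞ : ∀ s ∈ Ξ, s < R)
    (hcard : ram (τ + 1) δ ≤ Ξ.card) (hdet : ∀ s ∈ Ξ, 𝒩.Determines s z 𝒩.Q) :
    𝒩.SeesFew z (1 + adjBound δ τ K Ξ.card) := by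
  classical
  intro x hx
  have h : Few (adjBound δ τ K Ξ.card) (fun c => ∃ y ∈ 𝒩.Q, G.Adj x y ∧ 𝒩.idx z y = c) := by
    by_contra hcon
    obtain ⟨S, hS, hP⟩ := exists_many_of_not_few hcon
    have : ∀ c, ∃ y, c ∈ S → y ∈ 𝒩.Q ∧ G.Adj x y ∧ 𝒩.idx z y = c := fun c => by
      by_cases hc : c ∈ S
      · obtain ⟨y, hy⟩ := hP c hc
        exact ⟨y, fun _ => hy⟩
      · exact ⟨x, fun h => (hc h).elim⟩
    choose y hy using this
    refine not_few_of_card_lt (D := adjBound δ τ K Ξ.card) (S := S) (by omega)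
      (fun c hc => ⟨hc, (hy c hc).2.1⟩)
      (𝒩.few_adj hG hΞ hcard (S := S) (w := y) (fun t ht => (hy t ht).1) ?_ (𝒩.mem_U hΞ hx))
    intro s hs t ht t' ht' htt
    have := hdet s hs _ (hy t ht).1 _ (hy t' ht').1 htt
    rwa [(hy t ht).2.2, (hy t' ht').2.2] at this
  refine (Few.or (few_mem {𝒩.idx z x}) h).mono (by simp) ?_
  rintro c ⟨y, hy, rfl | hxy, rfl⟩
  · exact Or.inl (by simp)
  · exact Or.inr ⟨y, hy, hxy, rfl⟩

/-- A vertex of `X` touches few members of a family of subsets of different pieces. -/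
theorem SeesFew.few_touches {ι : Type*} (h : 𝒩.SeesFew z L) {x : V} (hx : x ∈ 𝒩.X) {P : ι → Prop}
    (g : ι → ℕ) (hg : ∀ t, P t → ∀ t', P t' → g t = g t' → t = t') (B : ι → Set V)
    (hB : ∀ t, P t → ∀ y ∈ B t, y ∈ 𝒩.Q ∧ 𝒩.idx z y = g t) :
    Few L (fun t => P t ∧ Touches G x (B t)) := by
  refine ((h x hx).preimage (P := P) g hg).mono le_rfl ?_
  rintro t ⟨ht, y, hy, hxy⟩
  exact ⟨ht, y, (hB t ht y hy).1, hxy, (hB t ht y hy).2⟩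

namespace EdgeFamily

theorem mono (h : 𝒩.EdgeFamily z c ν Q₁ S v w W) {S' : Finset ℕ} (hS : S' ⊆ S) :
    𝒩.EdgeFamily z c ν Q₁ S' v w W where
  Q_sub := h.Q_sub
  stable := h.stable
  v_mem t ht := h.v_mem t (hS ht)
  idx_v t ht := h.idx_v t (hS ht)
  lt t ht := h.lt t (hS ht)
  w_mem t ht := h.w_mem t (hS ht)
  idx_w t ht := h.idx_w t (hS ht)
  adj t ht := h.adj t (hS ht)
  W_card t ht := h.W_card t (hS ht)
  W_mem t ht := h.W_mem t (hS ht)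
  idx_W t ht := h.idx_W t (hS ht)
  adj_W t ht := h.adj_W t (hS ht)

theorem mem_insert_W (h : 𝒩.EdgeFamily z c ν Q₁ S v w W) {t : ℕ} (ht : t ∈ S) {x : V}
    (hx : x ∈ insert (w t) (W t : Set V)) : x ∈ Q₁ ∧ 𝒩.idx z x = t ∧ G.Adj (v t) x := by
  rcases hx with rfl | hx
  · exact ⟨h.w_mem t ht, h.idx_w t ht, h.adj t ht⟩
  · exact ⟨h.W_mem t ht x hx, h.idx_W t ht x hx, h.adj_W t ht x hx⟩

theorem few_touches (h : 𝒩.EdgeFamily z c ν Q₁ S v w W) (hL : 𝒩.SeesFew z L) {x : V}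
    (hx : x ∈ 𝒩.X) : Few L (fun t => t ∈ S ∧ Touches G x (insert (w t) (W t : Set V))) :=
  hL.few_touches hx (P := fun t => t ∈ S) id (fun _ _ _ _ h => h) _ fun _ ht _ hy =>
    ⟨h.Q_sub (h.mem_insert_W ht hy).1, (h.mem_insert_W ht hy).2.1⟩

theorem few_vertices (h : 𝒩.EdgeFamily z c ν Q₁ S v w W) {t : ℕ} (ht : t ∈ S) :
    Few (1 + (1 + ν)) (fun x => x ∈ insert (v t) (insert (w t) (W t : Set V))) := by
  have h1 := (few_mem (W t))
  rw [h.W_card t ht] at h1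
  exact (((few_mem {v t}).or ((few_mem {w t}).or h1))).mono (by simp) (by simp)

theorem mem_X (h : 𝒩.EdgeFamily z c ν Q₁ S v w W) {t : ℕ} (ht : t ∈ S) {x : V}
    (hx : x ∈ insert (v t) (insert (w t) (W t : Set V))) : x ∈ 𝒩.X := by
  rcases hx with rfl | hx
  · exact 𝒩.Q_sub (h.Q_sub (h.v_mem t ht))
  · exact 𝒩.Q_sub (h.Q_sub (h.mem_insert_W ht hx).1)

theorem exists_apart (h : 𝒩.EdgeFamily z c ν Q₁ S v w W) (hL : 𝒩.SeesFew z L) (k : ℕ)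
    (hS : (2 * ((1 + (1 + ν)) * L) + 1) * k + 1 ≤ S.card) :
    ∃ S' ⊆ S, S'.card = k ∧ ∀ t ∈ S', ∀ t' ∈ S', t ≠ t' → Apart G
      (insert (v t) (insert (w t) (W t : Set V))) (insert (v t') (insert (w t') (W t' : Set V))) := by
  obtain ⟨S', hS', hc, hfree⟩ := exists_free_subset (s := S) (k := k)
    (R := fun t t' => ∃ x, x ∈ insert (v t) (insert (w t) (W t : Set V)) ∧ t' ∈ S ∧
      Touches G x (insert (w t') (W t' : Set V))) (D := (1 + (1 + ν)) * L) (fun t ht =>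
        ((h.few_vertices ht).bind_few fun x hx => h.few_touches hL (h.mem_X ht hx)).mono le_rfl
          fun t' ht' => ht'.2.2) hS
  refine ⟨S', hS', hc, fun t ht t' ht' htt => ?_⟩
  rintro x (rfl | hx) y (rfl | hy)
  · refine ⟨fun hvv => hfree t ht t' ht' htt ⟨v t, Or.inl rfl, hS' ht', w t', Or.inl rfl, Or.inr ?_⟩,
      h.stable _ (h.v_mem t (hS' ht)) _ (h.v_mem t' (hS' ht')) ?_⟩
    · rw [hvv]; exact h.adj t' (hS' ht')
    · rw [h.idx_v t (hS' ht), h.idx_v t' (hS' ht')]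
  · have := hfree t ht t' ht' htt
    exact ⟨fun hxy => this ⟨v t, Or.inl rfl, hS' ht', y, hy, Or.inl hxy⟩,
      fun hxy => this ⟨v t, Or.inl rfl, hS' ht', y, hy, Or.inr hxy⟩⟩
  · have := hfree t' ht' t ht (Ne.symm htt)
    exact ⟨fun hxy => this ⟨v t', Or.inl rfl, hS' ht, x, hx, Or.inl hxy.symm⟩,
      fun hxy => this ⟨v t', Or.inl rfl, hS' ht, x, hx, Or.inr hxy.symm⟩⟩
  · have := hfree t ht t' ht' htt
    exact ⟨fun hxy => this ⟨x, Or.inr hx, hS' ht', y, hy, Or.inl hxy⟩,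
      fun hxy => this ⟨x, Or.inr hx, hS' ht', y, hy, Or.inr hxy⟩⟩

theorem hasLeaves (h : 𝒩.EdgeFamily z c ν Q₁ S v w W) (hν : δ ≤ ν) {t : ℕ} (ht : t ∈ S) :
    HasLeaves G δ (v t) (insert (w t) (W t : Set V)) := by
  obtain ⟨L, hL, hc⟩ := Finset.exists_subset_card_eq ((h.W_card t ht).symm ▸ hν : δ ≤ (W t).card)
  refine ⟨L, hc, fun l hl => ⟨Or.inr (hL hl), h.adj_W t ht l (hL hl)⟩, fun l hl l' hl' => ?_⟩
  exact h.stable _ (h.W_mem t ht l (hL hl)) _ (h.W_mem t ht l' (hL hl'))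
    (by rw [h.idx_W t ht l (hL hl), h.idx_W t ht l' (hL hl')])

/-- A vertex `p` of `X` has few neighbours among the `v t`: otherwise `p` is the root of a tree with
brooms `p - v t - W t` of length one, and of length two through `v t` and `w t` or a hub of `w t`. -/
theorem few_adj (h : 𝒩.EdgeFamily z c ν Q₁ S v w W) (hL : 𝒩.SeesFew z L) (hν : δ ≤ ν)
    (hG : Tame G δ τ) {Ξ : Finset ℕ} (hΞ : ∀ s ∈ Ξ, s < R)
    (hcard : ram (τ + 1) δ ≤ Ξ.card) (hdet : ∀ s ∈ Ξ, 𝒩.Determines s z 𝒩.Q) {p : V}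
    (hp : p ∈ 𝒩.X) : Few (edgeBound δ τ K ν L Ξ.card) (fun t => t ∈ S ∧ G.Adj p (v t)) := by
  by_contra hcon
  obtain ⟨S₁, hc₁, hS₁⟩ := exists_many_of_not_few hcon
  have hS₁S : S₁ ⊆ S := fun t ht => (hS₁ t ht).1
  obtain ⟨S₂, hS₂, hc₂, hap⟩ := (h.mono hS₁S).exists_apart hL _
    (by rw [hc₁]; exact Nat.le_succ _)
  have hwQ : ∀ t ∈ S₂, w t ∈ 𝒩.Q := fun t ht => h.Q_sub (h.w_mem t (hS₁S (hS₂ ht)))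
  have hinj : ∀ s ∈ Ξ, ∀ t ∈ S₂, ∀ t' ∈ S₂, 𝒩.idx s (w t) = 𝒩.idx s (w t') → t = t' := by
    intro s hs t ht t' ht' htt
    have := hdet s hs _ (hwQ t ht) _ (hwQ t' ht') htt
    rwa [h.idx_w t (hS₁S (hS₂ ht)), h.idx_w t' (hS₁S (hS₂ ht'))] at this
  obtain ⟨S₃, hS₃, hc₃, hobj⟩ := 𝒩.exists_apart_obj hG hΞ hwQ hinj _ hc₂.ge
  obtain ⟨S₄, hS₄, hc₄, hfree⟩ := exists_free_subset (s := S₃) (k := L + Ξ.card * K + 2 * δ)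
    (R := fun t t' => ∃ x, x ∈ insert (v t) (insert (w t) (W t : Set V)) ∧ t' ∈ S₂ ∧
      Touches G x (𝒩.obj Ξ (w t'))) (D := (1 + (1 + ν)) * (Ξ.card * K)) (fun t ht =>
        ((h.few_vertices (hS₁S (hS₂ (hS₃ ht)))).bind_few fun x hx =>
          𝒩.few_touches_obj hΞ hwQ hinj
            (𝒩.mem_U hΞ (h.mem_X (hS₁S (hS₂ (hS₃ ht))) hx))).mono le_rfl
          fun t' ht' => ht'.2.2) hc₃.ge
  have hs : ∀ t ∈ S₄, t ∈ S := fun t ht => hS₁S (hS₂ (hS₃ (hS₄ ht)))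
  refine hG.free (isIndContained_of_star S₄ v
    (fun t => insert (w t) (W t : Set V) ∪ 𝒩.obj Ξ (w t)) hc₄.ge
    (fun t ht => (hS₁ t (hS₂ (hS₃ (hS₄ ht)))).2) ?_ ?_ ?_ ?_)
  · refine ((h.few_touches hL hp).or (𝒩.few_touches_obj hΞ hwQ hinj (𝒩.mem_U hΞ hp))).mono le_rfl ?_
    rintro t ⟨ht, y, hy | hy, hpy⟩
    · exact Or.inl ⟨hs t ht, y, hy, hpy⟩
    · exact Or.inr ⟨hS₃ (hS₄ ht), y, hy, hpy⟩
  · intro t ht t' ht' htt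
    have hmix : ∀ t ∈ S₄, ∀ t' ∈ S₄, t ≠ t' →
        Apart G (insert (v t) (insert (w t) (W t : Set V))) (𝒩.obj Ξ (w t')) := by
      intro t ht t' ht' htt
      exact apart_iff.2 fun x hx hT => hfree t ht t' ht' htt ⟨x, hx, hS₃ (hS₄ ht'), hT⟩
    have hsplit : ∀ t, insert (v t) (insert (w t) (W t : Set V) ∪ 𝒩.obj Ξ (w t)) =
        insert (v t) (insert (w t) (W t : Set V)) ∪ 𝒩.obj Ξ (w t) := fun t => by
      simp only [Set.insert_union]
    rw [hsplit, hsplit]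
    rintro x (hx | hx) y (hy | hy)
    · exact hap t (hS₃ (hS₄ ht)) t' (hS₃ (hS₄ ht')) htt x hx y hy
    · exact hmix t ht t' ht' htt x hx y hy
    · exact (hmix t' ht' t ht (Ne.symm htt)).symm x hx y hy
    · exact hobj t (hS₄ ht) t' (hS₄ ht') htt x hx y hy
  · intro t ht
    obtain ⟨A, h1, h2, h3⟩ := h.hasLeaves hν (hs t ht)
    exact ⟨A, h1, fun l hl => ⟨Or.inl (h2 l hl).1, (h2 l hl).2⟩, h3⟩
  · intro t ht
    refine (𝒩.hasBroomOne_insert hG hΞ hcard (𝒩.mem_U hΞ (𝒩.Q_sub (h.Q_sub (h.v_mem t (hs t ht)))))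
      (hwQ t (hS₃ (hS₄ ht))) (h.adj t (hs t ht))).mono ?_
    rintro x (rfl | hx)
    · exact Or.inl (Or.inl rfl)
    · exact Or.inr hx

/-- The sets `X t` in pieces beyond those of the `w t`, when they are suitably apart from the family,
provide brooms of length two with root a hub of index `c`. -/
theorem isIndContained_of_hub (h : 𝒩.EdgeFamily z c ν Q₁ S v w W) (hL : 𝒩.SeesFew z L) (hν : δ ≤ ν)
    (hz : z < R) {m : V} (hm : m ∈ 𝒩.H z c) (hadj : ∀ t ∈ S, G.Adj m (v t)) (X : ℕ → Finset V)
    (hap : ∀ t ∈ S, ∀ t' ∈ S, t ≠ t' → Apart G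
      (insert (v t) (insert (w t) (W t : Set V))) (insert (v t') (insert (w t') (W t' : Set V))))
    (hXc : ∀ t ∈ S, (X t).card = δ) (hXQ : ∀ t ∈ S, ∀ x ∈ X t, x ∈ Q₁ ∧ t < 𝒩.idx z x)
    (hXst : ∀ t ∈ S, ∀ x ∈ X t, ∀ y ∈ X t, ¬ G.Adj x y)
    (hwX : ∀ t ∈ S, ∀ x ∈ X t, G.Adj (w t) x) (hvX : ∀ t ∈ S, ∀ x ∈ X t, ¬ G.Adj (v t) x)
    (hmX : ∀ t ∈ S, ∀ x ∈ X t, ¬ G.Adj m x)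
    (hfv : ∀ t ∈ S, Few L (fun t' => t' ∈ S ∧ t' ≠ t ∧ Touches G (v t) (X t')))
    (hfX : ∀ t ∈ S, ∀ x ∈ X t, Few L (fun t' => t' ∈ S ∧ t' ≠ t ∧ Touches G x (X t') ∧
      ¬ Touches G x (insert (w t') (W t' : Set V))))
    (hS : (2 * (L + δ * (L + L)) + 1) * (K' + 2 * δ) + 1 ≤ S.card) :
    (T δ).IsIndContained G := by
  obtain ⟨S₁, hS₁, hc₁, hfree⟩ := exists_free_subset (s := S) (k := K' + 2 * δ)
    (R := fun t t' => Touches G (v t) (X t') ∨ ∃ x ∈ X t, Touches G x (insert (w t') (W t' : Set V)) ∨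
      Touches G x (X t')) (D := L + δ * (L + L)) (fun t ht => by
        have h1 := Few.bind (X t) (D := L + L)
          (P := fun x t' => (t' ∈ S ∧ Touches G x (insert (w t') (W t' : Set V))) ∨
            (t' ∈ S ∧ t' ≠ t ∧ Touches G x (X t') ∧ ¬ Touches G x (insert (w t') (W t' : Set V))))
          fun x hx => (h.few_touches hL (𝒩.Q_sub (h.Q_sub (hXQ t ht x hx).1))).or (hfX t ht x hx)
        rw [hXc t ht] at h1
        refine ((hfv t ht).or h1).mono le_rfl ?_
        rintro t' ⟨ht', htt, h2 | ⟨x, hx, h2⟩⟩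
        · exact Or.inl ⟨ht', htt, h2⟩
        · refine Or.inr ⟨x, hx, ?_⟩
          by_cases h3 : Touches G x (insert (w t') (W t' : Set V))
          · exact Or.inl ⟨ht', h3⟩
          · exact Or.inr ⟨ht', htt, h2.resolve_left h3, h3⟩) hS
  have hmU : m ∉ 𝒩.U (z + 1) := (𝒩.layer z).M_notMem _ _ ((𝒩.refined z hz).H_sub _ hm)
  have hQU : ∀ x ∈ Q₁, x ∈ 𝒩.U (z + 1) := fun x hx =>
    𝒩.antitone hz (𝒩.X_sub (𝒩.Q_sub (h.Q_sub hx)))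
  refine isIndContained_of_star (u := m) S₁ v (fun t => insert (w t) (W t : Set V) ∪ X t) hc₁.ge
    (fun t ht => hadj t (hS₁ ht)) ?_ ?_ ?_ ?_
  · refine (((𝒩.refined z hz).late c m hm).image (𝒩.idx z)).mono le_rfl ?_
    rintro t ⟨ht, y, hy | hy, hmy⟩
    · have hy' := h.mem_insert_W (hS₁ ht) hy
      refine ⟨y, ⟨h.Q_sub hy'.1, ?_, hmy.resolve_left ?_⟩, hy'.2.1⟩
      · rw [hy'.2.1]
        exact h.lt t (hS₁ ht)
      · rintro rfl
        exact hmU (hQU _ hy'.1)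
    · rcases hmy with rfl | hmy
      · exact (hmU (hQU _ (hXQ t (hS₁ ht) m hy).1)).elim
      · exact (hmX t (hS₁ ht) y hy hmy).elim
  · intro t ht t' ht' htt
    have hmix : ∀ t ∈ S₁, ∀ t' ∈ S₁, t ≠ t' →
        Apart G (X t : Set V) (insert (v t') (insert (w t') (W t' : Set V))) := by
      intro t ht t' ht' htt
      refine apart_iff.2 fun x hx => ?_
      rintro ⟨y, hy | hy, hxy⟩
      · subst hy
        exact hfree t' ht' t ht (Ne.symm htt) (Or.inl ⟨x, hx, hxy.imp Eq.symm fun h => h.symm⟩)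
      · exact hfree t ht t' ht' htt (Or.inr ⟨x, hx, Or.inl ⟨y, hy, hxy⟩⟩)
    have hsplit : ∀ t, insert (v t) (insert (w t) (W t : Set V) ∪ (X t : Set V)) =
        insert (v t) (insert (w t) (W t : Set V)) ∪ (X t : Set V) := fun t => by
      simp only [Set.insert_union]
    rw [hsplit, hsplit]
    rintro x (hx | hx) y (hy | hy)
    · exact hap t (hS₁ ht) t' (hS₁ ht') htt x hx y hy
    · exact (hmix t' ht' t ht (Ne.symm htt)).symm x hx y hy
    · exact hmix t ht t' ht' htt x hx y hy
    · exact apart_iff.2 (fun x hx hT => hfree t ht t' ht' htt (Or.inr ⟨x, hx, Or.inr hT⟩)) x hx y hy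
  · intro t ht
    obtain ⟨A, h1, h2, h3⟩ := h.hasLeaves hν (hS₁ ht)
    exact ⟨A, h1, fun l hl => ⟨Or.inl (h2 l hl).1, (h2 l hl).2⟩, h3⟩
  · intro t ht
    have hts := hS₁ ht
    refine ⟨w t, X t, ⟨h.adj t hts, hXc t hts, hwX t hts, hvX t hts, fun x hx hvx => ?_,
      hXst t hts⟩, Or.inl (Or.inl rfl), fun x hx => Or.inr hx⟩
    have h1 := (hXQ t hts x hx).2
    have h2 := h.lt t hts
    rw [← hvx, h.idx_v t hts] at h1
    omega

end EdgeFamily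
end Nest

/-- The number of vertices of the family in `Nest.EdgeFamily.isIndContained_of_hub`. -/
def hubSize (δ K' L : ℕ) : ℕ := (2 * (L + δ * (L + L)) + 1) * (K' + 2 * δ) + 1

/-- Thresholds for the number of neighbours in a piece. -/
def threshold (δ K' L : ℕ) : ℕ → ℕ
  | 0 => K' + δ
  | i + 1 => threshold δ K' L i + (hubSize δ K' L * threshold δ K' L i + K' + δ)

theorem threshold_mono (δ K' L : ℕ) : Monotone (threshold δ K' L) :=
  monotone_nat_of_le_succ fun i => by rw [threshold]; exact Nat.le_add_right _ _

/-- Bound for the number of family members adjacent to a hub. -/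
def hubBound (δ K' L : ℕ) : ℕ :=
  (2 * ((1 + (1 + (K' + δ))) * L) + 1) *
    ((L + 1) * ram (hubSize δ K' L) (hubSize δ K' L) + 1) + 1

/-- Bound for the number of pieces joined by many edges to a given one. -/
def outBound (δ τ K K' L n : ℕ) : ℕ :=
  (2 * ((1 + (1 + (K' + δ))) * L) + 1) *
    rootBound δ τ K K' (edgeBound δ τ K (K' + δ) L n + hubBound δ K' L + L + K') + 1

/-- Bound for the chromatic number in `Nest.colorableOn_of_determined`. -/
def finalBound (δ τ K K' L n : ℕ) : ℕ :=
  K * (Fintype.card (Fin (L + 2) → Fin (L + 1)) * ((2 * (L * threshold δ K' L (L + 1)) + 1) *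
    ((2 * outBound δ τ K K' L n + 1) * 1)))

namespace Nest
variable {V : Type*} {G : SimpleGraph V} {δ τ K K' R : ℕ} (𝒩 : Nest G δ K K' R)

/-- The neighbours of `x` in the piece of index `g`, within `Q₁`. -/
def nbhd (z : ℕ) (Q₁ : Set V) (x : V) (g : ℕ) : Set V := {y | y ∈ Q₁ ∧ 𝒩.idx z y = g ∧ G.Adj x y}

variable {𝒩} {z c L : ℕ} {Q₁ : Set V} {S : Finset ℕ} {v w : ℕ → V} {W : ℕ → Finset V}

theorem exists_finset_of_le_ncard [Finite V] {k : ℕ} {A : Set V} (h : k ≤ A.ncard) :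
    ∃ F : Finset V, F.card = k ∧ ∀ x ∈ F, x ∈ A := by
  classical
  rw [Set.ncard_eq_toFinset_card A (Set.toFinite A)] at h
  obtain ⟨F, h1, h2⟩ := Finset.exists_subset_card_eq h
  exact ⟨F, h2, fun x hx => by simpa using h1 hx⟩

theorem few_of_ncard_le [Finite V] {k : ℕ} {A : Set V} (h : A.ncard ≤ k) :
    Few k (fun x => x ∈ A) := by
  classical
  rw [Set.ncard_eq_toFinset_card A (Set.toFinite A)] at h
  exact ⟨_, h, fun x hx => by simpa using hx⟩

/-- A hub of index `c` has few neighbours among the `v t`, if every `w t` has many more neighbours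
than `v t` in some later piece. -/
theorem EdgeFamily.few_adj_hub [Finite V] (h : 𝒩.EdgeFamily z c (K' + δ) Q₁ S v w W)
    (hL : 𝒩.SeesFew z L) (hz : z < R) (hG : Tame G δ τ) {m : V} (hm : m ∈ 𝒩.H z c)
    (hg : ∀ t ∈ S, ∃ i < L + 1, ∃ g, t < g ∧
      threshold δ K' L (i + 1) ≤ (𝒩.nbhd z Q₁ (w t) g).ncard ∧
      (𝒩.nbhd z Q₁ (v t) g).ncard < threshold δ K' L i) :
    Few (hubBound δ K' L) (fun t => t ∈ S ∧ G.Adj m (v t)) := by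
  classical
  by_contra hcon
  obtain ⟨S₁, hc₁, hS₁⟩ := exists_many_of_not_few hcon
  have hS₁S : S₁ ⊆ S := fun t ht => (hS₁ t ht).1
  obtain ⟨S₂, hS₂, hc₂, hap⟩ := (h.mono hS₁S).exists_apart hL _
    (by rw [hc₁]; exact Nat.le_succ _)
  choose! i hi g hlt hw hv using hg
  obtain ⟨i₀, -, S₃, hS₃, hc₃, hi₀⟩ := exists_fiber_nat (S := S₂) i
    (fun t ht => hi t (hS₁S (hS₂ ht))) hc₂.ge
  set k := hubSize δ K' L with hk
  obtain ⟨S₄, hS₄, hc₄, hdich⟩ : ∃ S₄ ⊆ S₃, S₄.card = k ∧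
      ((∀ t ∈ S₄, ∀ t' ∈ S₄, g t = g t') ∨ (∀ t ∈ S₄, ∀ t' ∈ S₄, g t = g t' → t = t')) := by
    rcases exists_const_or_injOn k g S₃ hc₃.ge with ⟨T, h1, h2, h3⟩ | ⟨T, h1, h2, h3⟩
    · exact ⟨T, h1, h2, Or.inl h3⟩
    · exact ⟨T, h1, h2, Or.inr h3⟩
  have hs : ∀ t ∈ S₄, t ∈ S := fun t ht => hS₁S (hS₂ (hS₃ (hS₄ ht)))
  have hi₀' : ∀ t ∈ S₄, i t = i₀ := fun t ht => hi₀ t (hS₄ ht)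
  -- neighbours of `w t` in the piece `g t` that are adjacent neither to the hub, nor to any `v t'`
  -- that has few neighbours in this piece
  have hX : ∀ t ∈ S₄, ∃ X : Finset V, X.card = δ ∧ ∀ x ∈ X, x ∈ 𝒩.nbhd z Q₁ (w t) (g t) ∧
      ¬ G.Adj m x ∧ ∀ t' ∈ S₄, g t' = g t → ¬ G.Adj (v t') x := by
    intro t ht
    have hwt := hw t (hs t ht)
    rw [hi₀' t ht] at hwt
    obtain ⟨A, hAc, hA⟩ := exists_finset_of_le_ncard hwt
    have h1 : Few (k * threshold δ K' L i₀) (fun y => ∃ t' ∈ S₄, g t' = g t ∧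
        y ∈ 𝒩.nbhd z Q₁ (v t') (g t')) := by
      rw [← hc₄]
      refine Few.bind S₄ fun t' ht' => ?_
      have := hv t' (hs t' ht')
      rw [hi₀' t' ht'] at this
      exact (few_of_ncard_le this.le).mono le_rfl fun y hy => hy.2
    obtain ⟨X, hXA, hXc, hX⟩ := (h1.or ((𝒩.refined z hz).late c m hm)).exists_subset
      (S := A) (k := δ) (by rw [hAc, threshold, ← hk]; omega)
    refine ⟨X, hXc, fun x hx => ⟨hA x (hXA hx), fun hmx => hX x hx (Or.inr ⟨?_, ?_, hmx⟩),
      fun t' ht' hgt hvx => hX x hx (Or.inl ⟨t', ht', hgt, ?_⟩)⟩⟩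
    · exact h.Q_sub (hA x (hXA hx)).1
    · rw [(hA x (hXA hx)).2.1]
      exact (h.lt t (hs t ht)).trans (hlt t (hs t ht))
    · exact ⟨(hA x (hXA hx)).1, hgt ▸ (hA x (hXA hx)).2.1, hvx⟩
  choose! X hXc hXn hXm hXv using hX
  have hXQ : ∀ t ∈ S₄, ∀ x ∈ X t, x ∈ Q₁ := fun t ht x hx => (hXn t ht x hx).1
  have hXi : ∀ t ∈ S₄, ∀ x ∈ X t, 𝒩.idx z x = g t := fun t ht x hx => (hXn t ht x hx).2.1
  have hsees : (∀ t ∈ S₄, ∀ t' ∈ S₄, g t = g t' → t = t') → ∀ x ∈ Q₁,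
      Few L (fun t' => t' ∈ S₄ ∧ Touches G x (X t')) := fun hinj x hx =>
    hL.few_touches (𝒩.Q_sub (h.Q_sub hx)) (P := fun t' => t' ∈ S₄) g
      (fun t ht t' ht' => hinj t ht t' ht') _
      fun t' ht' y hy => ⟨h.Q_sub (hXQ t' ht' y hy), hXi t' ht' y hy⟩
  refine hG.free ((h.mono (S' := S₄) hs).isIndContained_of_hub hL (Nat.le_add_left _ _) hz hm
    (fun t ht => (hS₁ t (hS₂ (hS₃ (hS₄ ht)))).2) X
    (fun t ht t' ht' => hap t (hS₃ (hS₄ ht)) t' (hS₃ (hS₄ ht'))) hXc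
    (fun t ht x hx => ⟨hXQ t ht x hx, ?_⟩) ?_ (fun t ht x hx => (hXn t ht x hx).2.2)
    (fun t ht x hx => hXv t ht x hx t ht rfl) hXm ?_ ?_ hc₄.ge)
  · rw [hXi t ht x hx]
    exact hlt t (hs t ht)
  · intro t ht x hx y hy
    exact h.stable _ (hXQ t ht x hx) _ (hXQ t ht y hy) (by rw [hXi t ht x hx, hXi t ht y hy])
  · intro t ht
    rcases hdich with hconst | hinj
    · refine (few_false fun t' ht' => ?_).mono (Nat.zero_le _) fun _ h => h
      obtain ⟨ht', -, y, hy, hvy⟩ := ht'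
      rcases hvy with hvy | hvy
      · have h1 := h.idx_v t (hs t ht)
        rw [hvy, hXi t' ht' y hy] at h1
        have h2 := hlt t' (hs t' ht')
        have h3 := h.lt t' (hs t' ht')
        omega
      · exact hXv t' ht' y hy t ht (hconst t ht t' ht') hvy
    · exact (hsees hinj _ (h.v_mem t (hs t ht))).mono le_rfl fun t' ht' => ⟨ht'.1, ht'.2.2⟩
  · intro t ht x hx
    rcases hdich with hconst | hinj
    · refine (few_false fun t' ht' => ?_).mono (Nat.zero_le _) fun _ h => h
      obtain ⟨ht', -, ⟨y, hy, hxy⟩, hno⟩ := ht'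
      rcases hxy with hxy | hxy
      · subst hxy
        exact hno ⟨w t', Or.inl rfl, Or.inr (hXn t' ht' x hy).2.2.symm⟩
      · exact h.stable _ (hXQ t ht x hx) _ (hXQ t' ht' y hy)
          (by rw [hXi t ht x hx, hXi t' ht' y hy, hconst t ht t' ht']) hxy
    · exact (hsees hinj _ (hXQ t ht x hx)).mono le_rfl fun t' ht' => ⟨ht'.1, ht'.2.2.1⟩

/-- A family of edges as in `EdgeFamily.few_adj_hub` has bounded size. -/
theorem EdgeFamily.card_lt [Finite V] (h : 𝒩.EdgeFamily z c (K' + δ) Q₁ S v w W)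
    (hL : 𝒩.SeesFew z L) (hz : z < R) (hG : Tame G δ τ) {Ξ : Finset ℕ} (hΞ : ∀ s ∈ Ξ, s < R)
    (hcard : ram (τ + 1) δ ≤ Ξ.card) (hdet : ∀ s ∈ Ξ, 𝒩.Determines s z 𝒩.Q)
    (hg : ∀ t ∈ S, ∃ i < L + 1, ∃ g, t < g ∧
      threshold δ K' L (i + 1) ≤ (𝒩.nbhd z Q₁ (w t) g).ncard ∧
      (𝒩.nbhd z Q₁ (v t) g).ncard < threshold δ K' L i) :
    S.card < outBound δ τ K K' L Ξ.card := by
  classical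
  by_contra hcon
  push Not at hcon
  obtain ⟨S', hS', hc, hap⟩ := h.exists_apart hL _ hcon
  have hmU : ∀ m ∈ 𝒩.H z c, m ∉ 𝒩.U (z + 1) := fun m hm =>
    (𝒩.layer z).M_notMem _ _ ((𝒩.refined z hz).H_sub _ hm)
  have hQU : ∀ x ∈ Q₁, x ∈ 𝒩.U (z + 1) := fun x hx =>
    𝒩.antitone hz (𝒩.X_sub (𝒩.Q_sub (h.Q_sub hx)))
  have hH : ∀ t ∈ S, 𝒩.hub z (v t) ∈ 𝒩.H z c := fun t ht => by
    have := (𝒩.refined z hz).hub_mem (v t) (h.Q_sub (h.v_mem t ht))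
    rwa [h.idx_v t ht] at this
  have hlate : ∀ m ∈ 𝒩.H z c, ∀ t ∈ S, ∀ x ∈ insert (w t) (W t : Set V), (m = x ∨ G.Adj m x) →
      x ∈ 𝒩.Q ∧ c < 𝒩.idx z x ∧ G.Adj m x := by
    intro m hm t ht x hx hmx
    have hx' := h.mem_insert_W ht hx
    refine ⟨h.Q_sub hx'.1, ?_, hmx.resolve_left ?_⟩
    · rw [hx'.2.1]
      exact h.lt t ht
    · rintro rfl
      exact hmU m hm (hQU _ hx'.1)
  refine hG.free (𝒩.isIndContained_of_root hG hz S' v (fun t => insert (w t) (W t : Set V)) hc.ge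
    (fun t ht => ⟨h.Q_sub (h.v_mem t (hS' ht)), h.idx_v t (hS' ht)⟩) hap ?_ ?_ ?_ ?_ ?_ ?_)
  · intro m hm
    exact (h.few_adj_hub hL hz hG hm hg).mono (by omega) fun t ht => ⟨hS' ht.1, ht.2⟩
  · intro m hm
    refine (((𝒩.refined z hz).late c m hm).image (𝒩.idx z)).mono (by omega) ?_
    rintro t ⟨ht, y, hy, hmy⟩
    exact ⟨y, hlate m hm t (hS' ht) y hy hmy, (h.mem_insert_W (hS' ht) hy).2.1⟩
  · intro p hp
    exact (h.few_adj hL (Nat.le_add_left _ _) hG hΞ hcard hdet hp).mono (by omega)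
      fun t ht => ⟨hS' ht.1, ht.2⟩
  · intro p hp
    exact (h.few_touches hL hp).mono (by omega) fun t ht => ⟨hS' ht.1, ht.2⟩
  · intro y hy hyX
    refine (few_false fun t ht => ?_).mono (Nat.zero_le _) fun _ h => h
    obtain ⟨ht, x, hx, hyx⟩ := ht
    have hx' := h.mem_insert_W (hS' ht) hx
    rcases hyx with rfl | hyx
    · exact (𝒩.layer z).Y_notMem _ _ hy (hQU _ hx'.1)
    · exact hyX x (𝒩.Q_sub (h.Q_sub hx'.1)) hyx
  · intro t ht
    have htS := hS' ht
    obtain ⟨A, hA, hAc, hAm⟩ := ((𝒩.refined z hz).late c _ (hH t htS)).exists_subset (S := W t)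
      (k := δ) (by rw [h.W_card t htS])
    have hno : ∀ x ∈ A, ¬ (𝒩.hub z (v t) = x ∨ G.Adj (𝒩.hub z (v t)) x) := fun x hx hmx =>
      hAm x hx (hlate _ (hH t htS) t htS x (Or.inr (hA hx)) hmx)
    refine ⟨v t, A, ⟨((𝒩.refined z hz).adj_hub (v t) (h.Q_sub (h.v_mem t htS))).symm, hAc,
      fun x hx => h.adj_W t htS x (hA hx), fun x hx hmx => hno x hx (Or.inr hmx),
      fun x hx hmx => hno x hx (Or.inl hmx), fun x hx y hy => ?_⟩, Or.inl rfl,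
      fun x hx => Or.inr (Or.inr (hA hx))⟩
    exact h.stable _ (h.W_mem t htS x (hA hx)) _ (h.W_mem t htS y (hA hy))
      (by rw [h.idx_W t htS x (hA hx), h.idx_W t htS y (hA hy)])

/-- If the index in each layer of a large set determines the index in one of them, layer `z`, then
`Q` can be coloured with boundedly many colours: the edges between different pieces of layer `z` are
split according to the number of neighbours of the earlier end in the piece of the later end. -/
theorem colorableOn_of_determined [Finite V] (hG : Tame G δ τ) {Ξ : Finset ℕ}
    (hΞ : ∀ s ∈ Ξ, s < R) (hcard : ram (τ + 1) δ ≤ Ξ.card) (hz : z ∈ Ξ)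
    (hdet : ∀ s ∈ Ξ, 𝒩.Determines s z 𝒩.Q) :
    ColorableOn G.Adj 𝒩.Q (finalBound δ τ K K' (1 + adjBound δ τ K Ξ.card) Ξ.card) := by
  classical
  have hL := seesFew_of_determines hG hΞ hcard hdet
  set L := 1 + adjBound δ τ K Ξ.card with hLdef
  have hzR := hΞ z hz
  -- make the pieces stable
  choose f hf hf' using (𝒩.layer z).color
  have hfmem : ∀ x ∈ 𝒩.Q, x ∈ {x | x ∈ 𝒩.U (z + 1) ∧ ∃ m ∈ (𝒩.layer z).M (𝒩.idx z x), G.Adj x m} :=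
    fun x hx => ⟨𝒩.antitone hzR (𝒩.X_sub (𝒩.Q_sub hx)), _, 𝒩.hub_mem_M hzR hx,
      (𝒩.refined z hzR).adj_hub x hx⟩
  refine ColorableOn.fibers (fun x => f (𝒩.idx z x) x) (fun x hx => hf _ x (hfmem x hx)) fun a _ => ?_
  set Q₁ : Set V := {x | x ∈ 𝒩.Q ∧ f (𝒩.idx z x) x = a} with hQ₁
  have hst : ∀ x ∈ Q₁, ∀ y ∈ Q₁, 𝒩.idx z x = 𝒩.idx z y → ¬ G.Adj x y := by
    intro x hx y hy hxy hadj
    refine hf' (𝒩.idx z x) x (hfmem x hx.1) y (by rw [hxy]; exact hfmem y hy.1) hadj ?_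
    rw [hx.2]
    nth_rewrite 1 [hxy]
    exact hy.2.symm
  -- later pieces in which a vertex has many neighbours
  let F : ℕ → V → Set ℕ := fun i x =>
    {g | 𝒩.idx z x < g ∧ threshold δ K' L i ≤ (𝒩.nbhd z Q₁ x g).ncard}
  have hth : ∀ i, threshold δ K' L 0 ≤ threshold δ K' L i := fun i =>
    threshold_mono δ K' L (Nat.zero_le i)
  have hFsees : ∀ i, ∀ x, F i x ⊆ {g | (𝒩.nbhd z Q₁ x g).Nonempty} ∨ threshold δ K' L i = 0 := by
    intro i x
    by_cases h0 : threshold δ K' L i = 0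
    · exact Or.inr h0
    · refine Or.inl fun g hg => ?_
      rw [Set.mem_ofPred_eq, ← Set.ncard_pos (Set.toFinite _)]
      exact (Nat.pos_of_ne_zero h0).trans_le hg.2
  by_cases hδ0 : threshold δ K' L 0 = 0
  · -- then `δ = 0` and the tree is a single vertex
    have hδ : δ = 0 := by
      simp only [threshold] at hδ0
      omega
    subst hδ
    refine ColorableOn.of_isEmpty fun x _ => ?_
    exact hG.free (isIndContained_of_brooms (ι := ℕ) (u := x) ∅ (by simp) (fun _ => ∅) (by simp)
      (by simp) (by simp))
  have hFfew : ∀ i, ∀ x ∈ Q₁, (F i x).Finite ∧ (F i x).ncard ≤ L := by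
    intro i x hx
    obtain ⟨A, hA, hA'⟩ := hL x (𝒩.Q_sub hx.1)
    have hsub : F i x ⊆ (A : Set ℕ) := by
      intro g hg
      have h1 := hth i
      rcases hFsees i x with h2 | h2
      · obtain ⟨y, hy⟩ := h2 hg
        exact hA' g ⟨y, hy.1.1, Or.inr hy.2.2, hy.2.1⟩
      · omega
    refine ⟨A.finite_toSet.subset hsub, (Set.ncard_le_ncard hsub A.finite_toSet).trans ?_⟩
    rwa [Set.ncard_coe_finset]
  have hFanti : ∀ x, ∀ i j, i ≤ j → F j x ⊆ F i x := fun x i j hij g hg =>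
    ⟨hg.1, (threshold_mono δ K' L hij).trans hg.2⟩
  refine ColorableOn.fibers_fintype (α := Fin (L + 2) → Fin (L + 1))
    (fun x i => ⟨min (F i x).ncard L, by omega⟩) fun cls => ?_
  set Q₂ : Set V := {x | x ∈ Q₁ ∧ (fun i : Fin (L + 2) =>
    (⟨min (F i x).ncard L, by omega⟩ : Fin (L + 1))) = cls} with hQ₂
  have hcls : ∀ x ∈ Q₂, ∀ y ∈ Q₂, ∀ i < L + 2, (F i x).ncard = (F i y).ncard := by
    intro x hx y hy i hi
    have h1 := congrFun (hx.2.trans hy.2.symm) ⟨i, hi⟩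
    simp only [Fin.mk.injEq] at h1
    have h2 := (hFfew i x hx.1).2
    have h3 := (hFfew i y hy.1).2
    omega
  -- edges `x y` where `x` has few neighbours in the later piece that contains `y`
  have hweak : ColorableOn (fun x y => G.Adj x y ∧ ((𝒩.idx z x < 𝒩.idx z y ∧ 𝒩.idx z y ∉ F (L + 1) x) ∨
      (𝒩.idx z y < 𝒩.idx z x ∧ 𝒩.idx z x ∉ F (L + 1) y))) Q₂
      (2 * (L * threshold δ K' L (L + 1)) + 1) := by
    refine ColorableOn.of_outdegree (S := fun x y => G.Adj x y ∧ 𝒩.idx z x < 𝒩.idx z y ∧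
      𝒩.idx z y ∉ F (L + 1) x) ?_ ?_
    · rintro x hx y hy ⟨hadj, h1 | h1⟩
      · exact ⟨hadj.ne, Or.inl ⟨hadj, h1⟩⟩
      · exact ⟨hadj.ne, Or.inr ⟨hadj.symm, h1⟩⟩
    · intro x hx
      refine ((hL x (𝒩.Q_sub hx.1.1)).bind_few (D := threshold δ K' L (L + 1))
        (P := fun g y => y ∈ 𝒩.nbhd z Q₁ x g ∧ 𝒩.idx z x < g ∧ g ∉ F (L + 1) x) fun g _ => ?_).mono
        le_rfl ?_
      · by_cases hg : 𝒩.idx z x < g ∧ g ∉ F (L + 1) x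
        · refine (few_of_ncard_le (A := 𝒩.nbhd z Q₁ x g) ?_).mono le_rfl fun y hy => hy.1
          by_contra hlt
          exact hg.2 ⟨hg.1, (not_le.1 hlt).le⟩
        · exact (few_false fun y hy => hg hy.2).mono (Nat.zero_le _) fun _ h => h
      · rintro y ⟨hy, -, hadj, hlt, hno⟩
        exact ⟨𝒩.idx z y, ⟨y, hy.1.1, Or.inr hadj, rfl⟩, ⟨hy.1, rfl, hadj⟩, hlt, hno⟩
  -- edges `x y` where `x` has many neighbours in the later piece that contains `y`
  have hstrong : ColorableOn (fun x y => G.Adj x y ∧ ((𝒩.idx z x < 𝒩.idx z y ∧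
      𝒩.idx z y ∈ F (L + 1) x) ∨ (𝒩.idx z y < 𝒩.idx z x ∧ 𝒩.idx z x ∈ F (L + 1) y))) Q₂
      ((2 * outBound δ τ K K' L Ξ.card + 1) * 1) := by
    refine ColorableOn.of_quotient_outdegree (𝒩.idx z) (S := fun c c' => c < c' ∧ ∃ x ∈ Q₂, ∃ y ∈ Q₂,
      𝒩.idx z x = c ∧ 𝒩.idx z y = c' ∧ G.Adj x y ∧ c' ∈ F (L + 1) x) ?_ ?_ ?_
    · rintro x hx y hy ⟨hadj, h1 | h1⟩
      · exact Or.inr (Or.inl ⟨h1.1, x, hx, y, hy, rfl, rfl, hadj, h1.2⟩)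
      · exact Or.inr (Or.inr ⟨h1.1, y, hy, x, hx, rfl, rfl, hadj.symm, h1.2⟩)
    · intro u hu
      by_contra hcon
      obtain ⟨S, hS, hP⟩ := exists_many_of_not_few hcon
      have hex : ∀ t, ∃ x y : V, ∃ W : Finset V, t ∈ S → 𝒩.idx z u < t ∧ x ∈ Q₂ ∧ y ∈ Q₂ ∧
          𝒩.idx z x = 𝒩.idx z u ∧ 𝒩.idx z y = t ∧ G.Adj x y ∧ t ∈ F (L + 1) x ∧
          W.card = K' + δ ∧ ∀ x' ∈ W, x' ∈ 𝒩.nbhd z Q₁ x t := by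
        intro t
        by_cases ht : t ∈ S
        · obtain ⟨-, -, h1, x, hx, y, hy, h2, h3, h4, h5⟩ := hP t ht
          obtain ⟨W, hWc, hW⟩ := exists_finset_of_le_ncard
            (((hth (L + 1)).trans h5.2 : K' + δ ≤ _))
          exact ⟨x, y, W, fun _ => ⟨h1, hx, hy, h2, h3, h4, h5, hWc, hW⟩⟩
        · exact ⟨u, u, ∅, fun h => (ht h).elim⟩
      choose v w W hfam using hex
      have hE : 𝒩.EdgeFamily z (𝒩.idx z u) (K' + δ) Q₁ S v w W :=
        { Q_sub := fun x hx => hx.1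
          stable := hst
          v_mem := fun t ht => (hfam t ht).2.1.1
          idx_v := fun t ht => (hfam t ht).2.2.2.1
          lt := fun t ht => (hfam t ht).1
          w_mem := fun t ht => (hfam t ht).2.2.1.1
          idx_w := fun t ht => (hfam t ht).2.2.2.2.1
          adj := fun t ht => (hfam t ht).2.2.2.2.2.1
          W_card := fun t ht => (hfam t ht).2.2.2.2.2.2.2.1
          W_mem := fun t ht x hx => ((hfam t ht).2.2.2.2.2.2.2.2 x hx).1
          idx_W := fun t ht x hx => ((hfam t ht).2.2.2.2.2.2.2.2 x hx).2.1
          adj_W := fun t ht x hx => ((hfam t ht).2.2.2.2.2.2.2.2 x hx).2.2 }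
      have := hE.card_lt hL hzR hG hΞ hcard hdet ?_
      · omega
      intro t ht
      obtain ⟨-, hv2, hw2, -, hidx, -, htF, -, -⟩ := hfam t ht
      -- otherwise `F i` would lose an element at each of the `L + 1` steps
      by_contra hno
      push Not at hno
      have hsub : ∀ i < L + 1, F (i + 1) (w t) ⊆ F i (v t) := by
        intro i hi g hg
        have htg : t < g := by
          have := hg.1
          rwa [hidx] at this
        exact ⟨(by rw [hE.idx_v t ht]; exact (hE.lt t ht).trans htg), hno i hi g htg hg.2⟩
      have hlt : ∀ i < L + 1, (F (i + 1) (v t)).ncard < (F i (v t)).ncard := by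
        intro i hi
        rw [hcls (v t) hv2 (w t) hw2 (i + 1) (by omega)]
        refine Set.ncard_lt_ncard ⟨hsub i hi, fun hsub' => ?_⟩ (hFfew i (v t) hv2.1).1
        have := (hsub' (hFanti _ i (L + 1) (by omega) htF)).1
        omega
      have hle : ∀ i ≤ L + 1, (F i (v t)).ncard + i ≤ L := by
        intro i
        induction i with
        | zero => exact fun _ => (hFfew 0 (v t) hv2.1).2
        | succ i ih =>
          intro hi
          have h1 := ih (by omega)
          have h2 := hlt i (by omega)
          omega
      have := hle (L + 1) le_rfl
      omega
    · intro i
      refine ⟨fun _ => 0, fun _ _ => Nat.one_pos, ?_⟩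
      rintro x ⟨hx, hxi⟩ y ⟨hy, hyi⟩ ⟨hadj, -⟩
      exact (hst x hx.1 y hy.1 (hxi.trans hyi.symm) hadj).elim
  refine (hweak.or hstrong).mono_rel fun x hx y hy hadj => ?_
  have hne : 𝒩.idx z x ≠ 𝒩.idx z y := fun h => hst x hx.1 y hy.1 h hadj
  by_cases h1 : (𝒩.idx z x < 𝒩.idx z y ∧ 𝒩.idx z y ∈ F (L + 1) x) ∨
      (𝒩.idx z y < 𝒩.idx z x ∧ 𝒩.idx z x ∈ F (L + 1) y)
  · exact Or.inr ⟨hadj, h1⟩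
  · refine Or.inl ⟨hadj, ?_⟩
    push Not at h1
    rcases lt_or_gt_of_ne hne with h | h
    · exact Or.inl ⟨h, h1.1 h⟩
    · exact Or.inr ⟨h, h1.2 h⟩

end Nest

/-! ### Refining the choice of hubs -/

section Cover
variable {V : Type*} [Finite V] {G : SimpleGraph V} {δ τ : ℕ}

/-- If every `x ∈ X` has a neighbour `h x ∉ X`, and the adjacencies between the vertices `h x` and
the other members of `X` follow a relation of bounded outdegree, then `X` is a union of few
matching-covered sets. -/
theorem Tame.colorableOn_of_cover (hG : Tame G δ τ) {X : Set V} {D : ℕ} (h : V → V)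
    {S : V → V → Prop} (hadj : ∀ x ∈ X, G.Adj (h x) x) (hX : ∀ x ∈ X, h x ∉ X)
    (hS : ∀ x ∈ X, ∀ y ∈ X, x ≠ y → G.Adj (h x) y → S x y ∨ S y x)
    (hfew : ∀ x ∈ X, Few D (fun y => y ∈ X ∧ y ≠ x ∧ S x y)) :
    ColorableOn G.Adj X ((2 * D + 1) * τ) := by
  classical
  obtain ⟨f, h1, h2⟩ := exists_coloring_of_outdegree S D
    (Set.toFinite X).toFinset (fun x hx => by simpa using hfew x (by simpa using hx))
  refine ColorableOn.fibers f (fun v hv => h1 v (by simpa using hv)) fun i _ => ?_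
  refine hG.matching _ fun x hx => ⟨h x, fun hh => hX x hx.1 hh.1, hadj x hx.1, ?_⟩
  intro z hz hadj'
  by_contra hne
  rcases hS x hx.1 z hz.1 (Ne.symm hne) hadj' with h3 | h3
  · exact h2 x (by simpa using hx.1) z (by simpa using hz.1) (Ne.symm hne) h3
      (hx.2.trans hz.2.symm)
  · exact h2 z (by simpa using hz.1) x (by simpa using hx.1) hne h3
      (hz.2.trans hx.2.symm)

/-- `H` dominates `F`. -/
def Dominates (G : SimpleGraph V) (H F : Set V) : Prop := ∀ x ∈ F, ∃ h ∈ H, G.Adj h x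

/-- An inclusion-minimal dominating subset, in which every vertex has a private neighbour. -/
theorem Dominates.exists_private {H F : Set V} (hH : Dominates G H F) :
    ∃ H' ⊆ H, Dominates G H' F ∧ ∃ p : V → V, ∀ h ∈ H', p h ∈ F ∧ G.Adj h (p h) ∧
      ∀ h' ∈ H', G.Adj h' (p h) → h' = h := by
  classical
  obtain ⟨H', hmin⟩ := (Set.toFinite {A | A ⊆ H ∧ Dominates G A F}).exists_minimal ⟨H, le_rfl, hH⟩
  refine ⟨H', hmin.prop.1, hmin.prop.2, ?_⟩
  have : ∀ h, ∃ x, h ∈ H' → x ∈ F ∧ G.Adj h x ∧ ∀ h' ∈ H', G.Adj h' x → h' = h := by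
    intro h
    by_cases hh : h ∈ H'
    swap
    · exact ⟨h, fun h' => (hh h').elim⟩
    by_contra hcon
    push Not at hcon
    have hdom : Dominates G (H' \ {h}) F := by
      intro x hx
      obtain ⟨a, ha, hax⟩ := hmin.prop.2 x hx
      by_cases hah : a = h
      · subst hah
        obtain ⟨b, hb, hbx, hba⟩ := (hcon x).2 hx hax
        exact ⟨b, ⟨hb, hba⟩, hbx⟩
      · exact ⟨a, ⟨ha, hah⟩, hax⟩
    exact (hmin.le_of_le ⟨Set.sdiff_subset.trans hmin.prop.1, hdom⟩ Set.sdiff_subset hh).2 rfl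
  choose p hp using this
  exact ⟨p, hp⟩

/-- Minimal dominating sets are taken repeatedly, each time inside the previous one, and after the
removal of one private neighbour `p j h` for each of its members `h`. -/
theorem Dominates.exists_rounds {W F : Set V} (hW : Dominates G W F) :
    ∃ (H : ℕ → Set V) (p : ℕ → V → V), Antitone H ∧ (∀ j, H j ⊆ W) ∧
      (∀ j, ∀ h ∈ H j, p j h ∈ F ∧ G.Adj h (p j h) ∧ ∀ h' ∈ H j, G.Adj h' (p j h) → h' = h) ∧
      (∀ i j, i < j → ∀ h ∈ H i, ∀ h' ∈ H j, p i h ≠ p j h') ∧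
      ∀ n, ∀ x ∈ F, (∀ j < n, ∀ h ∈ H j, x ≠ p j h) → ∃ h ∈ H n, G.Adj h x := by
  classical
  choose next hsub hdom p hp using
    fun s : {s : Set V × Set V // Dominates G s.1 s.2} => s.2.exists_private
  let step : {s : Set V × Set V // Dominates G s.1 s.2} → {s : Set V × Set V // Dominates G s.1 s.2} :=
    fun s => ⟨(next s, s.1.2 \ p s '' next s), fun x hx => hdom s x hx.1⟩
  let st : ℕ → {s : Set V × Set V // Dominates G s.1 s.2} := fun n => step^[n] ⟨(W, F), hW⟩
  have hst : ∀ n, st (n + 1) = step (st n) := fun n => Function.iterate_succ_apply' _ _ _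
  have hF : Antitone fun n => (st n).1.2 := antitone_nat_of_succ_le fun n => by
    rw [hst]; exact Set.sdiff_subset
  have hnext : ∀ n, next (st (n + 1)) ⊆ next (st n) := fun n => by
    have h1 := hsub (st (n + 1))
    have h2 : (st (n + 1)).1.1 = next (st n) := by rw [hst]
    rwa [h2] at h1
  have hanti : Antitone fun n => next (st n) := antitone_nat_of_succ_le hnext
  refine ⟨fun n => next (st n), fun n => p (st n), hanti, fun j => ?_, fun j h hh => ?_, ?_, ?_⟩
  · exact (hanti (Nat.zero_le j)).trans (hsub (st 0))
  · have := hp (st j) h hh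
    exact ⟨hF (Nat.zero_le j) this.1, this.2⟩
  · intro i j hij h hh h' hh' heq
    have h1 := (hp (st j) h' hh').1
    have h2 : p (st j) h' ∈ (st (i + 1)).1.2 := hF hij h1
    rw [hst] at h2
    exact h2.2 ⟨h, hh, heq⟩
  · intro n x hx hno
    have : ∀ j ≤ n, x ∈ (st j).1.2 := by
      intro j
      induction j with
      | zero => exact fun _ => hx
      | succ j ih =>
        intro hj
        rw [hst]
        refine ⟨ih (by omega), ?_⟩
        rintro ⟨h, hh, heq⟩
        exact hno j (by omega) h hh heq.symm
    exact hdom (st n) x (this n le_rfl)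

end Cover

theorem IsRefined.mono {V : Type*} {G : SimpleGraph V} {δ K : ℕ} {U U' : Set V}
    {L : Layer G δ K U U'} {K' : ℕ} {X Q Q' : Set V} {idx : V → ℕ} {hub : V → V}
    {H : ℕ → Set V} (h : IsRefined L K' X Q idx hub H) (hQ : Q' ⊆ Q) :
    IsRefined L K' X Q' idx hub H where
  H_sub := h.H_sub
  hub_mem v hv := h.hub_mem v (hQ hv)
  adj_hub v hv := h.adj_hub v (hQ hv)
  late c m hm := (h.late c m hm).mono le_rfl fun _ hw => ⟨hQ hw.1, hw.2⟩
  alt := h.alt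

section Refine
variable {V : Type*} [Finite V] {G : SimpleGraph V} {δ τ K : ℕ} {U U' : Set V}

/-- A set in a layer can be refined after the removal of a set of bounded chromatic number. -/
theorem Layer.exists_refined (L : Layer G δ K U U') (hG : Tame G δ τ) {X : Set V} (hX : X ⊆ U') :
    ∃ Q ⊆ X, ∃ idx hub H, IsRefined L (K + (K * δ + 1)) X Q idx hub H ∧
      ColorableOn G.Adj (X \ Q) ((K * δ + 1) * ((2 * (K * δ + 1) + 1) * τ)) := by
  classical
  rcases L.alt with hMY | hMY
  · -- bounded sets of hubs: all hubs are used, with the least possible index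
    have hidx : ∀ x, ∃ c, x ∈ X → ((∃ m ∈ L.M c, G.Adj x m) ∧ ∀ c' < c, ¬ ∃ m ∈ L.M c', G.Adj x m) := by
      intro x
      by_cases hx : x ∈ X
      · have hex := L.cover x (hX hx)
        exact ⟨Nat.find hex, fun _ => ⟨Nat.find_spec hex, fun c' hc' => Nat.find_min hex hc'⟩⟩
      · exact ⟨0, fun h => (hx h).elim⟩
    choose idx hidx using hidx
    have hhub : ∀ x, ∃ m, x ∈ X → m ∈ L.M (idx x) ∧ G.Adj x m := by
      intro x
      by_cases hx : x ∈ X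
      · obtain ⟨m, hm⟩ := (hidx x hx).1
        exact ⟨m, fun _ => hm⟩
      · exact ⟨x, fun h => (hx h).elim⟩
    choose hub hhub using hhub
    refine ⟨X, le_rfl, idx, hub, L.M, ⟨fun c => le_rfl, fun v hv => (hhub v hv).1,
      fun v hv => (hhub v hv).2, fun c m hm => ?_, Or.inl fun c => ?_⟩,
      ColorableOn.of_isEmpty fun v hv => hv.2 hv.1⟩
    · refine (few_false fun w hw => ?_).mono (Nat.zero_le _) fun _ h => h
      exact (hidx w hw.1).2 c hw.2.1 ⟨m, hm, hw.2.2.symm⟩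
    · rw [hMY]
      exact (few_mem (L.Y c)).mono ((L.card_Y c).trans (Nat.le_add_right _ _)) fun _ h => h
  -- unbounded sets of hubs
  set N := K * δ + 1 with hN
  have hdom : ∀ c, Dominates G (L.M c) {x | x ∈ X ∧ ∃ m ∈ L.M c, G.Adj x m} := by
    rintro c x ⟨-, m, hm, hxm⟩
    exact ⟨m, hm, hxm.symm⟩
  choose H p hanti hHM hp hpne hcov using fun c => (hdom c).exists_rounds
  -- the vertices that are removed for each of the indices that they touch
  let single : ℕ → ℕ → V → Prop := fun n c x => ∃ j < n, ∃ h ∈ H c j, x = p c j h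
  let S : Set V := {x | x ∈ X ∧ ∀ c, (∃ m ∈ L.M c, G.Adj x m) → single N c x}
  have hpriv : ∀ n c j, j < n → ∀ m ∈ H c n, ∀ h ∈ H c j, G.Adj m (p c j h) → m = h :=
    fun n c j hj m hm h hh hadj => (hp c j h hh).2.2 m (hanti c hj.le hm) hadj
  have hQ : ∀ x, ∃ c, x ∈ X \ S → ((∃ m ∈ L.M c, G.Adj x m) ∧ ¬ single N c x) ∧
      ∀ c' < c, ¬ ((∃ m ∈ L.M c', G.Adj x m) ∧ ¬ single N c' x) := by
    intro x
    by_cases hx : x ∈ X \ S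
    · have hex : ∃ c, (∃ m ∈ L.M c, G.Adj x m) ∧ ¬ single N c x := by
        by_contra hcon
        push Not at hcon
        exact hx.2 ⟨hx.1, fun c ⟨m, hm, hadj⟩ => hcon c ⟨m, hm, hadj⟩⟩
      exact ⟨Nat.find hex, fun _ => ⟨Nat.find_spec hex, fun c' hc' => Nat.find_min hex hc'⟩⟩
    · exact ⟨0, fun h => (hx h).elim⟩
  choose idx hidx using hQ
  have hhub : ∀ x, ∃ m, x ∈ X \ S → m ∈ H (idx x) N ∧ G.Adj m x := by
    intro x
    by_cases hx : x ∈ X \ S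
    · obtain ⟨h, hh, hadj⟩ := hcov (idx x) N x ⟨hx.1, (hidx x hx).1.1⟩
        (fun j hj h hh heq => (hidx x hx).1.2 ⟨j, hj, h, hh, heq⟩)
      exact ⟨h, fun _ => ⟨hh, hadj⟩⟩
    · exact ⟨x, fun h => (hx h).elim⟩
  choose hub hhub using hhub
  refine ⟨X \ S, Set.sdiff_subset, idx, hub, fun c => H c N, ⟨fun c => hHM c N,
    fun v hv => (hhub v hv).1, fun v hv => (hhub v hv).2.symm, fun c m hm => ?_, Or.inr fun c =>
    ⟨fun m hm => (hMY c).1 m (hHM c N hm), fun y hy x hx => (hMY c).2 y hy x (hX hx),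
    fun m hm => ?_⟩⟩, ?_⟩
  · refine ((few_mem (Finset.range N)).image fun j => p c j m).mono (by simp) ?_
    rintro w ⟨hw, hlt, hmw⟩
    have hsing : single N c w := by
      by_contra hno
      exact (hidx w hw).2 c hlt ⟨⟨m, hHM c N hm, hmw.symm⟩, hno⟩
    obtain ⟨j, hj, h, hh, rfl⟩ := hsing
    exact ⟨j, by simpa using hj, by rw [hpriv N c j hj m hm h hh hmw]⟩
  · refine ⟨(Finset.range N).image fun j => p c j m, ?_, ?_⟩
    · rw [Finset.card_image_of_injOn, Finset.card_range]
      intro i hi j hj hij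
      have hmi := hanti c (Finset.mem_range.1 hi).le hm
      have hmj := hanti c (Finset.mem_range.1 hj).le hm
      rcases lt_trichotomy i j with h | h | h
      · exact (hpne c i j h m hmi m hmj hij).elim
      · exact h
      · exact (hpne c j i h m hmj m hmi hij.symm).elim
    · intro q hq
      obtain ⟨j, hj, rfl⟩ := Finset.mem_image.1 hq
      have hj := (Finset.mem_range.1 hj)
      have := hp c j m (hanti c hj.le hm)
      exact ⟨this.1.1, this.2.1, fun m' hm' hadj => hpriv N c j hj m' hm' m (hanti c hj.le hm) hadj⟩
  -- the removed vertices
  have hSX : X \ (X \ S) ⊆ S := fun x hx => by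
    by_contra hxS
    exact hx.2 ⟨hx.1, hxS⟩
  refine ColorableOn.mono ?_ hSX le_rfl
  -- the last round in which `x` is removed for some index
  have hJ : ∀ x, ∃ J c h, x ∈ S → J < N ∧ (∀ c, (∃ m ∈ L.M c, G.Adj x m) → single (J + 1) c x) ∧
      h ∈ H c J ∧ x = p c J h := by
    intro x
    by_cases hx : x ∈ S
    swap
    · exact ⟨0, 0, x, fun h => (hx h).elim⟩
    have hex : ∃ n, ∀ c, (∃ m ∈ L.M c, G.Adj x m) → single n c x := ⟨N, hx.2⟩
    have hspec := Nat.find_spec hex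
    have hle : Nat.find hex ≤ N := Nat.find_min' hex hx.2
    obtain ⟨c₀, m₀, hm₀, hadj₀⟩ := L.cover x (hX hx.1)
    obtain ⟨J, hJ⟩ : ∃ J, Nat.find hex = J + 1 := by
      refine Nat.exists_eq_succ_of_ne_zero fun h0 => ?_
      obtain ⟨j, hj, -⟩ := hspec c₀ ⟨m₀, hm₀, hadj₀⟩
      omega
    have hmin := Nat.find_min hex (m := J) (by omega)
    push Not at hmin
    obtain ⟨c, ⟨m, hm, hadj⟩, hno⟩ := hmin
    obtain ⟨j, hj, h, hh, heq⟩ := hspec c ⟨m, hm, hadj⟩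
    have hjJ : j = J := by
      by_contra hne
      exact hno ⟨j, by omega, h, hh, heq⟩
    subst hjJ
    rw [hJ] at hspec
    exact ⟨j, c, h, fun _ => ⟨by omega, hspec, hh, heq⟩⟩
  choose J c h hJc using hJ
  refine ColorableOn.fibers J (fun x hx => (hJc x hx).1) fun j _ => ?_
  refine hG.colorableOn_of_cover h (S := fun x y => G.Adj (h x) y) ?_ ?_
    (fun _ _ _ _ _ hadj => Or.inl hadj) ?_
  · rintro x ⟨hx, -⟩
    have h1 := hJc x hx
    have h2 := (hp _ _ _ h1.2.2.1).2.1
    rwa [← h1.2.2.2] at h2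
  · rintro x ⟨hx, -⟩ hmem
    exact L.M_notMem _ _ (hHM _ _ (hJc x hx).2.2.1) (hX hmem.1.1)
  · rintro x ⟨hx, hxj⟩
    refine ((few_mem (Finset.range N)).image fun i => p (c x) i (h x)).mono (by simp) ?_
    rintro y ⟨⟨hy, hyj⟩, -, hadj⟩
    have h1 := hJc x hx
    obtain ⟨i, hi, h', hh', heq⟩ := (hJc y hy).2.1 (c x) ⟨h x, hHM _ _ h1.2.2.1, hadj.symm⟩
    refine ⟨i, ?_, ?_⟩
    · have := (hJc y hy).1
      simp only [Finset.mem_range]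
      omega
    · have : h x ∈ H (c x) i := hanti (c x) (by omega : i ≤ J x) h1.2.2.1
      rw [heq] at hadj
      rw [(hp (c x) i h' hh').2.2 _ this hadj, ← heq]

end Refine

/-! ### Towers of layers -/

/-- The number of layers in a block. -/
def blockSize (δ τ : ℕ) : ℕ := ram (τ + 1) δ

/-- Bound for the chromatic number of the top of a tower of layers. -/
def towerBound (δ τ K : ℕ) : ℕ :=
  blockSize δ τ * blockSize δ τ * ((K * δ + 1) * ((2 * (K * δ + 1) + 1) * τ)) +
  (blockSize δ τ * blockSize δ τ * pieceBound δ τ K (K + (K * δ + 1)) (blockSize δ τ)) ^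
    (blockSize δ τ - 1) * finalBound δ τ K (K + (K * δ + 1))
      (1 + adjBound δ τ K (blockSize δ τ)) (blockSize δ τ)

section Tower
variable {V : Type*} {G : SimpleGraph V} {δ τ K : ℕ}

/-- The layer over the empty set. -/
def Layer.empty (G : SimpleGraph V) (δ K : ℕ) (U : Set V) : Layer G δ K U ∅ where
  Y _ := ∅
  M _ := ∅
  out _ _ := False
  into _ _ := False
  sub := Set.empty_subset _
  Y_sub := by simp
  M_sub := by simp
  Y_notMem := by simp
  M_notMem := by simp
  card_Y := by simp
  Y_apart _ _ _ := by intro x hx; simp at hx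
  M_disj := by simp
  touch := by simp
  out_few _ := (few_false (by simp)).mono (Nat.zero_le _) fun _ h => h
  into_few _ := (few_false (by simp)).mono (Nat.zero_le _) fun _ h => h
  near := by simp
  cover := by simp
  broom := by simp
  color _ := ColorableOn.of_isEmpty (by simp)
  alt := by simp

/-- The nest with a smaller set `Q`. -/
def Nest.restrict {K' R : ℕ} (𝒩 : Nest G δ K K' R) (Q : Set V) (hQ : Q ⊆ 𝒩.Q) :
    Nest G δ K K' R where
  U := 𝒩.U
  layer := 𝒩.layer
  X := 𝒩.X
  X_sub := 𝒩.X_sub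
  Q := Q
  Q_sub := hQ.trans 𝒩.Q_sub
  idx := 𝒩.idx
  hub := 𝒩.hub
  H := 𝒩.H
  refined r hr := (𝒩.refined r hr).mono hQ

/-- The top of a sufficiently high tower of layers has bounded chromatic number. -/
theorem colorableOn_of_tower [Finite V] (hG : Tame G δ τ) (U : ℕ → Set V)
    (hU : ∀ r < blockSize δ τ * blockSize δ τ, Nonempty (Layer G δ K (U r) (U (r + 1)))) :
    ColorableOn G.Adj (U (blockSize δ τ * blockSize δ τ)) (towerBound δ τ K) := by
  classical
  set R := blockSize δ τ * blockSize δ τ with hR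
  let U' : ℕ → Set V := fun r => if r ≤ R then U r else ∅
  have hU' : ∀ r ≤ R, U' r = U r := fun r hr => if_pos hr
  have hlayer : ∀ r, Nonempty (Layer G δ K (U' r) (U' (r + 1))) := by
    intro r
    by_cases hr : r < R
    · rw [hU' r hr.le, hU' (r + 1) hr]
      exact hU r hr
    · have : U' (r + 1) = ∅ := if_neg (by omega)
      rw [this]
      exact ⟨Layer.empty G δ K _⟩
  let layer := fun r => Classical.choice (hlayer r)
  have hanti : Antitone U' := antitone_nat_of_succ_le fun r => (layer r).sub
  have href : ∀ r, ∃ Q : Set V, ∃ (idx : V → ℕ) (hub : V → V) (H : ℕ → Set V), r < R →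
      IsRefined (layer r) (K + (K * δ + 1)) (U' R) Q idx hub H ∧
        ColorableOn G.Adj (U' R \ Q) ((K * δ + 1) * ((2 * (K * δ + 1) + 1) * τ)) := by
    intro r
    by_cases hr : r < R
    · obtain ⟨Q, -, idx, hub, H, h⟩ := (layer r).exists_refined hG (X := U' R) (hanti hr)
      exact ⟨Q, idx, hub, H, fun _ => h⟩
    · exact ⟨∅, fun _ => 0, id, fun _ => ∅, fun h => (hr h).elim⟩
  choose Q idx hub H href using href
  let 𝒩 : Nest G δ K (K + (K * δ + 1)) R :=
    { U := U'
      layer := layer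
      X := U' R
      X_sub := le_rfl
      Q := {x | x ∈ U' R ∧ ∀ r < R, x ∈ Q r}
      Q_sub := fun x hx => hx.1
      idx := idx
      hub := hub
      H := H
      refined := fun r hr => (href r hr).1.mono fun x hx => hx.2 r hr }
  have h1 : ColorableOn G.Adj {x | ∃ r ∈ Finset.range R, x ∈ U' R \ Q r} _ :=
    ColorableOn.biUnion (Finset.range R) (fun r => U' R \ Q r)
      fun r hr => (href r (Finset.mem_range.1 hr)).2
  have h2 := 𝒩.colorableOn_of_chain (B := blockSize δ τ) le_rfl hG hR
    (k := finalBound δ τ K (K + (K * δ + 1)) (1 + adjBound δ τ K (blockSize δ τ)) (blockSize δ τ)) ?_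
  · refine (h1.union h2).mono (fun x hx => ?_) ?_
    · rw [← hU' R le_rfl] at hx
      by_cases hxQ : ∀ r < R, x ∈ Q r
      · exact Or.inr ⟨hx, hxQ⟩
      · push Not at hxQ
        obtain ⟨r, hr, hxr⟩ := hxQ
        exact Or.inl ⟨r, Finset.mem_range.2 hr, hx, hxr⟩
    · rw [towerBound, Finset.card_range]
  · intro Q' hQ' Ξ hΞ hΞc z hz hdet
    have := Nest.colorableOn_of_determined (𝒩 := 𝒩.restrict Q' hQ') hG hΞ
      (by rw [hΞc]; exact le_rfl) hz hdet
    rwa [hΞc] at this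

end Tower

/-! ### Layers from a greedy sequence of cores -/

/-- The sets `A i` are the parts, of size `a`, of a complete `b`-partite induced subgraph of `G`
inside `X`. -/
structure IsPartite {V : Type*} (G : SimpleGraph V) (X : Set V) (a b : ℕ) (A : Fin b → Finset V) :
    Prop where
  card : ∀ i, (A i).card = a
  sub : ∀ i, ∀ x ∈ A i, x ∈ X
  stable : ∀ i, ∀ x ∈ A i, ∀ y ∈ A i, ¬ G.Adj x y
  adj : ∀ i j, i ≠ j → ∀ x ∈ A i, ∀ y ∈ A j, G.Adj x y

section Partite
variable {V : Type*} {G : SimpleGraph V} {X : Set V} {δ τ a b : ℕ} {A : Fin b → Finset V}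

/-- `x` has more than `δ` neighbours in some part. -/
def Strong (G : SimpleGraph V) (δ : ℕ) (A : Fin b → Finset V) (x : V) : Prop :=
  ∃ i, ¬ Few δ (fun l => l ∈ A i ∧ G.Adj x l)

/-- `x` has more than `δ` non-neighbours in some part. -/
def Nondense (G : SimpleGraph V) (δ : ℕ) (A : Fin b → Finset V) (x : V) : Prop :=
  ∃ i, ¬ Few δ (fun l => l ∈ A i ∧ ¬ G.Adj x l)

/-- The union of the parts. -/
def parts (A : Fin b → Finset V) : Set V := {x | ∃ i, x ∈ A i}

/-- `x` has a neighbour in some part. -/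
def Meets (G : SimpleGraph V) (A : Fin b → Finset V) (x : V) : Prop := ∃ y ∈ parts A, G.Adj x y

theorem Strong.meets {x : V} (h : Strong G δ A x) : Meets G A x := by
  obtain ⟨i, hi⟩ := h
  obtain ⟨S, hS, hP⟩ := exists_many_of_not_few hi
  obtain ⟨l, hl⟩ := Finset.card_pos.1 (by omega : 0 < S.card)
  exact ⟨l, ⟨i, (hP l hl).1⟩, (hP l hl).2⟩

namespace IsPartite

theorem exists_ne (hb : 2 ≤ b) (i : Fin b) : ∃ j : Fin b, j ≠ i := by
  have : Nontrivial (Fin b) := Fin.nontrivial_iff_two_le.2 hb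
  exact _root_.exists_ne i

theorem not_few_part (h : IsPartite G X a b A) (ha : δ < a) (i : Fin b) :
    ¬ Few δ (fun l => l ∈ A i) :=
  not_few_of_card_lt (S := A i) (by rw [h.card]; exact ha) fun _ h => h

theorem strong_of_mem (h : IsPartite G X a b A) (hb : 2 ≤ b) (ha : δ < a) {x : V}
    (hx : x ∈ parts A) : Strong G δ A x := by
  obtain ⟨i, hi⟩ := hx
  obtain ⟨j, hj⟩ := exists_ne hb i
  refine ⟨j, fun hfew => h.not_few_part ha j (hfew.mono le_rfl fun l hl => ⟨hl, ?_⟩)⟩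
  exact h.adj i j (Ne.symm hj) x hi l hl

theorem nondense_of_mem (h : IsPartite G X a b A) (ha : δ < a) {x : V}
    (hx : x ∈ parts A) : Nondense G δ A x := by
  obtain ⟨i, hi⟩ := hx
  exact ⟨i, fun hfew => h.not_few_part ha i (hfew.mono le_rfl fun l hl =>
    ⟨hl, h.stable i x hi l hl⟩)⟩

theorem meets_of_not_nondense (h : IsPartite G X a b A) (hb : 2 ≤ b) (ha : δ < a) {x : V}
    (hx : ¬ Nondense G δ A x) : Meets G A x := by
  by_contra hno
  refine hx ⟨⟨0, by omega⟩, fun hfew => h.not_few_part ha _ (hfew.mono le_rfl fun l hl => ⟨hl, ?_⟩)⟩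
  exact fun hadj => hno ⟨l, ⟨_, hl⟩, hadj⟩

/-- A vertex that meets the core and is not dense to it is the handle of a broom of length one. -/
theorem hasBroomOne (h : IsPartite G X a b A) (hb : 2 ≤ b) (ha : δ < a) {x : V}
    (hx : Nondense G δ A x) (hm : Meets G A x) : HasBroomOne G δ x (parts A) := by
  classical
  obtain ⟨j, hj⟩ := hx
  obtain ⟨S, hSc, hS⟩ := exists_many_of_not_few hj
  -- the part of the hub is different from the part of the leaves
  by_cases hout : ∃ i, i ≠ j ∧ ∃ m ∈ A i, G.Adj x m
  · obtain ⟨i, hij, m, hmi, hxm⟩ := hout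
    obtain ⟨L, hL, hLc⟩ := Finset.exists_subset_card_eq
      (by have := Finset.pred_card_le_card_erase (s := S) (a := x); omega : δ ≤ (S.erase x).card)
    have hLS : ∀ l ∈ L, l ∈ S ∧ l ≠ x := fun l hl =>
      ⟨Finset.mem_of_mem_erase (hL hl), Finset.ne_of_mem_erase (hL hl)⟩
    exact ⟨m, L, ⟨hxm, hLc, fun l hl => h.adj i j hij m hmi l (hS l (hLS l hl).1).1,
      fun l hl => (hS l (hLS l hl).1).2, fun l hl => (hLS l hl).2.symm,
      fun l hl l' hl' => h.stable j l (hS l (hLS l hl).1).1 l' (hS l' (hLS l' hl').1).1⟩,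
      ⟨i, hmi⟩, fun l hl => ⟨j, (hS l (hLS l hl).1).1⟩⟩
  · push Not at hout
    obtain ⟨m, ⟨i, hmi⟩, hxm⟩ := hm
    have hij : i = j := by
      by_contra hne
      exact hout i hne m hmi hxm
    subst hij
    obtain ⟨k, hk⟩ := exists_ne hb i
    obtain ⟨L, hL, hLc⟩ := Finset.exists_subset_card_eq
      (by rw [h.card]; exact ha.le : δ ≤ (A k).card)
    obtain ⟨s, hs⟩ := Finset.card_pos.1 (by omega : 0 < S.card)
    refine ⟨m, L, ⟨hxm, hLc, fun l hl => h.adj i k (Ne.symm hk) m hmi l (hL hl),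
      fun l hl => hout k hk l (hL hl), ?_, fun l hl l' hl' => h.stable k l (hL hl) l' (hL hl')⟩,
      ⟨i, hmi⟩, fun l hl => ⟨k, hL hl⟩⟩
    rintro l hl rfl
    exact (hS s hs).2 (h.adj k i hk x (hL hl) s (hS s hs).1)

theorem nondense_of_not_strong (h : IsPartite G X a b A) (ha : 2 * δ < a) {x : V}
    (hx : ¬ Strong G δ A x) (i : Fin b) : ¬ Few δ (fun l => l ∈ A i ∧ ¬ G.Adj x l) := by
  intro hfew
  have h1 : Few δ (fun l => l ∈ A i ∧ G.Adj x l) := by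
    by_contra hno
    exact hx ⟨i, hno⟩
  refine not_few_of_card_lt (D := δ + δ) (S := A i) (P := fun l => l ∈ A i) ?_ (fun _ h => h)
    ((hfew.or h1).mono le_rfl fun l hl => ?_)
  · rw [h.card]; omega
  · by_cases hadj : G.Adj x l
    · exact Or.inr ⟨hl, hadj⟩
    · exact Or.inl ⟨hl, hadj⟩

/-- A vertex that meets the core but has few neighbours in each part is the handle of a broom of
length two. -/
theorem hasBroomTwo (h : IsPartite G X a b A) (hb : 2 ≤ b) (ha : 2 * δ < a) {x : V}
    (hx : ¬ Strong G δ A x) (hm : Meets G A x) : HasBroomTwo G δ x (parts A) := by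
  have hxA : x ∉ parts A := fun hmem => hx (h.strong_of_mem hb (by omega) hmem)
  obtain ⟨m, ⟨i, hmi⟩, hxm⟩ := hm
  obtain ⟨j, hj⟩ := exists_ne hb i
  obtain ⟨S, hSc, hS⟩ := exists_many_of_not_few (h.nondense_of_not_strong ha hx i)
  obtain ⟨S', hSc', hS'⟩ := exists_many_of_not_few (h.nondense_of_not_strong ha hx j)
  obtain ⟨y, hy⟩ := Finset.card_pos.1 (by omega : 0 < S'.card)
  obtain ⟨L, hL, hLc⟩ := Finset.exists_subset_card_eq (by omega : δ ≤ S.card)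
  have hyj := (hS' y hy).1
  have hne : ∀ z ∈ parts A, x ≠ z := fun z hz hxz => hxA (hxz ▸ hz)
  refine ⟨m, y, L, hxm, ⟨h.adj i j (Ne.symm hj) m hmi y hyj, hLc,
    fun l hl => h.adj j i hj y hyj l (hS l (hL hl)).1,
    fun l hl => h.stable i m hmi l (hS l (hL hl)).1, ?_,
    fun l hl l' hl' => h.stable i l (hS l (hL hl)).1 l' (hS l' (hL hl')).1⟩,
    hne y ⟨j, hyj⟩, (hS' y hy).2, fun l hl => ⟨hne l ⟨i, (hS l (hL hl)).1⟩, (hS l (hL hl)).2⟩,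
    ⟨i, hmi⟩, ⟨j, hyj⟩, fun l hl => ⟨i, (hS l (hL hl)).1⟩⟩
  rintro l hl rfl
  exact (hS m (hL hl)).2 hxm

theorem hasLeaves (h : IsPartite G X a b A) {x : V} (hx : Strong G δ A x) :
    HasLeaves G δ x (parts A) := by
  obtain ⟨i, hi⟩ := hx
  obtain ⟨S, hSc, hS⟩ := exists_many_of_not_few hi
  obtain ⟨L, hL, hLc⟩ := Finset.exists_subset_card_eq (by omega : δ ≤ S.card)
  exact ⟨L, hLc, fun l hl => ⟨⟨i, (hS l (hL hl)).1⟩, (hS l (hL hl)).2⟩,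
    fun l hl l' hl' => h.stable i l (hS l (hL hl)).1 l' (hS l' (hL hl')).1⟩

/-- Few vertices are dense to a core, as a stable set of them could be added as a new part. -/
theorem few_dense (h : IsPartite G X a b A) (hG : Tame G δ τ) {α : ℕ} (ha : α * δ + α ≤ a)
    {U : Set V} (hXU : X ⊆ U) (hU : ∀ A', ¬ IsPartite G U α (b + 1) A') :
    Few (ram (τ + 1) α) (fun x => x ∈ U ∧ ¬ Nondense G δ A x) := by
  classical
  by_contra hcon
  obtain ⟨S, hSc, hS⟩ := exists_many_of_not_few hcon
  obtain ⟨D, hD, hDc, hst⟩ := hG.exists_nonadj α id S (by omega)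
  have hsub : ∀ i, ∃ B ⊆ A i, B.card = α ∧ ∀ l ∈ B, ∀ x ∈ D, G.Adj x l := by
    intro i
    have h1 : Few (α * δ) (fun l => ∃ x ∈ D, l ∈ A i ∧ ¬ G.Adj x l) := by
      rw [← hDc]
      refine Few.bind D fun x hx => ?_
      by_contra hno
      exact (hS x (hD hx)).2 ⟨i, hno⟩
    obtain ⟨B, hB, hBc, hBx⟩ := h1.exists_subset (S := A i) (k := α) (by rw [h.card]; exact ha)
    refine ⟨B, hB, hBc, fun l hl x hx => ?_⟩
    by_contra hno
    exact hBx l hl ⟨x, hx, hB hl, hno⟩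
  choose B hB hBc hBD using hsub
  refine hU (Fin.cons D B) ⟨?_, ?_, ?_, ?_⟩
  · intro i
    refine Fin.cases ?_ (fun i => ?_) i
    · simpa using hDc
    · simpa using hBc i
  · intro i
    refine Fin.cases ?_ (fun i => ?_) i
    · simpa using fun x hx => (hS x (hD hx)).1
    · simpa using fun x hx => hXU (h.sub i x (hB i hx))
  · intro i
    refine Fin.cases ?_ (fun i => ?_) i
    · simpa using hst
    · simpa using fun x hx y hy => h.stable i x (hB i hx) y (hB i hy)
  · intro i j
    refine Fin.cases ?_ (fun i => ?_) i <;> refine Fin.cases ?_ (fun j => ?_) j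
    · intro hij; exact (hij rfl).elim
    · intro _ x hx y hy
      simp only [Fin.cons_zero, Fin.cons_succ] at hx hy
      exact hBD j y hy x hx
    · intro _ x hx y hy
      simp only [Fin.cons_zero, Fin.cons_succ] at hx hy
      exact (hBD i x hx y hy).symm
    · intro hij x hx y hy
      simp only [Fin.cons_succ] at hx hy
      exact h.adj i j (fun h => hij (by rw [h])) x (hB i hx) y (hB j hy)

end IsPartite
end Partite

/-- The size of the parts of the cores. -/
def partSize (α δ : ℕ) : ℕ := α * δ + α + 2 * δ + 1

/-- The bound in the layers built from cores. -/
def layerBound (α β δ τ : ℕ) : ℕ :=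
  β * partSize α δ + (2 * δ + 1 + ram (τ + 1) α) +
    ram (τ + 1) ((2 * (2 * δ + 1 + ram (τ + 1) α) + 1) * (0 + 2 * δ) + 1) +
    β * partSize α δ * τ

/-- The chromatic number of the part of a set that is not covered by its two layers, if sets without
cores are `t`-colourable. -/
def remainderBound (α β δ τ t : ℕ) : ℕ :=
  t + (2 * ((2 * δ + 1) * ram (τ + 1) α + ram (τ + 1) α) + 1) * τ + β

section Greedy
variable {V : Type*} {G : SimpleGraph V} {δ τ α β t : ℕ} {U : Set V}

/-- A sequence of cores, chosen greedily: `core n` lies in `rem n`, or is empty if `rem n` has no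
core, and `rem (n + 1)` is obtained from `rem n` by the removal of the neighbours of
the vertices that are strong but not dense to `core n`. -/
structure Greedy (G : SimpleGraph V) (δ α β : ℕ) (U : Set V) where
  rem : ℕ → Set V
  core : ℕ → Fin β → Finset V
  rem_zero : rem 0 = U
  rem_succ : ∀ n, rem (n + 1) =
    rem n \ {x | ∃ w ∈ U, Strong G δ (core n) w ∧ Nondense G δ (core n) w ∧ G.Adj w x}
  core_spec : ∀ n, IsPartite G (rem n) (partSize α δ) β (core n) ∨
    ((∀ i, core n i = ∅) ∧ ∀ A, ¬ IsPartite G (rem n) (partSize α δ) β A)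

theorem exists_greedy (G : SimpleGraph V) (δ α β : ℕ) (U : Set V) :
    Nonempty (Greedy G δ α β U) := by
  classical
  have : ∀ X : Set V, ∃ A : Fin β → Finset V, IsPartite G X (partSize α δ) β A ∨
      ((∀ i, A i = ∅) ∧ ∀ A, ¬ IsPartite G X (partSize α δ) β A) := by
    intro X
    by_cases h : ∃ A, IsPartite G X (partSize α δ) β A
    · obtain ⟨A, hA⟩ := h
      exact ⟨A, Or.inl hA⟩
    · push Not at h
      exact ⟨fun _ => ∅, Or.inr ⟨fun _ => rfl, h⟩⟩
  choose pick hpick using this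
  let step : Set V → Set V := fun X =>
    X \ {x | ∃ w ∈ U, Strong G δ (pick X) w ∧ Nondense G δ (pick X) w ∧ G.Adj w x}
  exact ⟨⟨fun n => step^[n] U, fun n => pick (step^[n] U), rfl,
    fun n => Function.iterate_succ_apply' _ _ _, fun n => hpick _⟩⟩

namespace Greedy
variable (𝒢 : Greedy G δ α β U)

/-- The vertices that are strong but not dense to the core with index `c`. -/
def hubs (c : ℕ) : Set V := {w | w ∈ U ∧ Strong G δ (𝒢.core c) w ∧ Nondense G δ (𝒢.core c) w}

theorem rem_antitone : Antitone 𝒢.rem := antitone_nat_of_succ_le fun n => by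
  rw [𝒢.rem_succ]; exact Set.sdiff_subset

theorem rem_sub (n : ℕ) : 𝒢.rem n ⊆ U := by
  have h := 𝒢.rem_antitone (Nat.zero_le n)
  rwa [𝒢.rem_zero] at h

theorem isPartite_of_mem {c : ℕ} {x : V} (hx : x ∈ parts (𝒢.core c)) :
    IsPartite G (𝒢.rem c) (partSize α δ) β (𝒢.core c) := by
  refine (𝒢.core_spec c).resolve_right fun h => ?_
  obtain ⟨i, hi⟩ := hx
  rw [h.1 i] at hi
  simp at hi

theorem isPartite_of_meets {c : ℕ} {x : V} (hx : Meets G (𝒢.core c) x) :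
    IsPartite G (𝒢.rem c) (partSize α δ) β (𝒢.core c) := by
  obtain ⟨y, hy, -⟩ := hx
  exact 𝒢.isPartite_of_mem hy

theorem size_lt : 2 * δ < partSize α δ := by rw [partSize]; omega

theorem size_lt' : δ < partSize α δ := by rw [partSize]; omega

theorem mem_hubs (hβ : 2 ≤ β) {c : ℕ} {y : V} (hy : y ∈ parts (𝒢.core c)) : y ∈ 𝒢.hubs c := by
  have h := 𝒢.isPartite_of_mem hy
  refine ⟨?_, h.strong_of_mem hβ size_lt' hy, h.nondense_of_mem size_lt' hy⟩
  obtain ⟨i, hi⟩ := hy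
  exact 𝒢.rem_sub c (h.sub i y hi)

theorem meets_of_mem (hβ : 2 ≤ β) {c : ℕ} {y : V} (hy : y ∈ parts (𝒢.core c)) :
    Meets G (𝒢.core c) y := (𝒢.mem_hubs hβ hy).2.1.meets

/-- The hubs of a core have no neighbours in the later cores. -/
theorem not_meets_of_lt {c c' : ℕ} (hc : c < c') {w : V} (hw : w ∈ 𝒢.hubs c) :
    ¬ Meets G (𝒢.core c') w := by
  rintro ⟨y, hy, hwy⟩
  have h := 𝒢.isPartite_of_mem hy
  obtain ⟨i, hi⟩ := hy
  have h1 : y ∈ 𝒢.rem (c + 1) := 𝒢.rem_antitone hc (h.sub i y hi)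
  rw [𝒢.rem_succ] at h1
  exact h1.2 ⟨w, hw.1, hw.2.1, hw.2.2, hwy⟩

theorem hubs_disj {c c' : ℕ} {w : V} (hw : w ∈ 𝒢.hubs c) (hw' : w ∈ 𝒢.hubs c') : c = c' := by
  rcases lt_trichotomy c c' with h | h | h
  · exact (𝒢.not_meets_of_lt h hw hw'.2.1.meets).elim
  · exact h
  · exact (𝒢.not_meets_of_lt h hw' hw.2.1.meets).elim

theorem meets_iff_touches (hβ : 2 ≤ β) {c : ℕ} {x : V} :
    Touches G x (parts (𝒢.core c)) ↔ Meets G (𝒢.core c) x := by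
  constructor
  · rintro ⟨y, hy, rfl | hxy⟩
    · exact 𝒢.meets_of_mem hβ hy
    · exact ⟨y, hy, hxy⟩
  · rintro ⟨y, hy, hxy⟩
    exact ⟨y, hy, Or.inr hxy⟩

theorem apart (hβ : 2 ≤ β) {c c' : ℕ} (hc : c ≠ c') :
    Apart G (parts (𝒢.core c)) (parts (𝒢.core c')) := by
  rcases lt_or_gt_of_ne hc with h | h
  · refine apart_iff.2 fun x hx => ?_
    rw [𝒢.meets_iff_touches hβ]
    exact 𝒢.not_meets_of_lt h (𝒢.mem_hubs hβ hx)
  · refine Apart.symm (apart_iff.2 fun x hx => ?_)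
    rw [𝒢.meets_iff_touches hβ]
    exact 𝒢.not_meets_of_lt h (𝒢.mem_hubs hβ hx)

/-- A vertex meets few cores without being strong to them: each of these provides both kinds of
brooms. -/
theorem few_weak (hβ : 2 ≤ β) (hG : Tame G δ τ) (x : V) :
    Few (2 * δ) (fun c => Meets G (𝒢.core c) x ∧ ¬ Strong G δ (𝒢.core c) x) := by
  by_contra hcon
  obtain ⟨S, hSc, hS⟩ := exists_many_of_not_few hcon
  refine hG.free (isIndContained_of_brooms (u := x) S (by omega) (fun c => parts (𝒢.core c))
    (fun c hc => ?_) (fun c hc => ?_) fun c _ c' _ hcc => 𝒢.apart hβ hcc)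
  · exact (𝒢.isPartite_of_meets (hS c hc).1).hasBroomOne hβ size_lt'
      ⟨⟨0, by omega⟩, (𝒢.isPartite_of_meets (hS c hc).1).nondense_of_not_strong size_lt
        (hS c hc).2 _⟩ (hS c hc).1
  · exact (𝒢.isPartite_of_meets (hS c hc).1).hasBroomTwo hβ size_lt (hS c hc).2 (hS c hc).1

/-- A vertex of `U` meets few cores to which it is not dense, since it is strong to at most one of
them. -/
theorem few_nondense (hβ : 2 ≤ β) (hG : Tame G δ τ) (x : V) :
    Few (2 * δ + 1) (fun c => x ∈ U ∧ Meets G (𝒢.core c) x ∧ Nondense G δ (𝒢.core c) x) := by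
  have h1 : Few 1 (fun c => x ∈ 𝒢.hubs c) := by
    by_cases h : ∃ c, x ∈ 𝒢.hubs c
    · obtain ⟨c, hc⟩ := h
      exact ⟨{c}, by simp, fun c' hc' => by simpa using 𝒢.hubs_disj hc' hc⟩
    · push Not at h
      exact (few_false h).mono (Nat.zero_le _) fun _ h => h
  refine ((𝒢.few_weak hβ hG x).or h1).mono le_rfl ?_
  rintro c ⟨hxU, hm, hn⟩
  by_cases hs : Strong G δ (𝒢.core c) x
  · exact Or.inr ⟨hxU, hs, hn⟩
  · exact Or.inl ⟨hm, hs⟩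

/-- `x` is dense to the nonempty core with index `c`. -/
def Dense (c : ℕ) (x : V) : Prop := (parts (𝒢.core c)).Nonempty ∧ ¬ Nondense G δ (𝒢.core c) x

theorem Dense.meets {𝒢 : Greedy G δ α β U} (hβ : 2 ≤ β) {c : ℕ} {x : V} (h : 𝒢.Dense c x) :
    Meets G (𝒢.core c) x := by
  obtain ⟨⟨y, hy⟩, hn⟩ := h
  exact (𝒢.isPartite_of_mem hy).meets_of_not_nondense hβ size_lt' hn

theorem not_dense_of_mem (hβ : 2 ≤ β) {c c' : ℕ} {y : V} (hy : y ∈ parts (𝒢.core c)) :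
    ¬ 𝒢.Dense c' y := by
  intro h
  by_cases hc : c = c'
  · subst hc
    exact h.2 (𝒢.mem_hubs hβ hy).2.2
  · obtain ⟨z, hz, hyz⟩ := h.meets hβ
    exact (𝒢.apart hβ hc y hy z hz).2 hyz

theorem few_dense (hG : Tame G δ τ) (hU : ∀ A, ¬ IsPartite G U α (β + 1) A) (c : ℕ) :
    Few (ram (τ + 1) α) (fun x => x ∈ U ∧ 𝒢.Dense c x) := by
  by_cases h : (parts (𝒢.core c)).Nonempty
  · obtain ⟨y, hy⟩ := h
    refine ((𝒢.isPartite_of_mem hy).few_dense hG (by rw [partSize]; omega) (𝒢.rem_sub c) hU).mono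
      le_rfl fun x hx => ⟨hx.1, hx.2.2⟩
  · exact (few_false fun x hx => h hx.2.1).mono (Nat.zero_le _) fun _ h => h

/-- The vertices of `U` that are dense to some core. -/
def denseSet : Set V := {x | x ∈ U ∧ ∃ c, 𝒢.Dense c x}

/-- Each vertex of `denseSet` has a neighbour in the core that it is dense to, and few others have to
be kept apart from it to make these neighbours private. -/
theorem colorableOn_denseSet [Finite V] (hβ : 2 ≤ β) (hG : Tame G δ τ)
    (hU : ∀ A, ¬ IsPartite G U α (β + 1) A) :
    ColorableOn G.Adj 𝒢.denseSet
      ((2 * ((2 * δ + 1) * ram (τ + 1) α + ram (τ + 1) α) + 1) * τ) := by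
  have hκ : ∀ x, ∃ c y, x ∈ 𝒢.denseSet → 𝒢.Dense c x ∧ y ∈ parts (𝒢.core c) ∧ G.Adj y x := by
    intro x
    by_cases hx : x ∈ 𝒢.denseSet
    · obtain ⟨c, hc⟩ := hx.2
      obtain ⟨y, hy, hxy⟩ := hc.meets hβ
      exact ⟨c, y, fun _ => ⟨hc, hy, hxy.symm⟩⟩
    · exact ⟨0, x, fun h => (hx h).elim⟩
  choose κ h hκ using hκ
  refine hG.colorableOn_of_cover h (S := fun x y => (Meets G (𝒢.core (κ y)) x ∧
    Nondense G δ (𝒢.core (κ y)) x) ∨ 𝒢.Dense (κ x) y) (fun x hx => (hκ x hx).2.2) ?_ ?_ ?_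
  · intro x hx hmem
    obtain ⟨c, hc⟩ := hmem.2
    exact 𝒢.not_dense_of_mem hβ (hκ x hx).2.1 hc
  · intro x hx y hy _ hadj
    by_cases hn : Nondense G δ (𝒢.core (κ x)) y
    · exact Or.inr (Or.inl ⟨⟨h x, (hκ x hx).2.1, hadj.symm⟩, hn⟩)
    · exact Or.inl (Or.inr ⟨(hκ x hx).1.1, hn⟩)
  · intro x hx
    refine (((𝒢.few_nondense hβ hG x).bind_few (P := fun c y => y ∈ U ∧ 𝒢.Dense c y)
      fun c _ => 𝒢.few_dense hG hU c).or (𝒢.few_dense hG hU (κ x))).mono le_rfl ?_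
    rintro y ⟨hy, -, ⟨h1, h2⟩ | h1⟩
    · exact Or.inl ⟨κ y, ⟨hx.1, h1, h2⟩, hy.1, (hκ y hy).1⟩
    · exact Or.inr ⟨hy.1, h1⟩

/-- The vertices of `U` outside the cores that meet some core, but are dense to none. -/
def coreLayer : Set V :=
  {x | x ∈ U ∧ x ∉ 𝒢.denseSet ∧ (∀ c, x ∉ parts (𝒢.core c)) ∧ ∃ c, Meets G (𝒢.core c) x}

/-- The vertices of `U` that meet no core, but have a neighbour among the hubs. -/
def hubLayer : Set V :=
  {x | x ∈ U ∧ (∀ c, ¬ Meets G (𝒢.core c) x) ∧ ∃ c, ∃ w ∈ 𝒢.hubs c, G.Adj x w}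

open Classical in
/-- The vertex set of the core with index `c`. -/
noncomputable def coreFinset (c : ℕ) : Finset V := Finset.univ.biUnion (𝒢.core c)

theorem coe_coreFinset (c : ℕ) : (𝒢.coreFinset c : Set V) = parts (𝒢.core c) := by
  ext x
  simp [coreFinset, parts]

theorem mem_coreFinset {c : ℕ} {x : V} : x ∈ 𝒢.coreFinset c ↔ x ∈ parts (𝒢.core c) := by
  rw [← 𝒢.coe_coreFinset, Finset.mem_coe]

theorem card_coreFinset (c : ℕ) : (𝒢.coreFinset c).card ≤ β * partSize α δ := by
  classical
  refine Finset.card_biUnion_le.trans ?_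
  have : ∀ i ∈ (Finset.univ : Finset (Fin β)), (𝒢.core c i).card ≤ partSize α δ := by
    intro i _
    rcases 𝒢.core_spec c with h | h
    · exact (h.card i).le
    · rw [h.1 i]; simp
  simpa using Finset.sum_le_card_nsmul _ _ _ this

theorem colorableOn_near (hG : Tame G δ τ) (c : ℕ) {X : Set V}
    (hX : ∀ x ∈ X, ∃ m, G.Adj x m ∧ (m ∈ parts (𝒢.core c) ∨ Meets G (𝒢.core c) m)) :
    ColorableOn G.Adj X (β * partSize α δ * τ) := by
  refine (ColorableOn.biUnion (𝒢.coreFinset c) _ fun v _ => hG.ball v).mono ?_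
    (Nat.mul_le_mul_right _ (𝒢.card_coreFinset c))
  intro x hx
  obtain ⟨m, hxm, hm | ⟨y, hy, hmy⟩⟩ := hX x hx
  · exact ⟨m, 𝒢.mem_coreFinset.2 hm, Or.inr (Or.inl hxm.symm)⟩
  · exact ⟨y, 𝒢.mem_coreFinset.2 hy, Or.inr (Or.inr ⟨m, hmy.symm, hxm.symm⟩)⟩

/-- In this layer the vertices of the cores are the hubs. -/
theorem nonempty_coreLayer (hβ : 2 ≤ β) (hG : Tame G δ τ) :
    Nonempty (Layer G δ (layerBound α β δ τ) U 𝒢.coreLayer) := by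
  have hnd : ∀ x ∈ 𝒢.coreLayer, ∀ c, Meets G (𝒢.core c) x → Nondense G δ (𝒢.core c) x := by
    intro x hx c hm
    by_contra hn
    obtain ⟨y, hy, -⟩ := hm
    exact hx.2.1 ⟨hx.1, c, ⟨y, hy⟩, hn⟩
  exact ⟨{
    Y := 𝒢.coreFinset
    M := fun c => 𝒢.coreFinset c
    out := fun _ _ => False
    into := fun _ _ => False
    sub := fun x hx => hx.1
    Y_sub := fun c y hy => (𝒢.mem_hubs hβ (𝒢.mem_coreFinset.1 hy)).1
    M_sub := fun c y hy => (𝒢.mem_hubs hβ (𝒢.mem_coreFinset.1 hy)).1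
    Y_notMem := fun c y hy hy' => hy'.2.2.1 c (𝒢.mem_coreFinset.1 hy)
    M_notMem := fun c y hy hy' => hy'.2.2.1 c (𝒢.mem_coreFinset.1 hy)
    card_Y := fun c => (𝒢.card_coreFinset c).trans (by rw [layerBound]; omega)
    Y_apart := fun c c' hc => by
      rw [𝒢.coe_coreFinset, 𝒢.coe_coreFinset]
      exact 𝒢.apart hβ hc
    M_disj := fun c c' m hm hm' => 𝒢.hubs_disj (𝒢.mem_hubs hβ (𝒢.mem_coreFinset.1 hm))
      (𝒢.mem_hubs hβ (𝒢.mem_coreFinset.1 hm'))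
    touch := fun c c' hc m hm ht => by
      rw [𝒢.coe_coreFinset] at ht
      exact (apart_iff.1 (𝒢.apart hβ hc) m (𝒢.mem_coreFinset.1 hm) ht).elim
    out_few := fun _ => (few_false fun _ h => h).mono (Nat.zero_le _) fun _ h => h
    into_few := fun _ => (few_false fun _ h => h).mono (Nat.zero_le _) fun _ h => h
    near := fun x hx => by
      refine (𝒢.few_nondense hβ hG x).mono (by rw [layerBound]; omega) fun c hc => ?_
      rw [Set.union_self, 𝒢.coe_coreFinset, 𝒢.meets_iff_touches hβ] at hc
      exact ⟨hx.1, hc, hnd x hx c hc⟩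
    cover := fun x hx => by
      obtain ⟨c, y, hy, hxy⟩ := hx.2.2.2
      exact ⟨c, y, 𝒢.mem_coreFinset.2 hy, hxy⟩
    broom := fun x hx c m hm hxm => by
      have hmeets : Meets G (𝒢.core c) x := ⟨m, 𝒢.mem_coreFinset.1 hm, hxm⟩
      rw [𝒢.coe_coreFinset]
      exact ((𝒢.isPartite_of_meets hmeets).hasBroomOne hβ size_lt' (hnd x hx c hmeets) hmeets).mono
        (Set.subset_insert _ _)
    color := fun c => (𝒢.colorableOn_near hG c (fun x hx => by
      obtain ⟨m, hm, hxm⟩ := hx.2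
      exact ⟨m, hxm, Or.inl (𝒢.mem_coreFinset.1 hm)⟩)).mono le_rfl (by rw [layerBound]; omega)
    alt := Or.inl fun _ => rfl }⟩

/-- A vertex that meets no core has neighbours in the hub sets of few cores. -/
theorem few_hubs (hβ : 2 ≤ β) (hG : Tame G δ τ) (hU : ∀ A, ¬ IsPartite G U α (β + 1) A) {x : V}
    (hx : x ∈ 𝒢.hubLayer) :
    Few (ram (τ + 1) ((2 * (2 * δ + 1 + ram (τ + 1) α) + 1) * (0 + 2 * δ) + 1))
      (fun c => ∃ m ∈ 𝒢.hubs c, G.Adj x m) := by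
  by_contra hcon
  obtain ⟨S, hSc, hS⟩ := exists_many_of_not_few hcon
  have hm : ∀ c, ∃ m, c ∈ S → m ∈ 𝒢.hubs c ∧ G.Adj x m := fun c => by
    by_cases hc : c ∈ S
    · obtain ⟨m, hm⟩ := hS c hc
      exact ⟨m, fun _ => hm⟩
    · exact ⟨x, fun h => (hc h).elim⟩
  choose m hm using hm
  have hinj : ∀ c ∈ S, ∀ c' ∈ S, m c = m c' → c = c' := fun c hc c' hc' h =>
    𝒢.hubs_disj (hm c hc).1 (h ▸ (hm c' hc').1)
  obtain ⟨S₁, hS₁, hc₁, hna⟩ := hG.exists_nonadj _ m S (by rw [hSc]; exact Nat.le_succ _)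
  obtain ⟨S₂, hS₂, hc₂, hfree⟩ := exists_free_subset (s := S₁)
    (R := fun c c' => (Meets G (𝒢.core c') (m c) ∧ Nondense G δ (𝒢.core c') (m c)) ∨
      𝒢.Dense c (m c')) (fun c hc => by
        refine ((𝒢.few_nondense hβ hG (m c)).or ((𝒢.few_dense hG hU c).preimage
          (P := fun c' => c' ∈ S) m hinj)).mono le_rfl ?_
        rintro c' ⟨hc', -, h | h⟩
        · exact Or.inl ⟨(hm c (hS₁ hc)).1.1, h⟩
        · exact Or.inr ⟨hS₁ hc', (hm c' (hS₁ hc')).1.1, h⟩) hc₁.ge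
  have hmc : ∀ c ∈ S₂, m c ∈ 𝒢.hubs c ∧ G.Adj x (m c) := fun c hc => hm c (hS₁ (hS₂ hc))
  have hcross : ∀ c ∈ S₂, ∀ c' ∈ S₂, c ≠ c' → ¬ Touches G (m c) (parts (𝒢.core c')) := by
    intro c hc c' hc' hcc ht
    have ht' := (𝒢.meets_iff_touches hβ).1 ht
    by_cases hn : Nondense G δ (𝒢.core c') (m c)
    · exact hfree c hc c' hc' hcc (Or.inl ⟨ht', hn⟩)
    · obtain ⟨y, hy, -⟩ := ht'
      exact hfree c' hc' c hc (Ne.symm hcc) (Or.inr ⟨⟨y, hy⟩, hn⟩)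
  refine hG.free (isIndContained_of_star (u := x) S₂ m (fun c => parts (𝒢.core c)) hc₂.ge
    (fun c hc => (hmc c hc).2) (few_false fun c hc => ?_) ?_
    (fun c hc => (𝒢.isPartite_of_meets (hmc c hc).1.2.1.meets).hasLeaves (hmc c hc).1.2.1)
    (fun c hc => (𝒢.isPartite_of_meets (hmc c hc).1.2.1.meets).hasBroomOne hβ size_lt'
      (hmc c hc).1.2.2 (hmc c hc).1.2.1.meets))
  · exact hx.2.1 c ((𝒢.meets_iff_touches hβ).1 hc.2)
  · intro c hc c' hc' hcc
    refine apart_iff.2 ?_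
    rintro z (rfl | hz) ⟨y, rfl | hy, hzy⟩
    · rcases hzy with h | h
      · exact hcc (hinj c (hS₁ (hS₂ hc)) c' (hS₁ (hS₂ hc')) h)
      · exact hna c (hS₂ hc) c' (hS₂ hc') h
    · exact hcross c hc c' hc' hcc ⟨y, hy, hzy⟩
    · exact hcross c' hc' c hc (Ne.symm hcc) ⟨z, hz, hzy.imp Eq.symm fun h => h.symm⟩
    · exact apart_iff.1 (𝒢.apart hβ hcc) z hz ⟨y, hy, hzy⟩

/-- In this layer the hubs are the vertices that are strong but not dense to a core. -/
theorem nonempty_hubLayer (hβ : 2 ≤ β) (hG : Tame G δ τ)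
    (hU : ∀ A, ¬ IsPartite G U α (β + 1) A) :
    Nonempty (Layer G δ (layerBound α β δ τ) U 𝒢.hubLayer) := by
  have hnot : ∀ x ∈ 𝒢.hubLayer, ∀ c, x ∉ 𝒢.hubs c := fun x hx c h => hx.2.1 c h.2.1.meets
  have hYhub : ∀ c, ∀ y ∈ 𝒢.coreFinset c, y ∈ 𝒢.hubs c := fun c y hy =>
    𝒢.mem_hubs hβ (𝒢.mem_coreFinset.1 hy)
  exact ⟨{
    Y := 𝒢.coreFinset
    M := 𝒢.hubs
    out := fun m c => m ∈ U ∧ Meets G (𝒢.core c) m ∧ Nondense G δ (𝒢.core c) m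
    into := fun m c => m ∈ U ∧ 𝒢.Dense c m
    sub := fun x hx => hx.1
    Y_sub := fun c y hy => (hYhub c y hy).1
    M_sub := fun c y hy => hy.1
    Y_notMem := fun c y hy hy' => hnot y hy' c (hYhub c y hy)
    M_notMem := fun c y hy hy' => hnot y hy' c hy
    card_Y := fun c => (𝒢.card_coreFinset c).trans (by rw [layerBound]; omega)
    Y_apart := fun c c' hc => by
      rw [𝒢.coe_coreFinset, 𝒢.coe_coreFinset]
      exact 𝒢.apart hβ hc
    M_disj := fun c c' m hm hm' => 𝒢.hubs_disj hm hm'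
    touch := fun c c' hc m hm ht => by
      rw [𝒢.coe_coreFinset, 𝒢.meets_iff_touches hβ] at ht
      by_cases hn : Nondense G δ (𝒢.core c') m
      · exact Or.inl ⟨hm.1, ht, hn⟩
      · obtain ⟨y, hy, -⟩ := ht
        exact Or.inr ⟨hm.1, ⟨y, hy⟩, hn⟩
    out_few := fun m => (𝒢.few_nondense hβ hG m).mono (by rw [layerBound]; omega) fun _ h => h
    into_few := fun c => (𝒢.few_dense hG hU c).mono (by rw [layerBound]; omega) fun _ h => h
    near := fun x hx => by
      refine (𝒢.few_hubs hβ hG hU hx).mono (by rw [layerBound]; omega) ?_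
      rintro c ⟨m, hm, hxm⟩
      have hmc : m ∈ 𝒢.hubs c := hm.elim id fun h => hYhub c m h
      refine ⟨m, hmc, hxm.resolve_left ?_⟩
      rintro rfl
      exact hnot _ hx c hmc
    cover := fun x hx => hx.2.2
    broom := fun x hx c m hm hxm => by
      rw [𝒢.coe_coreFinset]
      exact ((𝒢.isPartite_of_meets hm.2.1.meets).hasLeaves hm.2.1).hasBroomOne hxm
        fun ht => hx.2.1 c ((𝒢.meets_iff_touches hβ).1 ht)
    color := fun c => (𝒢.colorableOn_near hG c (fun x hx => by
      obtain ⟨m, hm, hxm⟩ := hx.2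
      exact ⟨m, hxm, Or.inr hm.2.1.meets⟩)).mono le_rfl (by rw [layerBound]; omega)
    alt := Or.inr fun c => ⟨fun m hm => by
      obtain ⟨y, hy, hmy⟩ := hm.2.1.meets
      exact ⟨y, 𝒢.mem_coreFinset.2 hy, hmy.symm⟩, fun y hy x hx hyx =>
        hx.2.1 c ⟨y, 𝒢.mem_coreFinset.1 hy, hyx.symm⟩⟩ }⟩

/-- The sets `rem n` shrink as long as they contain cores, since all vertices of `core n` have
neighbours in it. -/
theorem exists_no_core [Finite V] (hβ : 2 ≤ β) : ∃ n, ∀ A, ¬ IsPartite G (𝒢.rem n) (partSize α δ) β A := by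
  by_contra hcon
  push Not at hcon
  have hpart : ∀ n, IsPartite G (𝒢.rem n) (partSize α δ) β (𝒢.core n) := fun n => by
    obtain ⟨A, hA⟩ := hcon n
    exact (𝒢.core_spec n).resolve_right fun h => h.2 A hA
  have hlt : ∀ n, (𝒢.rem (n + 1)).ncard < (𝒢.rem n).ncard := by
    intro n
    refine Set.ncard_lt_ncard ⟨𝒢.rem_antitone (Nat.le_succ n), fun hsub => ?_⟩ (Set.toFinite _)
    have h := hpart n
    have hpos : 0 < (𝒢.core n ⟨0, by omega⟩).card := by
      rw [h.card, partSize]; omega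
    obtain ⟨y, hy⟩ := Finset.card_pos.1 hpos
    obtain ⟨z, hz, hyz⟩ := 𝒢.meets_of_mem hβ (⟨_, hy⟩ : y ∈ parts (𝒢.core n))
    have h1 := hsub (h.sub _ y hy)
    rw [𝒢.rem_succ] at h1
    obtain ⟨h2, h3, h4⟩ := 𝒢.mem_hubs hβ hz
    exact h1.2 ⟨z, h2, h3, h4, hyz.symm⟩
  have hle : ∀ n, (𝒢.rem n).ncard + n ≤ (𝒢.rem 0).ncard := by
    intro n
    induction n with
    | zero => exact le_rfl
    | succ n ih => have := hlt n; omega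
  have := hle ((𝒢.rem 0).ncard + 1)
  omega

/-- What is left of `U` consists of the last set of the greedy sequence, which contains no core,
the vertices dense to some core, and the cores themselves. -/
theorem colorableOn_remainder [Finite V] (hβ : 2 ≤ β) (hG : Tame G δ τ)
    (hU : ∀ A, ¬ IsPartite G U α (β + 1) A)
    (ht : ∀ X ⊆ U, (∀ A, ¬ IsPartite G X (partSize α δ) β A) → ColorableOn G.Adj X t) :
    ColorableOn G.Adj (U \ (𝒢.coreLayer ∪ 𝒢.hubLayer)) (remainderBound α β δ τ t) := by
  classical
  obtain ⟨n, hn⟩ := 𝒢.exists_no_core hβ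
  have h1 := ht _ (𝒢.rem_sub n) hn
  have h2 := 𝒢.colorableOn_denseSet hβ hG hU
  have h3 : ColorableOn G.Adj {x | ∃ i ∈ (Finset.univ : Finset (Fin β)), ∃ c, x ∈ 𝒢.core c i}
      ((Finset.univ : Finset (Fin β)).card * 1) := by
    refine ColorableOn.biUnion Finset.univ (fun i => {x | ∃ c, x ∈ 𝒢.core c i}) fun i _ => ?_
    refine ⟨fun _ => 0, fun _ _ => Nat.one_pos, ?_⟩
    rintro x ⟨c, hx⟩ y ⟨c', hy⟩ hxy
    by_cases hc : c = c'
    · subst hc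
      exact ((𝒢.isPartite_of_mem ⟨i, hx⟩).stable i x hx y hy hxy).elim
    · exact ((𝒢.apart hβ hc x ⟨i, hx⟩ y ⟨i, hy⟩).2 hxy).elim
  refine ((h1.union h2).union h3).mono (fun x hx => ?_) (by
    rw [remainderBound, Finset.card_univ, Fintype.card_fin, mul_one])
  by_contra hno
  have hno1 : x ∉ 𝒢.rem n := fun h => hno (Or.inl (Or.inl h))
  have hno2 : x ∉ 𝒢.denseSet := fun h => hno (Or.inl (Or.inr h))
  have hno3 : ∀ c, x ∉ parts (𝒢.core c) := fun c ⟨i, hi⟩ =>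
    hno (Or.inr ⟨i, Finset.mem_univ i, c, hi⟩)
  by_cases hm : ∃ c, Meets G (𝒢.core c) x
  · exact hx.2 (Or.inl ⟨hx.1, hno2, hno3, hm⟩)
  push Not at hm
  refine hx.2 (Or.inr ⟨hx.1, hm, ?_⟩)
  -- `x` has been removed in some step
  have : ∀ k, x ∉ 𝒢.rem k → ∃ c, ∃ w ∈ 𝒢.hubs c, G.Adj x w := by
    intro k
    induction k with
    | zero =>
      intro h
      rw [𝒢.rem_zero] at h
      exact (h hx.1).elim
    | succ k ih =>
      intro h
      by_cases hk : x ∈ 𝒢.rem k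
      · rw [𝒢.rem_succ] at h
        by_contra hcon
        push Not at hcon
        exact h ⟨hk, fun ⟨w, h1, h2, h3, h4⟩ => hcon k w ⟨h1, h2, h3⟩ h4.symm⟩
      · exact ih hk
  exact this n hno1

end Greedy
end Greedy

/-! ### Graphs without large bicliques -/

/-- There are no two sets of `s` vertices in `X` that are completely adjacent to each other. -/
def NoBiclique {V : Type*} (G : SimpleGraph V) (X : Set V) (s : ℕ) : Prop :=
  ∀ A B : Finset V, A.card = s → B.card = s → (∀ a ∈ A, a ∈ X) → (∀ b ∈ B, b ∈ X) →
    ¬ ∀ a ∈ A, ∀ b ∈ B, G.Adj a b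

theorem exists_lt_split {ι : Type*} [LinearOrder ι] {s : ℕ} (T : Finset ι) (hT : T.card = s + s) :
    ∃ L ⊆ T, ∃ U ⊆ T, L.card = s ∧ U.card = s ∧ ∀ l ∈ L, ∀ u ∈ U, l < u := by
  classical
  let f := T.orderEmbOfFin hT
  refine ⟨Finset.univ.image fun i : Fin s => f (Fin.castAdd s i), ?_,
    Finset.univ.image fun i : Fin s => f (Fin.natAdd s i), ?_, ?_, ?_, ?_⟩
  · intro a ha
    obtain ⟨i, -, rfl⟩ := Finset.mem_image.1 ha
    exact T.orderEmbOfFin_mem hT _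
  · intro a ha
    obtain ⟨i, -, rfl⟩ := Finset.mem_image.1 ha
    exact T.orderEmbOfFin_mem hT _
  · rw [Finset.card_image_of_injective _ fun i j h => by simpa using h]
    simp
  · rw [Finset.card_image_of_injective _ fun i j h => by simpa using h]
    simp
  · intro l hl u hu
    obtain ⟨i, -, rfl⟩ := Finset.mem_image.1 hl
    obtain ⟨j, -, rfl⟩ := Finset.mem_image.1 hu
    refine f.lt_iff_lt.2 ?_
    rw [Fin.lt_def]
    simp only [Fin.val_castAdd, Fin.val_natAdd]
    omega

/-- A relation that does not hold completely between two sets of size `s` vanishes on a large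
set. -/
theorem exists_forall_lt_not {ι : Type*} [LinearOrder ι] {s k : ℕ} {A : ι → ι → Prop}
    {S : Finset ι} (hA : ∀ L ⊆ S, ∀ U ⊆ S, L.card = s → U.card = s → ¬ ∀ l ∈ L, ∀ u ∈ U, A l u)
    (hS : ram (s + s) k ≤ S.card) :
    ∃ T ⊆ S, T.card = k ∧ ∀ i ∈ T, ∀ j ∈ T, i < j → ¬ A i j := by
  rcases ramsey (s + s) k (fun i j => A (min i j) (max i j))
    (fun i j h => by rwa [min_comm, max_comm]) S hS with ⟨T, h1, h2, h3⟩ | ⟨T, h1, h2, h3⟩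
  · exfalso
    obtain ⟨L, hL, U, hU, hLc, hUc, hlt⟩ := exists_lt_split T h2
    refine hA L (hL.trans h1) U (hU.trans h1) hLc hUc fun l hl u hu => ?_
    have h := h3 l (hL hl) u (hU hu) (hlt l hl u hu).ne
    rwa [min_eq_left (hlt l hl u hu).le, max_eq_right (hlt l hl u hu).le] at h
  · refine ⟨T, h1, h2, fun i hi j hj hij => ?_⟩
    have h := h3 i hi j hj hij.ne
    rwa [min_eq_left hij.le, max_eq_right hij.le] at h

theorem exists_forall_ne_not {ι : Type*} {s k : ℕ} {A : ι → ι → Prop}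
    {S : Finset ι} (hA : ∀ L ⊆ S, ∀ U ⊆ S, L.card = s → U.card = s → ¬ ∀ l ∈ L, ∀ u ∈ U, A l u)
    (hS : ram (s + s) (ram (s + s) k) ≤ S.card) :
    ∃ T ⊆ S, T.card = k ∧ ∀ i ∈ T, ∀ j ∈ T, i ≠ j → ¬ A i j := by
  obtain ⟨_, -⟩ := exists_wellFoundedLT ι
  obtain ⟨T, h1, h2, h3⟩ := exists_forall_lt_not hA hS
  obtain ⟨T', h4, h5, h6⟩ := exists_forall_lt_not (A := fun i j => A j i) (S := T) (s := s) (k := k)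
    (fun L hL U hU hLc hUc h => hA U (hU.trans h1) L (hL.trans h1) hUc hLc
      fun u hu l hl => h l hl u hu) h2.ge
  refine ⟨T', h4.trans h1, h5, fun i hi j hj hij => ?_⟩
  rcases lt_or_gt_of_ne hij with h | h
  · exact h3 i (h4 hi) j (h4 hj) h
  · exact h6 j hj i hi h

/-- Finitely many properties, each of which can be obtained by passing to a subset, can be
obtained simultaneously. -/
theorem exists_subset_forall {ι κ : Type*} (C : Finset κ) (Q : κ → Finset ι → Prop)
    (hQ : ∀ c T T', T' ⊆ T → Q c T → Q c T') (F : ℕ → ℕ) (S : Finset ι)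
    (hF : ∀ c ∈ C, ∀ k, ∀ S' ⊆ S, F k ≤ S'.card → ∃ T ⊆ S', T.card = k ∧ Q c T) (k : ℕ)
    (hS : F^[C.card] k ≤ S.card) : ∃ T ⊆ S, T.card = k ∧ ∀ c ∈ C, Q c T := by
  classical
  induction C using Finset.induction_on generalizing S with
  | empty =>
    obtain ⟨T, h1, h2⟩ := Finset.exists_subset_card_eq (by simpa using hS : k ≤ S.card)
    exact ⟨T, h1, h2, by simp⟩
  | insert c C hc ih =>
    rw [Finset.card_insert_of_notMem hc, Function.iterate_succ_apply'] at hS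
    obtain ⟨S₁, h1, h2, h3⟩ := hF c (Finset.mem_insert_self c C) _ S subset_rfl hS
    obtain ⟨T, h4, h5, h6⟩ := ih S₁ (fun c' hc' k S' hS' => hF c' (Finset.mem_insert_of_mem hc') k S'
      (hS'.trans h1)) h2.ge
    refine ⟨T, h4.trans h1, h5, fun c' hc' => ?_⟩
    rcases Finset.mem_insert.1 hc' with rfl | hc'
    · exact hQ _ _ _ h4 h3
    · exact h6 c' hc'

section Biclique
variable {V : Type*} {G : SimpleGraph V} {X : Set V} {s : ℕ}

/-- The family `x` is constant on `T`. -/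
def IsConstOn {ι : Type*} (x : ι → V) (T : Finset ι) : Prop := ∀ i ∈ T, ∀ j ∈ T, x i = x j

/-- The families `x` and `y` have no coincidences and no edges between different indices in `T`,
unless one of them is constant. -/
def IsSeparated {ι : Type*} (G : SimpleGraph V) (x y : ι → V) (T : Finset ι) : Prop :=
  IsConstOn x T ∨ IsConstOn y T ∨ ∀ i ∈ T, ∀ j ∈ T, i ≠ j → x i ≠ y j ∧ ¬ G.Adj (x i) (y j)

theorem IsConstOn.mono {ι : Type*} {x : ι → V} {T T' : Finset ι} (h : IsConstOn x T)
    (hT : T' ⊆ T) : IsConstOn x T' := fun i hi j hj => h i (hT hi) j (hT hj)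

theorem IsSeparated.mono {ι : Type*} {x y : ι → V} {T T' : Finset ι} (h : IsSeparated G x y T)
    (hT : T' ⊆ T) : IsSeparated G x y T' := by
  rcases h with h | h | h
  · exact Or.inl (h.mono hT)
  · exact Or.inr (Or.inl (h.mono hT))
  · exact Or.inr (Or.inr fun i hi j hj => h i (hT hi) j (hT hj))

/-- The number of indices from which `k` can be chosen such that two families are separated. -/
def separationBound (s k : ℕ) : ℕ :=
  let p := ram (s + s) (ram (s + s) ((2 * 1 + 1) * k + 1)) + k
  let r := ram p p + k
  ram r r

theorem NoBiclique.exists_isSeparated {ι : Type*} (hX : NoBiclique G X s) (x y : ι → V) (k : ℕ)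
    (S : Finset ι) (hx : ∀ i ∈ S, x i ∈ X) (hy : ∀ i ∈ S, y i ∈ X)
    (hS : separationBound s k ≤ S.card) : ∃ T ⊆ S, T.card = k ∧ IsSeparated G x y T := by
  classical
  rcases exists_const_or_injOn _ x S hS with ⟨S₁, h1, h2, h3⟩ | ⟨S₁, h1, h2, h3⟩
  · obtain ⟨T, hT, hTc⟩ := Finset.exists_subset_card_eq (by rw [h2]; omega : k ≤ S₁.card)
    exact ⟨T, hT.trans h1, hTc, Or.inl (IsConstOn.mono h3 hT)⟩
  rcases exists_const_or_injOn (ram (s + s) (ram (s + s) ((2 * 1 + 1) * k + 1)) + k) y S₁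
    (by omega) with ⟨S₂, h4, h5, h6⟩ | ⟨S₂, h4, h5, h6⟩
  · obtain ⟨T, hT, hTc⟩ := Finset.exists_subset_card_eq (by rw [h5]; omega : k ≤ S₂.card)
    exact ⟨T, hT.trans (h4.trans h1), hTc, Or.inr (Or.inl (IsConstOn.mono h6 hT))⟩
  obtain ⟨S₃, h7, h8, h9⟩ := exists_forall_ne_not (A := fun i j => G.Adj (x i) (y j)) (S := S₂)
    (s := s) (k := (2 * 1 + 1) * k + 1) (fun L hL U hU hLc hUc h => by
      refine hX (L.image x) (U.image y) ?_ ?_ ?_ ?_ ?_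
      · rw [Finset.card_image_of_injOn, hLc]
        exact fun i hi j hj hij => h3 i (h4 (hL hi)) j (h4 (hL hj)) hij
      · rw [Finset.card_image_of_injOn, hUc]
        exact fun i hi j hj hij => h6 i (hU hi) j (hU hj) hij
      · intro a ha
        obtain ⟨i, hi, rfl⟩ := Finset.mem_image.1 ha
        exact hx i (h1 (h4 (hL hi)))
      · intro a ha
        obtain ⟨i, hi, rfl⟩ := Finset.mem_image.1 ha
        exact hy i (h1 (h4 (hU hi)))
      · intro a ha b hb
        obtain ⟨i, hi, rfl⟩ := Finset.mem_image.1 ha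
        obtain ⟨j, hj, rfl⟩ := Finset.mem_image.1 hb
        exact h i hi j hj) (by omega)
  obtain ⟨T, h10, h11, h12⟩ := exists_free_subset (R := fun i j => x i = y j) (D := 1) (k := k)
    (s := S₃) (fun i _ => by
      by_cases hi : ∃ j ∈ S₃, x i = y j
      · obtain ⟨j, hj, hij⟩ := hi
        refine ⟨{j}, by simp, fun j' hj' => ?_⟩
        rw [Finset.mem_singleton]
        exact h6 j' (h7 hj'.1) j (h7 hj) (hj'.2.2.symm.trans hij)
      · exact (few_false fun j hj => hi ⟨j, hj.1, hj.2.2⟩).mono (Nat.zero_le 1) fun _ h => h)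
    h8.ge
  exact ⟨T, h10.trans (h7.trans (h4.trans h1)), h11, Or.inr (Or.inr fun i hi j hj hij =>
    ⟨h12 i hi j hj hij, h9 i (h10 hi) j (h10 hj) hij⟩)⟩

/-- The bound in `NoBiclique.colorableOn_of_gadgets`. -/
def gadgetBound (s q k : ℕ) : ℕ :=
  (2 * (q + 2 ^ q * s) + 1) * (2 * (separationBound s)^[q * q] k + 1)

/-- Attach to each vertex `v ∈ X'` finitely many distinct vertices `x v b` of `X`. If `X'` cannot be
coloured with few colours, then some `u ∈ X'` has many neighbours in `X'` whose attached vertices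
are separated and mostly not adjacent to `u`. -/
theorem NoBiclique.colorableOn_of_gadgets [Finite V] (hX : NoBiclique G X s) {X' : Set V}
    (hX' : X' ⊆ X) {κ : Type*} [Fintype κ] {q : ℕ} (hq : Fintype.card κ = q) (k : ℕ) (x : V → κ → V)
    (hx : ∀ v ∈ X', ∀ b, x v b ∈ X) (hinj : ∀ v ∈ X', Function.Injective (x v))
    (h : ∀ u ∈ X', ∀ T : Finset V, T.card = k → (∀ t ∈ T, t ∈ X' ∧ G.Adj u t ∧ (∀ b, u ≠ x t b) ∧
      Few s (fun b => G.Adj u (x t b))) →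
      ¬ ∀ b b', IsSeparated G (fun t => x t b) (fun t => x t b') T) :
    ColorableOn G.Adj X' (gadgetBound s q k) := by
  classical
  -- the edges `u v` such that `u` is attached to `v` or adjacent to many vertices attached to `v`
  let S : V → V → Prop := fun v u => (∃ b, x v b = u) ∨ ¬ Few s (fun b => G.Adj u (x v b))
  have hfew : ∀ v ∈ X', Few (q + 2 ^ q * s) (fun u => u ∈ X' ∧ u ≠ v ∧ S v u) := by
    intro v hv
    have h1 : Few q (fun u => ∃ b, x v b = u) :=
      ⟨Finset.univ.image (x v), Finset.card_image_le.trans (by rw [Finset.card_univ, hq]),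
        fun u ⟨b, hb⟩ => Finset.mem_image.2 ⟨b, Finset.mem_univ b, hb⟩⟩
    have h2 : Few (2 ^ q * s) (fun u => u ∈ X' ∧ ¬ Few s (fun b => G.Adj u (x v b))) := by
      by_contra hcon
      obtain ⟨W, hWc, hW⟩ := exists_many_of_not_few hcon
      have : ∀ u ∈ W, ∃ B : Finset κ, B.card = s ∧ ∀ b ∈ B, G.Adj u (x v b) := fun u hu => by
        obtain ⟨B, hBc, hB⟩ := exists_many_of_not_few (hW u hu).2
        obtain ⟨B', hB', hBc'⟩ := Finset.exists_subset_card_eq (by omega : s ≤ B.card)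
        exact ⟨B', hBc', fun b hb => hB b (hB' hb)⟩
      choose! B hBc hB using this
      obtain ⟨B₀, -, W', hW', hWc', hWB⟩ := exists_fiber (m := 2 ^ q) (k := s) B Finset.univ
        (by rw [Finset.card_univ, Fintype.card_finset, hq]) (fun _ _ => Finset.mem_univ _) hWc.ge
      rcases W'.eq_empty_or_nonempty with rfl | ⟨u₀, hu₀⟩
      · have hs : s = 0 := by simpa using hWc'.symm
        subst hs
        exact hX ∅ ∅ rfl rfl (by simp) (by simp) (by simp)
      refine hX W' (B₀.image (x v)) hWc' ?_ (fun u hu => hX' (hW u (hW' hu)).1) ?_ ?_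
      · rw [Finset.card_image_of_injective _ (hinj v hv), ← hWB u₀ hu₀, hBc _ (hW' hu₀)]
      · intro a ha
        obtain ⟨b, -, rfl⟩ := Finset.mem_image.1 ha
        exact hx v hv b
      · intro u hu a ha
        obtain ⟨b, hb, rfl⟩ := Finset.mem_image.1 ha
        exact hB u (hW' hu) b (by rw [hWB u hu]; exact hb)
    exact (h1.or h2).mono le_rfl fun u hu => hu.2.2.imp id fun h => ⟨hu.1, h⟩
  obtain ⟨f, hf, hf'⟩ := ColorableOn.of_outdegree (X := X')
    (R := fun u v => G.Adj u v ∧ (S u v ∨ S v u)) (fun u _ v _ huv => ⟨huv.1.ne, huv.2⟩) hfew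
  refine ColorableOn.fibers f hf fun i _ => ?_
  refine ColorableOn.of_outdegree (S := G.Adj) (fun u _ v _ huv => ⟨huv.ne, Or.inl huv⟩) ?_
  intro u hu
  by_contra hcon
  obtain ⟨N, hNc, hN⟩ := exists_many_of_not_few hcon
  have hNX : ∀ t ∈ N, t ∈ X' := fun t ht => (hN t ht).1.1
  obtain ⟨T, hT, hTc, hsep⟩ := exists_subset_forall (Finset.univ : Finset (κ × κ))
    (fun c T => IsSeparated G (fun t => x t c.1) (fun t => x t c.2) T)
    (fun c T T' hT h => h.mono hT) (separationBound s) N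
    (fun c _ k S' hS' hk => hX.exists_isSeparated _ _ k S' (fun t ht => hx t (hNX t (hS' ht)) _)
      (fun t ht => hx t (hNX t (hS' ht)) _) hk) k (by
        rw [Finset.card_univ, Fintype.card_prod, hq]; omega)
  refine h u hu.1 T hTc (fun t ht => ?_) fun b b' => hsep (b, b') (Finset.mem_univ _)
  obtain ⟨⟨htX, hti⟩, -, hut⟩ := hN t (hT ht)
  have hS : ¬ S t u := fun hS => hf' u hu.1 t htX ⟨hut, Or.inr hS⟩ (hu.2.trans hti.symm)
  refine ⟨htX, hut, fun b hb => hS (Or.inl ⟨b, hb.symm⟩), ?_⟩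
  by_contra hno
  exact hS (Or.inr hno)

theorem IsSeparated.apart {ι : Type*} {x y : ι → V} {T : Finset ι} (h : IsSeparated G x y T)
    (hx : ¬ IsConstOn x T) (hy : ¬ IsConstOn y T) :
    ∀ i ∈ T, ∀ j ∈ T, i ≠ j → x i ≠ y j ∧ ¬ G.Adj (x i) (y j) :=
  (h.resolve_left hx).resolve_left hy

/-- Only few of the children of an injective family of vertices are constant. -/
theorem NoBiclique.few_isConstOn {ι κ : Type*} (hX : NoBiclique G X s) {T : Finset ι}
    (hT : s + 1 ≤ T.card) {p : ι → V} (hp : ∀ t ∈ T, ∀ t' ∈ T, p t = p t' → t = t')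
    {y : ι → κ → V} (hpX : ∀ t ∈ T, p t ∈ X) (hyX : ∀ t ∈ T, ∀ j, y t j ∈ X)
    (hadj : ∀ t ∈ T, ∀ j, G.Adj (p t) (y t j)) (hinj : ∀ t ∈ T, Function.Injective (y t)) :
    Few s (fun j => IsConstOn (fun t => y t j) T) := by
  classical
  by_contra hcon
  obtain ⟨S, hSc, hS⟩ := exists_many_of_not_few hcon
  obtain ⟨S', hS', hSc'⟩ := Finset.exists_subset_card_eq (by omega : s ≤ S.card)
  obtain ⟨T', hT', hTc'⟩ := Finset.exists_subset_card_eq (by omega : s ≤ T.card)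
  obtain ⟨t₀, ht₀⟩ := Finset.card_pos.1 (by omega : 0 < T.card)
  refine hX (T'.image p) (S'.image (y t₀)) ?_ ?_ ?_ ?_ ?_
  · rw [Finset.card_image_of_injOn, hTc']
    exact fun i hi j hj hij => hp i (hT' hi) j (hT' hj) hij
  · rw [Finset.card_image_of_injective _ (hinj t₀ ht₀), hSc']
  · intro a ha
    obtain ⟨i, hi, rfl⟩ := Finset.mem_image.1 ha
    exact hpX i (hT' hi)
  · intro a ha
    obtain ⟨i, hi, rfl⟩ := Finset.mem_image.1 ha
    exact hyX t₀ ht₀ i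
  · intro a ha b hb
    obtain ⟨t, ht, rfl⟩ := Finset.mem_image.1 ha
    obtain ⟨j, hj, rfl⟩ := Finset.mem_image.1 hb
    have h : y t₀ j = y t j := hS j (hS' hj) t₀ ht₀ t (hT' ht)
    rw [h]
    exact hadj t (hT' ht) j

end Biclique

section TwoParts
variable {V : Type*} {G : SimpleGraph V} {X : Set V} {s δ : ℕ}

/-- An induced tree in `X` with root `u`, whose root has the children `w i` for `i : Fin k`, and in
which `w i` has the children `y i j` for `j : Fin r`. -/
structure IsDoubleStar (G : SimpleGraph V) (X : Set V) {k r : ℕ} (u : V) (w : Fin k → V)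
    (y : Fin k → Fin r → V) : Prop where
  w_mem : ∀ i, w i ∈ X
  y_mem : ∀ i j, y i j ∈ X
  adj_w : ∀ i, G.Adj u (w i)
  adj_y : ∀ i j, G.Adj (w i) (y i j)
  root_ne : ∀ i j, u ≠ y i j
  root_not_adj : ∀ i j, ¬ G.Adj u (y i j)
  w_inj : ∀ i i', w i = w i' → i = i'
  w_stable : ∀ i i', ¬ G.Adj (w i) (w i')
  w_apart : ∀ i i' j, i ≠ i' → w i ≠ y i' j ∧ ¬ G.Adj (w i) (y i' j)
  y_apart : ∀ i i' j j', i ≠ i' → y i j ≠ y i' j' ∧ ¬ G.Adj (y i j) (y i' j')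
  y_inj : ∀ i j j', y i j = y i j' → j = j'
  y_stable : ∀ i j j', ¬ G.Adj (y i j) (y i j')

/-- The vertices of a double star, indexed by `none` for the root, and by the positions of the
others. -/
def treeVertex {k r : ℕ} (u : V) (w : Fin k → V) (y : Fin k → Fin r → V) :
    Option (Fin k ⊕ Fin k × Fin r) → V
  | none => u
  | some (Sum.inl i) => w i
  | some (Sum.inr (i, j)) => y i j

theorem IsDoubleStar.injective {k r : ℕ} {u : V} {w : Fin k → V} {y : Fin k → Fin r → V}
    (h : IsDoubleStar G X u w y) : Function.Injective (treeVertex u w y) := by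
  have hwy : ∀ i i' j, w i ≠ y i' j := by
    intro i i' j
    by_cases hi : i = i'
    · subst hi; exact (h.adj_y i j).ne
    · exact (h.w_apart i i' j hi).1
  rintro (_ | i | ⟨i, j⟩) (_ | i' | ⟨i', j'⟩) hab
  · rfl
  · exact ((h.adj_w i').ne hab).elim
  · exact (h.root_ne i' j' hab).elim
  · exact ((h.adj_w i).ne hab.symm).elim
  · rw [h.w_inj i i' hab]
  · exact (hwy i i' j' hab).elim
  · exact (h.root_ne i j hab.symm).elim
  · exact (hwy i' i j hab.symm).elim
  · by_cases hi : i = i'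
    · subst hi
      rw [h.y_inj i j j' hab]
    · exact ((h.y_apart i i' j j' hi).1 hab).elim

theorem NoBiclique.colorableOn_of_not_hasLeaves [Finite V] (hX : NoBiclique G X s) (m : ℕ)
    {X' : Set V} (hX' : X' ⊆ X) (h : ∀ v ∈ X', ¬ HasLeaves G m v X) :
    ColorableOn G.Adj X' (gadgetBound s 1 (m + 2)) := by
  refine hX.colorableOn_of_gadgets hX' (κ := Unit) (by simp) (m + 2) (fun v _ => v)
    (fun v hv _ => hX' hv) (fun v _ a b _ => rfl) fun u hu T hTc hT hsep => h u hu ?_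
  obtain ⟨a, ha, b, hb, hab⟩ := Finset.one_lt_card.1 (by omega : 1 < T.card)
  have hconst : ¬ IsConstOn (fun t : V => t) T := fun hc => hab (hc a ha b hb)
  have h1 := (hsep () ()).apart hconst hconst
  obtain ⟨L, hL, hLc⟩ := Finset.exists_subset_card_eq (by omega : m ≤ T.card)
  refine ⟨L, hLc, fun l hl => ⟨hX' (hT l (hL hl)).1, (hT l (hL hl)).2.1⟩, fun l hl l' hl' => ?_⟩
  by_cases hll : l = l'
  · subst hll; exact G.irrefl
  · exact (h1 l (hL hl) l' (hL hl') hll).2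

theorem exists_fin_of_finset {α : Type*} {n : ℕ} (L : Finset α) (hL : L.card = n) :
    ∃ y : Fin n → α, Function.Injective y ∧ ∀ j, y j ∈ L :=
  ⟨fun j => ((L.equivFinOfCardEq hL).symm j : α), fun _ _ h =>
    (L.equivFinOfCardEq hL).symm.injective (Subtype.ext h),
    fun j => ((L.equivFinOfCardEq hL).symm j).2⟩

theorem NoBiclique.colorableOn_of_not_isDoubleStar [Finite V] (hX : NoBiclique G X s) (k r : ℕ)
    {X' : Set V} (hX' : X' ⊆ X) (hleaf : ∀ v ∈ X', HasLeaves G (s + s + r) v X)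
    (h : ∀ u ∈ X', ∀ (w : Fin k → V) (y : Fin k → Fin r → V), ¬ IsDoubleStar G X u w y) :
    ColorableOn G.Adj X' (gadgetBound s (s + s + r + 1) (k + s + 2)) := by
  classical
  rcases isEmpty_or_nonempty V with hV | hV
  · exact ColorableOn.of_isEmpty fun v => hV.elim v
  have : ∀ v ∈ X', ∃ z : Fin (s + s + r) → V, Function.Injective z ∧
      (∀ j, z j ∈ X ∧ G.Adj v (z j)) ∧ ∀ j j', ¬ G.Adj (z j) (z j') := fun v hv => by
    obtain ⟨L, hLc, hL, hst⟩ := hleaf v hv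
    obtain ⟨z, hz, hzL⟩ := exists_fin_of_finset L hLc
    exact ⟨z, hz, fun j => hL _ (hzL j), fun j j' => hst _ (hzL j) _ (hzL j')⟩
  choose! z hzinj hz hzst using this
  let x : V → Option (Fin (s + s + r)) → V := fun v b => b.elim v (z v)
  refine hX.colorableOn_of_gadgets hX' (κ := Option (Fin (s + s + r))) (by simp) (k + s + 2) x
    ?_ ?_ fun u hu T hTc hT hsep => ?_
  · rintro v hv (_ | j)
    · exact hX' hv
    · exact (hz v hv j).1
  · rintro v hv (_ | j) (_ | j') hab
    · rfl
    · exact ((hz v hv j').2.ne hab).elim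
    · exact ((hz v hv j).2.ne hab.symm).elim
    · rw [hzinj v hv hab]
  obtain ⟨a, ha, b, hb, hab⟩ := Finset.one_lt_card.1 (by omega : 1 < T.card)
  have hroot : ¬ IsConstOn (fun t => x t none) T := fun hc => hab (hc a ha b hb)
  have hfew := hX.few_isConstOn (T := T) (by omega) (p := id) (fun _ _ _ _ h => h) (y := z)
    (fun t ht => hX' (hT t ht).1) (fun t ht j => (hz t (hT t ht).1 j).1)
    (fun t ht j => (hz t (hT t ht).1 j).2) fun t ht => hzinj t (hT t ht).1
  -- for each neighbour in `T`, discard the leaves that are constant or adjacent to `u`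
  have : ∀ t ∈ T, ∃ J : Fin r → Fin (s + s + r), Function.Injective J ∧
      ∀ j, ¬ IsConstOn (fun t => x t (some (J j))) T ∧ ¬ G.Adj u (z t (J j)) := fun t ht => by
    have h1 : Few s (fun j => G.Adj u (z t j)) := by
      have := (hT t ht).2.2.2.preimage (P := fun _ => True) (fun j : Fin (s + s + r) => some j)
        (fun a _ b _ hab => Option.some_injective _ hab)
      exact this.mono le_rfl fun j hj => ⟨trivial, hj⟩
    obtain ⟨B, -, hBc, hB⟩ := (hfew.or h1).exists_subset (S := Finset.univ) (k := r) (by simp)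
    obtain ⟨J, hJ, hJB⟩ := exists_fin_of_finset B hBc
    exact ⟨J, hJ, fun j => ⟨fun h => hB _ (hJB j) (Or.inl h), fun h => hB _ (hJB j) (Or.inr h)⟩⟩
  choose! J hJinj hJ using this
  obtain ⟨T', hT', hTc'⟩ := Finset.exists_subset_card_eq (by omega : k ≤ T.card)
  obtain ⟨w, hw, hwT'⟩ := exists_fin_of_finset T' hTc'
  have hwT : ∀ i, w i ∈ T := fun i => hT' (hwT' i)
  have hww := (hsep none none).apart hroot hroot
  refine h u hu w (fun i j => z (w i) (J (w i) (hwT i) j)) ⟨fun i => hX' (hT _ (hwT i)).1,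
    fun i j => (hz _ (hT _ (hwT i)).1 _).1, fun i => (hT _ (hwT i)).2.1,
    fun i j => (hz _ (hT _ (hwT i)).1 _).2, fun i j => (hT _ (hwT i)).2.2.1 (some _),
    fun i j => (hJ _ (hwT i) j).2, fun i i' h => hw h, fun i i' => ?_, fun i i' j hii => ?_,
    fun i i' j j' hii => ?_, fun i j j' h => hJinj _ (hwT i) (hzinj _ (hT _ (hwT i)).1 h),
    fun i j j' => hzst _ (hT _ (hwT i)).1 _ _⟩
  · by_cases hii : i = i'
    · subst hii; exact G.irrefl
    · exact (hww _ (hwT i) _ (hwT i') fun h => hii (hw h)).2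
  · exact (hsep none (some (J (w i') (hwT i') j))).apart hroot (hJ _ (hwT i') j).1 _ (hwT i) _ (hwT i')
      fun h => hii (hw h)
  · exact (hsep (some (J (w i) (hwT i) j)) (some (J (w i') (hwT i') j'))).apart (hJ _ (hwT i) j).1
      (hJ _ (hwT i') j').1 _ (hwT i) _ (hwT i') fun h => hii (hw h)

theorem NoBiclique.colorableOn_of_isDoubleStar [Finite V] (hX : NoBiclique G X s)
    (hfree : ¬ (T δ).IsIndContained G) {X' : Set V} (hX' : X' ⊆ X)
    (hstar : ∀ v ∈ X', ∃ (w : Fin (s + s + (δ + 1)) → V)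
      (y : Fin (s + s + (δ + 1)) → Fin (s + s + δ) → V), IsDoubleStar G X v w y) :
    ColorableOn G.Adj X' (gadgetBound s
      (s + s + (δ + 1) + (s + s + (δ + 1)) * (s + s + δ) + 1) (2 * δ + s + 2)) := by
  classical
  rcases isEmpty_or_nonempty V with hV | hV
  · exact ColorableOn.of_isEmpty fun v => hV.elim v
  choose! w y hy using hstar
  refine hX.colorableOn_of_gadgets hX' (by simp) (2 * δ + s + 2)
    (fun v => treeVertex v (w v) (y v)) ?_ (fun v hv => (hy v hv).injective)
    fun u hu T hTc hT hsep => hfree ?_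
  · rintro v hv (_ | i | ⟨i, j⟩)
    · exact hX' hv
    · exact (hy v hv).w_mem i
    · exact (hy v hv).y_mem i j
  have hY : ∀ t ∈ T, IsDoubleStar G X t (w t) (y t) := fun t ht => hy t (hT t ht).1
  let x : Option (Fin (s + s + (δ + 1)) ⊕ Fin (s + s + (δ + 1)) × Fin (s + s + δ)) → V → V :=
    fun b t => treeVertex t (w t) (y t) b
  obtain ⟨a, ha, b, hb, hab⟩ := Finset.one_lt_card.1 (by omega : 1 < T.card)
  have hroot : ¬ IsConstOn (x none) T := fun hc => hab (hc a ha b hb)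
  have hneu : ∀ t ∈ T, ∀ b, u ≠ x b t := fun t ht b => (hT t ht).2.2.1 b
  let O : V → Set V := fun t => {v | ∃ b, ¬ IsConstOn (x b) T ∧ v = x b t}
  have hO : ∀ t ∈ T, ∀ t' ∈ T, t ≠ t' → Apart G (O t) (O t') := by
    rintro t ht t' ht' htt _ ⟨b, hb, rfl⟩ _ ⟨b', hb', rfl⟩
    exact (hsep b b').apart hb hb' t ht t' ht' htt
  have hwfew := hX.few_isConstOn (T := T) (by omega) (p := id) (fun _ _ _ _ h => h) (y := w)
    (fun t ht => hX' (hT t ht).1) (fun t ht i => (hY t ht).w_mem i)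
    (fun t ht i => (hY t ht).adj_w i) fun t ht i i' h => (hY t ht).w_inj i i' h
  -- the children that are neither constant nor adjacent to `u`
  have hchild : ∀ t ∈ T, ∃ B : Finset (Fin (s + s + (δ + 1))), B.card = δ + 1 ∧
      ∀ i ∈ B, ¬ IsConstOn (x (some (Sum.inl i))) T ∧ ¬ G.Adj u (w t i) := fun t ht => by
    have h1 : Few s (fun i => G.Adj u (w t i)) :=
      ((hT t ht).2.2.2.preimage (P := fun _ => True)
        (fun i : Fin (s + s + (δ + 1)) => some (Sum.inl i))
        (fun a _ b _ hab => by simpa using hab)).mono le_rfl fun j hj => ⟨trivial, hj⟩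
    obtain ⟨B, -, hBc, hB⟩ := (hwfew.or h1).exists_subset (S := Finset.univ) (k := δ + 1) (by simp)
    exact ⟨B, hBc, fun i hi => ⟨fun h => hB i hi (Or.inl h), fun h => hB i hi (Or.inr h)⟩⟩
  refine isIndContained_of_brooms (u := u) T (by omega) O (fun t ht => ?_) (fun t ht => ?_) hO
  · obtain ⟨B, hBc, hB⟩ := hchild t ht
    obtain ⟨B', hB', hBc'⟩ := Finset.exists_subset_card_eq (by omega : δ ≤ B.card)
    refine ⟨t, B'.image (w t), ⟨(hT t ht).2.1, ?_, ?_, ?_, ?_, ?_⟩, ⟨none, hroot, rfl⟩, ?_⟩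
    · rw [Finset.card_image_of_injective _ fun i i' h => (hY t ht).w_inj i i' h, hBc']
    · simp only [Finset.forall_mem_image]
      exact fun i _ => (hY t ht).adj_w i
    · simp only [Finset.forall_mem_image]
      exact fun i hi => (hB i (hB' hi)).2
    · simp only [Finset.forall_mem_image]
      exact fun i hi => hneu t ht (some (Sum.inl i))
    · simp only [Finset.forall_mem_image]
      exact fun i _ i' _ => (hY t ht).w_stable i i'
    · simp only [Finset.forall_mem_image]
      exact fun i hi => ⟨some (Sum.inl i), (hB i (hB' hi)).1, rfl⟩
  · obtain ⟨B, hBc, hB⟩ := hchild t ht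
    obtain ⟨i, hi⟩ := Finset.card_pos.1 (by omega : 0 < B.card)
    obtain ⟨hci, hui⟩ := hB i hi
    have hyfew := hX.few_isConstOn (T := T) (by omega) (p := fun t => w t i)
      (fun t ht t' ht' h => by
        by_contra hne
        exact ((hsep (some (Sum.inl i)) (some (Sum.inl i))).apart hci hci t ht t' ht' hne).1 h)
      (y := fun t => y t i) (fun t ht => (hY t ht).w_mem i) (fun t ht j => (hY t ht).y_mem i j)
      (fun t ht j => (hY t ht).adj_y i j) fun t ht j j' h => (hY t ht).y_inj i j j' h
    have h1 : Few s (fun j => G.Adj u (y t i j)) :=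
      ((hT t ht).2.2.2.preimage (P := fun _ => True)
        (fun j : Fin (s + s + δ) => some (Sum.inr (i, j)))
        (fun a _ b _ hab => by simpa using hab)).mono le_rfl fun j hj => ⟨trivial, hj⟩
    obtain ⟨C, -, hCc, hC⟩ := (hyfew.or h1).exists_subset (S := Finset.univ) (k := δ) (by simp)
    refine ⟨t, w t i, C.image (y t i), (hT t ht).2.1, ⟨(hY t ht).adj_w i, ?_, ?_, ?_, ?_, ?_⟩,
      hneu t ht (some (Sum.inl i)), hui, ?_, ⟨none, hroot, rfl⟩, ⟨_, hci, rfl⟩, ?_⟩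
    · rw [Finset.card_image_of_injective _ fun j j' h => (hY t ht).y_inj i j j' h, hCc]
    · simp only [Finset.forall_mem_image]
      exact fun j _ => (hY t ht).adj_y i j
    · simp only [Finset.forall_mem_image]
      exact fun j _ => (hY t ht).root_not_adj i j
    · simp only [Finset.forall_mem_image]
      exact fun j _ => (hY t ht).root_ne i j
    · simp only [Finset.forall_mem_image]
      exact fun j _ j' _ => (hY t ht).y_stable i j j'
    · simp only [Finset.forall_mem_image]
      exact fun j hj => ⟨hneu t ht (some (Sum.inr (i, j))), fun h => hC j hj (Or.inr h)⟩
    · simp only [Finset.forall_mem_image]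
      exact fun j hj => ⟨some (Sum.inr (i, j)), fun h => hC j hj (Or.inl h), rfl⟩

/-- The chromatic bound for `T δ`-free graphs without large bicliques. -/
def bicliqueBound (δ s : ℕ) : ℕ :=
  gadgetBound s 1 (s + s + (s + s + δ) + 2) +
    gadgetBound s (s + s + (s + s + δ) + 1) (s + s + (δ + 1) + s + 2) +
    gadgetBound s (s + s + (δ + 1) + (s + s + (δ + 1)) * (s + s + δ) + 1) (2 * δ + s + 2)

/-- A `T δ`-free graph without large bicliques has bounded chromatic number: otherwise the tree is
grown by one level at a time. -/
theorem NoBiclique.colorableOn [Finite V] (hX : NoBiclique G X s)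
    (hfree : ¬ (T δ).IsIndContained G) : ColorableOn G.Adj X (bicliqueBound δ s) := by
  classical
  let X₁ : Set V := {v | v ∈ X ∧ HasLeaves G (s + s + (s + s + δ)) v X}
  let X₂ : Set V := {v | v ∈ X₁ ∧ ∃ (w : Fin (s + s + (δ + 1)) → V)
      (y : Fin (s + s + (δ + 1)) → Fin (s + s + δ) → V), IsDoubleStar G X v w y}
  have h1 := hX.colorableOn_of_not_hasLeaves (s + s + (s + s + δ)) (X' := X \ X₁) Set.sdiff_subset
    fun v hv h => hv.2 ⟨hv.1, h⟩
  have h2 := hX.colorableOn_of_not_isDoubleStar (s + s + (δ + 1)) (s + s + δ) (X' := X₁ \ X₂)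
    (fun v hv => hv.1.1) (fun v hv => hv.1.2) fun v hv w y h => hv.2 ⟨hv.1, w, y, h⟩
  have h3 := hX.colorableOn_of_isDoubleStar hfree (X' := X₂) (fun v hv => hv.1.1) fun v hv => hv.2
  refine ((h1.union h2).union h3).mono (fun v hv => ?_) le_rfl
  by_cases hv1 : v ∈ X₁
  · by_cases hv2 : v ∈ X₂
    · exact Or.inr hv2
    · exact Or.inl (Or.inr ⟨hv1, hv2⟩)
  · exact Or.inl (Or.inl ⟨hv, hv1⟩)

end TwoParts

/-! ### Induction on the number of parts -/

theorem IsPartite.mono {V : Type*} {G : SimpleGraph V} {X Y : Set V} {a b : ℕ}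
    {A : Fin b → Finset V} (h : IsPartite G X a b A) (hXY : X ⊆ Y) : IsPartite G Y a b A :=
  ⟨h.card, fun i x hx => hXY (h.sub i x hx), h.stable, h.adj⟩

theorem Tame.noBiclique {V : Type*} {G : SimpleGraph V} {X : Set V} {δ τ α : ℕ}
    (hG : Tame G δ τ) (hX : ∀ A, ¬ IsPartite G X α 2 A) : NoBiclique G X (ram (τ + 1) α) := by
  intro A B hA hB hAX hBX hAB
  obtain ⟨A', hA', hAc, hAs⟩ := hG.exists_nonadj α id A hA.ge
  obtain ⟨B', hB', hBc, hBs⟩ := hG.exists_nonadj α id B hB.ge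
  refine hX ![A', B'] ⟨?_, ?_, ?_, ?_⟩
  · simp [Fin.forall_fin_two, hAc, hBc]
  · simp only [Fin.forall_fin_two, Matrix.cons_val_zero, Matrix.cons_val_one]
    exact ⟨fun x hx => hAX x (hA' hx), fun x hx => hBX x (hB' hx)⟩
  · simp only [Fin.forall_fin_two, Matrix.cons_val_zero, Matrix.cons_val_one]
    exact ⟨hAs, hBs⟩
  · simp only [Fin.forall_fin_two, Matrix.cons_val_zero, Matrix.cons_val_one]
    exact ⟨⟨fun h => (h rfl).elim, fun _ x hx y hy => hAB x (hA' hx) y (hB' hy)⟩,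
      fun _ x hx y hy => (hAB y (hA' hy) x (hB' hx)).symm, fun h => (h rfl).elim⟩

/-- The chromatic bound for the set on top of a tower that lacks `n` layers of its full height. -/
def descentBound (α β δ τ t : ℕ) : ℕ → ℕ
  | 0 => towerBound δ τ (layerBound α β δ τ)
  | n + 1 => descentBound α β δ τ t n + descentBound α β δ τ t n + remainderBound α β δ τ t

/-- Downward induction on the height of a tower of layers: a set on top of a tower consists of two
sets on top of higher towers and a remainder of bounded chromatic number. -/
theorem colorableOn_of_partial_tower {V : Type*} [Finite V] {G : SimpleGraph V} {X : Set V}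
    {δ τ α β t : ℕ} (hβ : 2 ≤ β) (hG : Tame G δ τ) (hX : ∀ A, ¬ IsPartite G X α (β + 1) A)
    (ht : ∀ Y ⊆ X, (∀ A, ¬ IsPartite G Y (partSize α δ) β A) → ColorableOn G.Adj Y t)
    (n j : ℕ) (hn : j + n = blockSize δ τ * blockSize δ τ) (U : ℕ → Set V) (hUX : U j ⊆ X)
    (hU : ∀ r < j, Nonempty (Layer G δ (layerBound α β δ τ) (U r) (U (r + 1)))) :
    ColorableOn G.Adj (U j) (descentBound α β δ τ t n) := by
  induction n generalizing j U with
  | zero =>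
    obtain rfl : j = blockSize δ τ * blockSize δ τ := by omega
    exact colorableOn_of_tower hG U hU
  | succ n ih =>
    have hUj : ∀ A, ¬ IsPartite G (U j) α (β + 1) A := fun A h => hX A (h.mono hUX)
    obtain ⟨𝒢⟩ := exists_greedy G δ α β (U j)
    have hext : ∀ U', Nonempty (Layer G δ (layerBound α β δ τ) (U j) U') →
        ColorableOn G.Adj U' (descentBound α β δ τ t n) := by
      intro U' hU'
      have h := ih (j + 1) (by omega) (fun r => if r ≤ j then U r else U') ?_ ?_
      · simpa using h
      · obtain ⟨L⟩ := hU'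
        simpa using L.sub.trans hUX
      · intro r hr
        rcases Nat.lt_succ_iff_lt_or_eq.1 hr with hr | rfl
        · simpa [hr.le, Nat.succ_le_of_lt hr] using hU r hr
        · simpa using hU'
    have h1 := hext _ (𝒢.nonempty_coreLayer hβ hG)
    have h2 := hext _ (𝒢.nonempty_hubLayer hβ hG hUj)
    have h3 := 𝒢.colorableOn_remainder hβ hG hUj fun Y hY => ht Y (hY.trans hUX)
    refine ((h1.union h2).union h3).mono (fun x hx => ?_) le_rfl
    by_cases h : x ∈ 𝒢.coreLayer ∪ 𝒢.hubLayer
    · exact Or.inl h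
    · exact Or.inr ⟨hx, h⟩

/-- Sets without a complete `(b + 2)`-partite subgraph with parts of size `α` have bounded chromatic
number in tame graphs. -/
theorem exists_forall_colorableOn (δ τ b : ℕ) : ∀ α, ∃ c, ∀ (V : Type u) [Finite V]
    (G : SimpleGraph V), Tame G δ τ → ∀ X : Set V, (∀ A, ¬ IsPartite G X α (b + 2) A) →
      ColorableOn G.Adj X c := by
  induction b with
  | zero =>
    exact fun α => ⟨bicliqueBound δ (ram (τ + 1) α), fun V _ G hG X hX =>
      (hG.noBiclique hX).colorableOn hG.free⟩
  | succ b ih =>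
    intro α
    obtain ⟨t, ht⟩ := ih (partSize α δ)
    exact ⟨descentBound α (b + 2) δ τ t (blockSize δ τ * blockSize δ τ), fun V _ G hG X hX =>
      colorableOn_of_partial_tower (by omega) hG hX (fun Y _ hY => ht V G hG Y hY) _ 0
        (Nat.zero_add _) (fun _ => X) subset_rfl fun r hr => (Nat.not_lt_zero r hr).elim⟩

/-! ### Chromatic numbers -/

theorem colorableOn_of_chi_le {V : Type*} {G : SimpleGraph V} {X : Set V} {k : ℕ}
    (h : chi G X ≤ (k : ℕ∞)) : ColorableOn G.Adj X k := by
  classical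
  obtain ⟨f⟩ := SimpleGraph.chromaticNumber_le_iff_colorable.1 h
  refine ⟨fun v => if hv : v ∈ X then (f ⟨v, hv⟩ : ℕ) else 0, fun v hv => ?_, fun u hu v hv huv => ?_⟩
  · simp only [hv, dif_pos]
    exact (f ⟨v, hv⟩).2
  · simp only [hu, hv, dif_pos]
    intro heq
    exact f.valid (v := ⟨u, hu⟩) (w := ⟨v, hv⟩) huv (Fin.ext heq)

theorem ColorableOn.chromaticNumber_le {V : Type*} {G : SimpleGraph V} {k : ℕ}
    (h : ColorableOn G.Adj Set.univ k) : G.chromaticNumber ≤ (k : ℕ∞) := by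
  obtain ⟨f, h1, h2⟩ := h
  refine SimpleGraph.chromaticNumber_le_iff_colorable.2 ⟨SimpleGraph.Coloring.mk
    (fun v => (⟨f v, h1 v trivial⟩ : Fin k)) fun {u v} huv heq => ?_⟩
  exact h2 u trivial v trivial huv (Fin.mk.inj_iff.1 heq)

theorem mem_closedBall_two {V : Type*} {G : SimpleGraph V} {v w : V}
    (h : w = v ∨ G.Adj v w ∨ ∃ m, G.Adj v m ∧ G.Adj m w) : w ∈ closedBall G 2 v := by
  have key : ∀ p : G.Walk v w, p.length ≤ 2 → G.edist v w ≤ (2 : ℕ) := fun p hp =>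
    (SimpleGraph.Walk.edist_le p).trans (by exact_mod_cast hp)
  rcases h with rfl | h | ⟨m, h1, h2⟩
  · exact key .nil (by simp)
  · exact key (.cons h .nil) (by simp)
  · exact key (.cons h1 (.cons h2 .nil)) (by simp)

theorem tame_of_chi_le {V : Type*} {G : SimpleGraph V} {δ τ : ℕ} (hfree : IsFree G (T δ))
    (hball : chiBall G 2 ≤ (τ : ℕ∞))
    (hmatch : ∀ X : Set V, IsMatchingCovered G X → chi G X ≤ (τ : ℕ∞)) : Tame G δ τ where
  free := hfree
  ball v := (colorableOn_of_chi_le ((le_iSup (fun v => chi G (closedBall G 2 v)) v).trans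
    hball)).mono (fun _ => mem_closedBall_two) le_rfl
  matching X hX := colorableOn_of_chi_le (hmatch X hX)

theorem IsPartite.admitsCore {V : Type*} {G : SimpleGraph V} {X : Set V} {a b : ℕ}
    {A : Fin b → Finset V} (h : IsPartite G X a b A) : AdmitsCore G a b := by
  classical
  have hdisj : ∀ i j, i ≠ j → Disjoint (A i) (A j) := fun i j hij =>
    Finset.disjoint_left.2 fun x hx hx' => (h.adj i j hij x hx x hx').ne rfl
  refine ⟨Finset.univ.biUnion A, ?_, A, by simp, hdisj, h.card,
    fun i x hx y hy _ => h.stable i x hx y hy, fun i j hij => h.adj i j hij.ne⟩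
  rw [Finset.card_biUnion fun i _ j _ hij => hdisj i j hij]
  simp [h.card, mul_comm]

end Multibroom

theorem theorem2p5 (τ α δ β : ℕ) (hα : 1 ≤ α) (hδ : 1 ≤ δ) (hβ : 2 ≤ β)
    (θ : ℕ → ℕ) (hθ : Monotone θ) :
    ∃ c : ℕ, ∀ (V : Type*) [Finite V] (G : SimpleGraph V),
      Multibroom.IsFree G (Multibroom.T δ) →
      Multibroom.chiBall G 2 ≤ (τ : ℕ∞) →
      (∀ X : Set V, Multibroom.IsMatchingCovered G X → Multibroom.chi G X ≤ (τ : ℕ∞)) →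
      (∀ a : ℕ, 1 ≤ a → (θ a : ℕ∞) < G.chromaticNumber → Multibroom.AdmitsCore G a β) →
      ¬ Multibroom.AdmitsCore G α (β + 1) →
      G.chromaticNumber ≤ (c : ℕ∞) := by
  obtain ⟨b, rfl⟩ : ∃ b, β = b + 1 := ⟨β - 1, by omega⟩
  obtain ⟨c, hc⟩ := Multibroom.exists_forall_colorableOn δ τ b α
  exact ⟨c, fun V _ G hfree hball hmatch _ hcore =>
    (hc V G (Multibroom.tame_of_chi_le hfree hball hmatch) Set.univ fun _ hA =>
      hcore hA.admitsCore).chromaticNumber_le⟩
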